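/- Let $\lambda:\mathbb{R}\to\mathbb{R}$ be a $C^\infty$ function such that (1) $\lambda(x)=0$ for $x\le 0$; (2) $\lambda(x)>1$ for $x>1$; (3) $\lambda''(x)\ge 100\,\lambda'(x)$ for all $x$; (4) $\lambda''(x)>0$ for $x>0$; (5) $\lambda'(x)>100$ whenever $\lambda(x)>\frac12$. For $r>1$ let $$\rho_r(z,w)=\left|w+e^{i\log|z|^2}\right|^2-1+\lambda\!\left(\frac1{|z|^2}-1\right)+\lambda\left(|z|^2-r^2\right)\qquad(z\in\mathbb{C}\setminus\{0\},\ w\in\mathbb{C}),$$ and let $\Omega_r=\{(z,w)\in(\mathbb{C}\setminus\{0\})\times\mathbb{C}:\rho_r(z,w)<0\}$ be the Diederich–Fornæss worm domain. A $C^k$ defining function for an open set $\Omega\subset\mathbb{C}^2$ is a real-valued function $\rho$, of class $C^k$ on a neighborhood $U$ of $\overline\Omega$, with $\Omega=\{p\in U:\rho(p)<0\}$ and $d\rho\ne0$ on $b\Omega$. A number $\tau\in(0,1)$ is a Diederich–Fornæss exponent for $\Omega$ if there is a $C^\infty$ defining function $\rho$ for $\Omega$ such that $-(-\rho)^\tau$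 is plurisubharmonic on $\Omega$, and the Diederich–Fornæss index of $\Omega$ is the supremum of its Diederich–Fornæss exponents. A set $\Omega$ with $C^2$ boundary is pseudoconvex if at every boundary point the Levi form of every $C^2$ defining function is nonnegative on complex tangent vectors; a boundary point is weakly pseudoconvex if the Levi form is nonnegative but not positive definite there. Then $\Omega_r$ is pseudoconvex, its set of weakly pseudoconvex boundary points is the annulus $M_r=\{(z,w):1\le|z|\le r,\ w=0\}$, and its Diederich–Fornæss index equals $$\frac{\pi}{\log r^2+\pi}.$$ -/

import Mathlib

open scoped ContDiff ComplexConjugate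

namespace Worm

/-- The complex coordinate directions of `ℂ × ℂ`: `(1, 0)` for `z` and `(0, 1)` for `w`. -/
def e : Fin 2 → ℂ × ℂ := ![(1, 0), (0, 1)]

/-- The coordinates `(t₁, t₂)` of a vector `t` of `ℂ × ℂ`. -/
def coord (t : ℂ × ℂ) : Fin 2 → ℂ := ![t.1, t.2]

/-- The Wirtinger derivative `∂f/∂z_j = (∂f/∂x_j - i ∂f/∂y_j) / 2`. -/
noncomputable def dz (j : Fin 2) (f : ℂ × ℂ → ℂ) (p : ℂ × ℂ) : ℂ :=
  (fderiv ℝ f p (e j) - Complex.I * fderiv ℝ f p (Complex.I • e j)) / 2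

/-- The Wirtinger derivative `∂f/∂z̄_j = (∂f/∂x_j + i ∂f/∂y_j) / 2`. -/
noncomputable def dzbar (j : Fin 2) (f : ℂ × ℂ → ℂ) (p : ℂ × ℂ) : ℂ :=
  (fderiv ℝ f p (e j) + Complex.I * fderiv ℝ f p (Complex.I • e j)) / 2

/-- The complex Hessian form `∑ⱼₖ (∂²f/∂z_j ∂z̄_k)(p) t_j t̄_k` of a real function `f`. (For `f` of
class `C²` near `p` the sum is real; the real part only turns it into a real number.) -/
noncomputable def leviForm (f : ℂ × ℂ → ℝ) (p t : ℂ × ℂ) : ℝ :=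
  (∑ j : Fin 2, ∑ k : Fin 2,
    dz j (dzbar k (fun q => (f q : ℂ))) p * coord t j * conj (coord t k)).re

/-- `∑ⱼ (∂f/∂z_j)(p) t_j = 0`: the vector `t` is complex tangential to the level set of `f`. -/
def IsComplexTangent (f : ℂ × ℂ → ℝ) (p t : ℂ × ℂ) : Prop :=
  ∑ j : Fin 2, dz j (fun q => (f q : ℂ)) p * coord t j = 0

/-- `ρ` is a defining function of class `C^n` for `Ω`: it is `C^n` on a neighborhood `U` of the
closure of `Ω`, `Ω = {ρ < 0}`, and `dρ ≠ 0` on the boundary. -/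
def IsDefiningFunction (n : WithTop ℕ∞) (Ω : Set (ℂ × ℂ)) (ρ : ℂ × ℂ → ℝ) : Prop :=
  ∃ U : Set (ℂ × ℂ), IsOpen U ∧ closure Ω ⊆ U ∧ ContDiffOn ℝ n ρ U ∧
    Ω = {p | p ∈ U ∧ ρ p < 0} ∧ ∀ p ∈ frontier Ω, fderiv ℝ ρ p ≠ 0

/-- A function is `C²` and plurisubharmonic on the (open) set `Ω`. -/
def IsPlurisubharmonicOn (φ : ℂ × ℂ → ℝ) (Ω : Set (ℂ × ℂ)) : Prop :=
  ContDiffOn ℝ 2 φ Ω ∧ ∀ p ∈ Ω, ∀ t : ℂ × ℂ, 0 ≤ leviForm φ p t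

/-- The Levi form of every `C²` defining function is nonnegative at the boundary point `p`. -/
def IsPseudoconvexAt (Ω : Set (ℂ × ℂ)) (p : ℂ × ℂ) : Prop :=
  ∀ ρ : ℂ × ℂ → ℝ, IsDefiningFunction 2 Ω ρ →
    ∀ t : ℂ × ℂ, IsComplexTangent ρ p t → 0 ≤ leviForm ρ p t

/-- The Levi form of every `C²` defining function is positive definite at the boundary point `p`. -/
def IsStrictlyPseudoconvexAt (Ω : Set (ℂ × ℂ)) (p : ℂ × ℂ) : Prop :=
  ∀ ρ : ℂ × ℂ → ℝ, IsDefiningFunction 2 Ω ρ →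
    ∀ t : ℂ × ℂ, t ≠ 0 → IsComplexTangent ρ p t → 0 < leviForm ρ p t

/-- `Ω` has `C²` boundary and is (Levi) pseudoconvex. -/
def IsPseudoconvex (Ω : Set (ℂ × ℂ)) : Prop :=
  (∃ ρ : ℂ × ℂ → ℝ, IsDefiningFunction 2 Ω ρ) ∧ ∀ p ∈ frontier Ω, IsPseudoconvexAt Ω p

/-- The boundary points at which `Ω` is pseudoconvex but not strictly pseudoconvex. -/
def weaklyPseudoconvexPoints (Ω : Set (ℂ × ℂ)) : Set (ℂ × ℂ) :=
  {p | p ∈ frontier Ω ∧ IsPseudoconvexAt Ω p ∧ ¬ IsStrictlyPseudoconvexAt Ω p}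

/-- `τ ∈ (0, 1)` is a Diederich–Fornæss exponent for `Ω`: there is a smooth defining function `ρ`
such that `-(-ρ)^τ` is plurisubharmonic on `Ω`. -/
def IsDFExponent (Ω : Set (ℂ × ℂ)) (τ : ℝ) : Prop :=
  0 < τ ∧ τ < 1 ∧ ∃ ρ : ℂ × ℂ → ℝ, IsDefiningFunction ∞ Ω ρ ∧
    IsPlurisubharmonicOn (fun p => -((-ρ p) ^ τ)) Ω

/-- The Diederich–Fornæss index: the supremum of all Diederich–Fornæss exponents. -/
noncomputable def dfIndex (Ω : Set (ℂ × ℂ)) : ℝ := sSup {τ : ℝ | IsDFExponent Ω τ}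

/-- The conditions on the cut-off function used to construct a worm domain. -/
structure IsWormProfile (lam : ℝ → ℝ) : Prop where
  smooth : ContDiff ℝ ∞ lam
  eq_zero : ∀ x, x ≤ 0 → lam x = 0
  one_lt : ∀ x, 1 < x → 1 < lam x
  le_deriv_deriv : ∀ x, 100 * deriv lam x ≤ deriv (deriv lam) x
  deriv_deriv_pos : ∀ x, 0 < x → 0 < deriv (deriv lam) x
  lt_deriv : ∀ x, 1 / 2 < lam x → 100 < deriv lam x

/-- `ρ_r(z, w) = |w + e^{i log (z z̄)}|² - 1 + λ(1/|z|² - 1) + λ(|z|² - r²)`, for `z ≠ 0`. -/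
noncomputable def wormFunction (lam : ℝ → ℝ) (r : ℝ) (p : ℂ × ℂ) : ℝ :=
  ‖p.2 + Complex.exp (Complex.I * (Real.log (‖p.1‖ ^ 2) : ℂ))‖ ^ 2 - 1
    + lam (1 / ‖p.1‖ ^ 2 - 1) + lam (‖p.1‖ ^ 2 - r ^ 2)

/-- The worm domain `{ρ_r < 0}`. The formula for `ρ_r` has no meaning at `z = 0` (it tends to `+∞`
there), so these points are excluded explicitly. -/
def wormDomain (lam : ℝ → ℝ) (r : ℝ) : Set (ℂ × ℂ) :=
  {p | p.1 ≠ 0 ∧ wormFunction lam r p < 0}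

end Worm

/-! Put x = log|z| and W = w e^{-i log|z|²}. The defining function becomes |1+W|² - 1 + C(x), where
C collects the cut-off terms. On the holomorphic discs ζ ↦ (z e^{ηζ}, w + ζt) the variable x is
affine and the phase rotates at constant speed, so first and second derivatives are explicit
(`wormFunction_data`). Multiplied by |1+W|², the complex Hessian can be rewritten through the
half-differential E (`worm_levi_identity`). At a boundary point and on complex tangents E = 0, and a
sum of nonnegative terms times |η|² remains. Over 1 ≤ |z| ≤ r this sum is |W|², so positivity fails
only on the annulus w = 0. Defining functions have positively proportional Levi forms on complex
tangents, so the choice of function is immaterial.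

Exponents exist: multiply the worm function by a weight m(log|z|). Near the annulus, positivity of
the complex Hessian of -(-ρ)^τ amounts to positivity of a 2×2 Hermitian form in E and δη, where δ is
minus the worm function. Its discriminant condition on the annulus is a Riccati inequality for m'/m.
The substitution m = s^{(1-τ)/τ} linearizes it, and a cosine s of frequency 2k with k > τ/(1-τ) is a
solution. Such a cosine is positive on [0, log r] when 2k log r < π. The other boundary points are
strictly pseudoconvex and need no care, and a convex truncation makes the function harmless deep
inside (`isDFExponent_of_eventually`).

No larger exponent exists: suppose 2τ/(1-τ) log r > π and choose k < τ/(1-τ) with 2k log r > π.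
Along the holomorphic curves `leaf`, with ζ = x + iy measured from the middle of the annulus,
(-ρ/ε)^τ tends as ε → 0 to Φ = (2h)^τ e^{-2τ(1+k)y} cos(2kx)^τ, where h > 0 depends only on the
point of the annulus. If -(-ρ)^τ is plurisubharmonic, then Φ must be superharmonic. But
e^{-2τ(1+k)y} cos(2kx) is strictly subharmonic where the cosine is positive, because k < τ(1+k), and
its quotient by Φ has an interior maximum on a compact annulus. A multiple of Φ is thus touched from
below (`exists_touching`), against the maximum principle (`not_touching`). -/

open Filter Topology

namespace Worm

/-! ### Second-order jets in one real variable. -/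

/-- `g` has first derivative `b` and second derivative `c` at `s`. -/
structure HasTwoJetAt (g : ℝ → ℝ) (b c s : ℝ) : Prop where
  eventually_differentiableAt : ∀ᶠ x in 𝓝 s, DifferentiableAt ℝ g x
  hasDerivAt : HasDerivAt g b s
  hasDerivAt_deriv : HasDerivAt (deriv g) c s

namespace HasTwoJetAt

variable {f g : ℝ → ℝ} {b c b' c' s : ℝ}

theorem of_hasDerivAt {g' : ℝ → ℝ} (h : ∀ᶠ x in 𝓝 s, HasDerivAt g (g' x) x)
    (h' : HasDerivAt g' c s) : HasTwoJetAt g (g' s) c s where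
  eventually_differentiableAt := h.mono fun _ hx => hx.differentiableAt
  hasDerivAt := h.self_of_nhds
  hasDerivAt_deriv := h'.congr_of_eventuallyEq (h.mono fun _ hx => hx.deriv)

theorem of_contDiffAt (h : ContDiffAt ℝ 2 g s) :
    HasTwoJetAt g (deriv g s) (deriv (deriv g) s) s where
  eventually_differentiableAt :=
    (h.eventually (by simp)).mono fun _ hx => hx.differentiableAt (by simp)
  hasDerivAt := (h.differentiableAt (by simp)).hasDerivAt
  hasDerivAt_deriv := by
    have h1 : ContDiffAt ℝ 1 (deriv g) s := by
      have : ContDiffAt ℝ 1 (fderiv ℝ g) s := h.fderiv_right (by norm_num)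
      exact this.clm_apply contDiffAt_const
    exact (h1.differentiableAt (by simp)).hasDerivAt

theorem congr_of_eventuallyEq (h : HasTwoJetAt g b c s) (hfg : f =ᶠ[𝓝 s] g) :
    HasTwoJetAt f b c s where
  eventually_differentiableAt := by
    filter_upwards [h.eventually_differentiableAt, hfg.eventuallyEq_nhds] with x hx hx'
    exact hx.congr_of_eventuallyEq hx'
  hasDerivAt := h.hasDerivAt.congr_of_eventuallyEq hfg
  hasDerivAt_deriv := h.hasDerivAt_deriv.congr_of_eventuallyEq hfg.deriv

theorem unique (h : HasTwoJetAt g b c s) (h' : HasTwoJetAt g b' c' s) : b = b' ∧ c = c' :=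
  ⟨h.hasDerivAt.unique h'.hasDerivAt, h.hasDerivAt_deriv.unique h'.hasDerivAt_deriv⟩

theorem congr_jet (h : HasTwoJetAt g b c s) (hb : b = b') (hc : c = c') :
    HasTwoJetAt g b' c' s := hb ▸ hc ▸ h

theorem add (hf : HasTwoJetAt f b c s) (hg : HasTwoJetAt g b' c' s) :
    HasTwoJetAt (fun x => f x + g x) (b + b') (c + c') s where
  eventually_differentiableAt := by
    filter_upwards [hf.eventually_differentiableAt, hg.eventually_differentiableAt] with x h1 h2
    exact h1.add h2
  hasDerivAt := hf.hasDerivAt.add hg.hasDerivAt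
  hasDerivAt_deriv := by
    refine (hf.hasDerivAt_deriv.add hg.hasDerivAt_deriv).congr_of_eventuallyEq ?_
    filter_upwards [hf.eventually_differentiableAt, hg.eventually_differentiableAt] with x h1 h2
    exact (h1.hasDerivAt.add h2.hasDerivAt).deriv

theorem mul (hf : HasTwoJetAt f b c s) (hg : HasTwoJetAt g b' c' s) :
    HasTwoJetAt (fun x => f x * g x) (b * g s + f s * b')
      (c * g s + 2 * (b * b') + f s * c') s where
  eventually_differentiableAt := by
    filter_upwards [hf.eventually_differentiableAt, hg.eventually_differentiableAt] with x h1 h2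
    exact h1.mul h2
  hasDerivAt := hf.hasDerivAt.mul hg.hasDerivAt
  hasDerivAt_deriv := by
    have h := (hf.hasDerivAt_deriv.mul hg.hasDerivAt).add (hf.hasDerivAt.mul hg.hasDerivAt_deriv)
    rw [hf.hasDerivAt.deriv, hg.hasDerivAt.deriv] at h
    refine (h.congr_of_eventuallyEq ?_).congr_deriv (by ring)
    filter_upwards [hf.eventually_differentiableAt, hg.eventually_differentiableAt] with x h1 h2
    exact (h1.hasDerivAt.mul h2.hasDerivAt).deriv

theorem const (k s : ℝ) : HasTwoJetAt (fun _ => k) 0 0 s :=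
  of_hasDerivAt (g' := fun _ => 0) (Eventually.of_forall fun x => hasDerivAt_const x k)
    (hasDerivAt_const s 0)

theorem const_mul (k : ℝ) (hg : HasTwoJetAt g b c s) :
    HasTwoJetAt (fun x => k * g x) (k * b) (k * c) s :=
  ((const k s).mul hg).congr_jet (by ring) (by ring)

theorem neg (hg : HasTwoJetAt g b c s) : HasTwoJetAt (fun x => -g x) (-b) (-c) s :=
  ((hg.const_mul (-1)).congr_jet (by ring) (by ring)).congr_of_eventuallyEq
    (Eventually.of_forall fun x => by ring)

theorem sub (hf : HasTwoJetAt f b c s) (hg : HasTwoJetAt g b' c' s) :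
    HasTwoJetAt (fun x => f x - g x) (b - b') (c - c') s :=
  ((hf.add hg.neg).congr_jet (by ring) (by ring)).congr_of_eventuallyEq
    (Eventually.of_forall fun x => by ring)

theorem sq (hg : HasTwoJetAt g b c s) :
    HasTwoJetAt (fun x => g x ^ 2) (2 * g s * b) (2 * b ^ 2 + 2 * g s * c) s :=
  ((hg.mul hg).congr_jet (by ring) (by ring)).congr_of_eventuallyEq
    (Eventually.of_forall fun x => by ring)

theorem affine (k m s : ℝ) : HasTwoJetAt (fun x => k + m * x) m 0 s :=
  of_hasDerivAt (g' := fun _ => m)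
    (Eventually.of_forall fun x => by simpa using ((hasDerivAt_id x).const_mul m).const_add k)
    (hasDerivAt_const s m)

theorem comp (hf : HasTwoJetAt f b c (g s)) (hg : HasTwoJetAt g b' c' s) :
    HasTwoJetAt (fun x => f (g x)) (b * b') (c * b' ^ 2 + b * c') s where
  eventually_differentiableAt := by
    filter_upwards [hg.hasDerivAt.continuousAt.eventually hf.eventually_differentiableAt,
      hg.eventually_differentiableAt] with x h1 h2
    exact h1.comp x h2
  hasDerivAt := hf.hasDerivAt.comp s hg.hasDerivAt
  hasDerivAt_deriv := by
    have h := (hf.hasDerivAt_deriv.comp s hg.hasDerivAt).mul hg.hasDerivAt_deriv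
    simp only [Function.comp_apply] at h
    rw [hf.hasDerivAt.deriv, hg.hasDerivAt.deriv] at h
    refine (h.congr_of_eventuallyEq ?_).congr_deriv (by ring)
    filter_upwards [hg.hasDerivAt.continuousAt.eventually hf.eventually_differentiableAt,
      hg.eventually_differentiableAt] with x h1 h2
    exact (h1.hasDerivAt.comp x h2.hasDerivAt).deriv

/-- Restriction of a `C²` function to a curve. -/
theorem comp_curve {E : Type*} [NormedAddCommGroup E] [NormedSpace ℝ E] {F : E → ℝ}
    {γ γ' : ℝ → E} {γ'' : E} (hF : ContDiffAt ℝ 2 F (γ s)) (hγ : ∀ x, HasDerivAt γ (γ' x) x)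
    (hγ' : HasDerivAt γ' γ'' s) :
    HasTwoJetAt (fun x => F (γ x)) (fderiv ℝ F (γ s) (γ' s))
      (fderiv ℝ (fderiv ℝ F) (γ s) (γ' s) (γ' s) + fderiv ℝ F (γ s) γ'') s := by
  refine of_hasDerivAt (g' := fun x => fderiv ℝ F (γ x) (γ' x)) ?_ ?_
  · filter_upwards [(hγ s).continuousAt.eventually (hF.eventually (by simp))] with x hx
    exact (hx.differentiableAt (by simp)).hasFDerivAt.comp_hasDerivAt x (hγ x)
  · have h1 : ContDiffAt ℝ 1 (fderiv ℝ F) (γ s) := hF.fderiv_right (by norm_num)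
    have h2 := (h1.differentiableAt (by simp)).hasFDerivAt.comp_hasDerivAt s (hγ s)
    exact h2.clm_apply hγ'

/-- A strict form of the second derivative test. -/
theorem eventually_lt (h : HasTwoJetAt g 0 c s) (hc : 0 < c) :
    ∀ᶠ x in 𝓝[≠] s, g s < g x := by
  -- Subtracting (c/4)(x-s)² leaves second derivative c/2 > 0. The difference still has a local
  -- minimum at s, and the subtracted square supplies strictness.
  have hq : HasTwoJetAt (fun x => -s + 1 * x) 1 0 s := affine (-s) 1 s
  have h2 := h.sub (hq.sq.const_mul (c / 4))
  have hd : deriv (fun x => g x - c / 4 * (-s + 1 * x) ^ 2) s = 0 := by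
    rw [h2.hasDerivAt.deriv]; ring
  have hdd : 0 < deriv (deriv fun x => g x - c / 4 * (-s + 1 * x) ^ 2) s := by
    rw [h2.hasDerivAt_deriv.deriv]; ring_nf; linarith
  have hm := isLocalMin_of_deriv_deriv_pos hdd hd h2.hasDerivAt.continuousAt
  have hm' : ∀ᶠ x in 𝓝[≠] s, _ := hm.filter_mono nhdsWithin_le_nhds
  filter_upwards [hm', self_mem_nhdsWithin] with x hx hne
  have hpos : 0 < (-s + 1 * x) ^ 2 := by
    have : x - s ≠ 0 := sub_ne_zero.2 hne
    have : -s + 1 * x ≠ 0 := by rwa [one_mul, neg_add_eq_sub]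
    positivity
  have : (-s + 1 * s) ^ 2 = 0 := by ring
  simp only [this] at hx
  nlinarith

/-- This is the form in which the maximum principle is applied to the restrictions of a function to
real lines. -/
theorem nonpos_of_isLocalMax (h : HasTwoJetAt g b c s) (hm : IsLocalMax g s) : c ≤ 0 := by
  by_contra! hc
  have hb : b = 0 := hm.hasDerivAt_eq_zero h.hasDerivAt
  subst hb
  have hm' : ∀ᶠ x in 𝓝[≠] s, _ := hm.filter_mono nhdsWithin_le_nhds
  obtain ⟨x, h1, h2⟩ := ((h.eventually_lt hc).and hm').exists
  exact absurd h1 (not_lt.2 h2)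

end HasTwoJetAt

/-! ### The complex Hessian as a Laplacian along holomorphic discs. -/

section Levi

variable {f g : ℂ × ℂ → ℝ} {p t : ℂ × ℂ}

theorem fderiv_ofReal_comp (hf : DifferentiableAt ℝ f p) (v : ℂ × ℂ) :
    fderiv ℝ (fun q => (f q : ℂ)) p v = (fderiv ℝ f p v : ℂ) := by
  have := (Complex.ofRealCLM.hasFDerivAt.comp p hf.hasFDerivAt).fderiv
  change fderiv ℝ (⇑Complex.ofRealCLM ∘ f) p v = _
  rw [this]; simp

theorem eq_sum_e (t : ℂ × ℂ) :
    t = t.1.re • e 0 + t.1.im • (Complex.I • e 0) + t.2.re • e 1 + t.2.im • (Complex.I • e 1) := by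
  ext <;> simp [e]

theorem I_smul_eq_sum_e (t : ℂ × ℂ) : Complex.I • t =
    t.1.re • (Complex.I • e 0) - t.1.im • e 0 + t.2.re • (Complex.I • e 1) - t.2.im • e 1 := by
  ext <;> refine Complex.ext ?_ ?_ <;> simp [e]

/-- The Wirtinger sum equals (Df(t) - i Df(it))/2, so its real and imaginary parts vanish
separately. -/
theorem isComplexTangent_iff (hf : DifferentiableAt ℝ f p) :
    IsComplexTangent f p t ↔ fderiv ℝ f p t = 0 ∧ fderiv ℝ f p (Complex.I • t) = 0 := by
  have h1 : fderiv ℝ f p t = fderiv ℝ f p _ := congrArg _ (eq_sum_e t)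
  have h2 : fderiv ℝ f p (Complex.I • t) = fderiv ℝ f p _ := congrArg _ (I_smul_eq_sum_e t)
  simp only [map_add, map_sub, map_smul, smul_eq_mul] at h1 h2
  rw [IsComplexTangent, h1, h2, Complex.ext_iff]
  simp only [Fin.sum_univ_two, dz, fderiv_ofReal_comp hf, coord]
  simp
  constructor <;> rintro ⟨h3, h4⟩ <;> constructor <;> linarith

theorem dz_dzbar (hf : ContDiffAt ℝ 2 f p) (j k : Fin 2) :
    dz j (dzbar k (fun q => (f q : ℂ))) p =
      ((fderiv ℝ (fderiv ℝ f) p (e j) (e k) +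
          fderiv ℝ (fderiv ℝ f) p (Complex.I • e j) (Complex.I • e k) : ℝ) +
        Complex.I * (fderiv ℝ (fderiv ℝ f) p (e j) (Complex.I • e k) -
          fderiv ℝ (fderiv ℝ f) p (Complex.I • e j) (e k) : ℝ)) / 4 := by
  have h1 : ContDiffAt ℝ 1 (fderiv ℝ f) p := hf.fderiv_right (by norm_num)
  have hD : DifferentiableAt ℝ (fderiv ℝ f) p := h1.differentiableAt (by simp)
  have key : ∀ v, fderiv ℝ (dzbar k (fun q => (f q : ℂ))) p v =
      ((fderiv ℝ (fderiv ℝ f) p v (e k) : ℂ) +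
        Complex.I * (fderiv ℝ (fderiv ℝ f) p v (Complex.I • e k) : ℂ)) / 2 := by
    intro v
    have heq : dzbar k (fun q => (f q : ℂ)) =ᶠ[𝓝 p] fun q =>
        ((fderiv ℝ f q (e k) : ℂ) + Complex.I * (fderiv ℝ f q (Complex.I • e k) : ℂ)) / 2 := by
      filter_upwards [hf.eventually (by simp)] with q hq
      simp only [dzbar, fderiv_ofReal_comp (hq.differentiableAt (by simp))]
    rw [heq.fderiv_eq]
    have hw : ∀ w : ℂ × ℂ, HasFDerivAt (fun q => (fderiv ℝ f q w : ℂ))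
        (Complex.ofRealCLM.comp ((fderiv ℝ (fderiv ℝ f) p).flip w)) p := fun w =>
      Complex.ofRealCLM.hasFDerivAt.comp p
        ((hD.hasFDerivAt.clm_apply (hasFDerivAt_const w p)).congr_fderiv (by ext <;> simp))
    have := (((hw (e k)).add ((hw (Complex.I • e k)).const_mul Complex.I)).mul_const
      ((2 : ℂ)⁻¹)).fderiv
    simp only [div_eq_mul_inv]
    erw [this]
    simp
    ring
  rw [dz, key, key]
  push_cast
  linear_combination (norm := ring_nf)
    (-(fderiv ℝ (fderiv ℝ f) p (Complex.I • e j) (Complex.I • e k) : ℂ) / 4) * Complex.I_sq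

/-- The complex Hessian form is a quarter of the sum of the two real second derivatives. -/
theorem leviForm_eq (hf : ContDiffAt ℝ 2 f p) :
    leviForm f p t = (fderiv ℝ (fderiv ℝ f) p t t +
      fderiv ℝ (fderiv ℝ f) p (Complex.I • t) (Complex.I • t)) / 4 := by
  have h1 : fderiv ℝ (fderiv ℝ f) p t t = fderiv ℝ (fderiv ℝ f) p _ _ :=
    congrArg (fun u => fderiv ℝ (fderiv ℝ f) p u u) (eq_sum_e t)
  have h2 : fderiv ℝ (fderiv ℝ f) p (Complex.I • t) (Complex.I • t) =
      fderiv ℝ (fderiv ℝ f) p _ _ :=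
    congrArg (fun u => fderiv ℝ (fderiv ℝ f) p u u) (I_smul_eq_sum_e t)
  simp only [map_add, map_sub, map_smul, smul_eq_mul, add_apply,
    sub_apply, smul_apply, smul_eq_mul] at h1 h2
  rw [h1, h2, leviForm]
  simp only [Fin.sum_univ_two, dz_dzbar hf, coord, Complex.add_re, Complex.mul_re, Complex.mul_im,
    Complex.add_im, Complex.div_ofNat_re, Complex.div_ofNat_im, Complex.ofReal_re,
    Complex.ofReal_im, Complex.I_re, Complex.I_im, Complex.conj_re, Complex.conj_im,
    Matrix.cons_val_zero, Matrix.cons_val_one]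
  ring

/-- The complex Hessian form computed along the real and the imaginary axis of a disc. -/
theorem four_mul_leviForm_eq {γ₁ γ₁' γ₂ γ₂' : ℝ → ℂ × ℂ} {m : ℂ × ℂ} {b₁ c₁ b₂ c₂ : ℝ}
    (hf : ContDiffAt ℝ 2 f p) (h₁ : γ₁ 0 = p) (h₂ : γ₂ 0 = p)
    (hγ₁ : ∀ x, HasDerivAt γ₁ (γ₁' x) x) (hγ₂ : ∀ x, HasDerivAt γ₂ (γ₂' x) x)
    (hγ₁' : HasDerivAt γ₁' m 0) (hγ₂' : HasDerivAt γ₂' (-m) 0)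
    (ht₁ : γ₁' 0 = t) (ht₂ : γ₂' 0 = Complex.I • t)
    (hj₁ : HasTwoJetAt (fun s => f (γ₁ s)) b₁ c₁ 0)
    (hj₂ : HasTwoJetAt (fun s => f (γ₂ s)) b₂ c₂ 0) :
    4 * leviForm f p t = c₁ + c₂ ∧ fderiv ℝ f p t = b₁ ∧ fderiv ℝ f p (Complex.I • t) = b₂ := by
  have e1 := hj₁.unique (HasTwoJetAt.comp_curve (by rwa [h₁]) hγ₁ hγ₁')
  have e2 := hj₂.unique (HasTwoJetAt.comp_curve (by rwa [h₂]) hγ₂ hγ₂')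
  rw [h₁, ht₁] at e1
  rw [h₂, ht₂] at e2
  refine ⟨?_, e1.1.symm, e2.1.symm⟩
  -- The accelerations m and -m of the two curves are opposite, so the first-derivative terms cancel
  -- in the sum.
  rw [leviForm_eq hf, e1.2, e2.2, map_neg]
  ring

end Levi

/-! ### Functions with the same negative set near a regular zero. -/

section Invariance

variable {E : Type*} [NormedAddCommGroup E] [NormedSpace ℝ E] {f g : E → ℝ} {p : E}

theorem hasDerivAt_quadratic_curve (p v n : E) (c x : ℝ) :
    HasDerivAt (fun x : ℝ => p + x • v + (c * x ^ 2) • n) (v + (2 * c * x) • n) x := by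
  have h1 := (hasDerivAt_id x).smul_const v
  have h2 := (((hasDerivAt_pow 2 x).const_mul c).smul_const n)
  refine ((h1.const_add p).add h2).congr_deriv ?_
  simp only [one_smul, Nat.add_one_sub_one, pow_one, Nat.cast_ofNat]
  ring_nf

theorem hasDerivAt_quadratic_curve' (v n : E) (c x : ℝ) :
    HasDerivAt (fun x : ℝ => v + (2 * c * x) • n) ((2 * c) • n) x := by
  have h2 := (((hasDerivAt_id x).const_mul (2 * c)).smul_const n)
  simpa using h2.const_add v

theorem hasTwoJetAt_quadratic_curve (hf : ContDiffAt ℝ 2 f p) (v n : E) (c : ℝ) :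
    HasTwoJetAt (fun x : ℝ => f (p + x • v + (c * x ^ 2) • n)) (fderiv ℝ f p v)
      (fderiv ℝ (fderiv ℝ f) p v v + 2 * c * fderiv ℝ f p n) 0 := by
  have := HasTwoJetAt.comp_curve (F := f) (s := 0)
    (γ := fun x : ℝ => p + x • v + (c * x ^ 2) • n) (by simpa using hf)
    (fun x => hasDerivAt_quadratic_curve p v n c x) (hasDerivAt_quadratic_curve' v n c 0)
  simpa using this

theorem tendsto_quadratic_curve (p v n : E) (c : ℝ) :
    Tendsto (fun x : ℝ => p + x • v + (c * x ^ 2) • n) (𝓝 0) (𝓝 p) := by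
  have : Continuous (fun x : ℝ => p + x • v + (c * x ^ 2) • n) := by fun_prop
  simpa using this.tendsto 0

/-- Along a direction of strict decrease of `f` the function `g` does not increase. -/
theorem fderiv_nonpos_of_neg (hf : DifferentiableAt ℝ f p) (hg : DifferentiableAt ℝ g p)
    (hf0 : f p = 0) (hg0 : g p = 0) (hfg : ∀ᶠ q in 𝓝 p, f q < 0 → g q < 0)
    {v : E} (hv : fderiv ℝ f p v < 0) : fderiv ℝ g p v ≤ 0 := by
  by_contra! hpos
  have hline : HasDerivAt (fun x : ℝ => p + x • v) v 0 := by
    simpa using ((hasDerivAt_id (0 : ℝ)).smul_const v).const_add p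
  have hline0 : p + (0 : ℝ) • v = p := by simp
  have hF : HasDerivAt (fun x : ℝ => f (p + x • v)) (fderiv ℝ f p v) 0 := by
    have : HasFDerivAt f (fderiv ℝ f p) (p + (0 : ℝ) • v) := by
      rw [hline0]; exact hf.hasFDerivAt
    exact this.comp_hasDerivAt (0 : ℝ) hline
  have hG : HasDerivAt (fun x : ℝ => g (p + x • v)) (fderiv ℝ g p v) 0 := by
    have : HasFDerivAt g (fderiv ℝ g p) (p + (0 : ℝ) • v) := by
      rw [hline0]; exact hg.hasFDerivAt
    exact this.comp_hasDerivAt (0 : ℝ) hline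
  have hF' : ∀ᶠ x in 𝓝[>] (0 : ℝ), f (p + x • v) < 0 := by
    have := (hasDerivAt_iff_tendsto_slope.1 hF).mono_left
      (nhdsWithin_mono (0 : ℝ) (s := Set.Ioi 0) fun x hx => ne_of_gt hx)
    filter_upwards [this.eventually (gt_mem_nhds hv), self_mem_nhdsWithin] with x hx (hx0 : 0 < x)
    rw [slope_def_field] at hx
    simp only [zero_smul, add_zero, hf0, sub_zero] at hx
    rcases (div_neg_iff.1 hx) with h | h
    · linarith
    · exact h.1
  have hG' : ∀ᶠ x in 𝓝[>] (0 : ℝ), 0 < g (p + x • v) := by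
    have := (hasDerivAt_iff_tendsto_slope.1 hG).mono_left
      (nhdsWithin_mono (0 : ℝ) (s := Set.Ioi 0) fun x hx => ne_of_gt hx)
    filter_upwards [this.eventually (lt_mem_nhds hpos), self_mem_nhdsWithin] with x hx (hx0 : 0 < x)
    rw [slope_def_field] at hx
    simp only [zero_smul, add_zero, hg0, sub_zero] at hx
    rcases (div_pos_iff.1 hx) with h | h
    · exact h.1
    · linarith
  have hfg' : ∀ᶠ x in 𝓝[>] (0 : ℝ), f (p + x • v) < 0 → g (p + x • v) < 0 := by
    have h : Tendsto (fun x : ℝ => p + x • v) (𝓝 0) (𝓝 p) := by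
      simpa using hline.continuousAt.tendsto
    exact (h.eventually hfg).filter_mono nhdsWithin_le_nhds
  obtain ⟨x, h1, h2, h3⟩ := (hF'.and (hG'.and hfg')).exists
  exact absurd (h3 h1) (not_lt.2 h2.le)

theorem exists_fderiv_eq_one {L : E →L[ℝ] ℝ} (hL : L ≠ 0) : ∃ n, L n = 1 := by
  obtain ⟨m, hm⟩ : ∃ m, L m ≠ 0 := by
    by_contra! h
    exact hL (by ext x; simp [h x])
  exact ⟨(L m)⁻¹ • m, by simp [hm]⟩

/-- Two functions with the same negative set near a common regular zero have positively
proportional differentials there. -/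
theorem exists_fderiv_eq_smul (hf : DifferentiableAt ℝ f p) (hg : DifferentiableAt ℝ g p)
    (hf0 : f p = 0) (hg0 : g p = 0) (hfg : ∀ᶠ q in 𝓝 p, f q < 0 ↔ g q < 0)
    (hf' : fderiv ℝ f p ≠ 0) (hg' : fderiv ℝ g p ≠ 0) :
    ∃ h : ℝ, 0 < h ∧ fderiv ℝ g p = h • fderiv ℝ f p := by
  obtain ⟨n, hn⟩ := exists_fderiv_eq_one hf'
  have hle : ∀ v, fderiv ℝ f p v < 0 → fderiv ℝ g p v ≤ 0 := fun v hv =>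
    fderiv_nonpos_of_neg hf hg hf0 hg0 (hfg.mono fun _ h => h.1) hv
  have hker : ∀ v, fderiv ℝ f p v = 0 → fderiv ℝ g p v ≤ 0 := by
    intro v hv
    -- A kernel vector is a limit of the strictly descending directions v - εn, for which the sign
    -- is already known.
    have h1 : ∀ ε : ℝ, 0 < ε → fderiv ℝ g p v ≤ 0 + ε * fderiv ℝ g p n := by
      intro ε hε
      have := hle (v - ε • n) (by simp [hv, hn, hε])
      simp only [map_sub, map_smul, smul_eq_mul] at this
      linarith
    have ht : Tendsto (fun ε : ℝ => 0 + ε * fderiv ℝ g p n) (𝓝[>] 0) (𝓝 0) := by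
      have : Continuous (fun ε : ℝ => 0 + ε * fderiv ℝ g p n) := by fun_prop
      have := this.tendsto 0
      simp only [zero_mul, add_zero] at this
      exact this.mono_left nhdsWithin_le_nhds
    exact ge_of_tendsto ht (eventually_mem_nhdsWithin.mono fun ε hε => h1 ε hε)
  have hker' : ∀ v, fderiv ℝ f p v = 0 → fderiv ℝ g p v = 0 := fun v hv =>
    le_antisymm (hker v hv) (by simpa using hker (-v) (by simp [hv]))
  have heq : fderiv ℝ g p = fderiv ℝ g p n • fderiv ℝ f p := by
    ext v
    have := hker' (v - fderiv ℝ f p v • n) (by simp [hn])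
    simp only [map_sub, map_smul, smul_eq_mul] at this
    simp only [smul_apply, smul_eq_mul]
    linarith
  refine ⟨_, lt_of_le_of_ne ?_ ?_, heq⟩
  · simpa using hle (-n) (by simp [hn])
  · intro h0
    rw [← h0, zero_smul] at heq
    exact hg' heq

/-- Second order version of `exists_fderiv_eq_smul`: the Hessians are proportional on the common
tangent space. -/
theorem exists_hessian_eq_mul (hf : ContDiffAt ℝ 2 f p) (hg : ContDiffAt ℝ 2 g p)
    (hf0 : f p = 0) (hg0 : g p = 0) (hfg : ∀ᶠ q in 𝓝 p, f q < 0 ↔ g q < 0)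
    (hf' : fderiv ℝ f p ≠ 0) (hg' : fderiv ℝ g p ≠ 0) :
    ∃ h : ℝ, 0 < h ∧ fderiv ℝ g p = h • fderiv ℝ f p ∧ ∀ v, fderiv ℝ f p v = 0 →
      fderiv ℝ (fderiv ℝ g) p v v = h * fderiv ℝ (fderiv ℝ f) p v v := by
  obtain ⟨h, hpos, heq⟩ := exists_fderiv_eq_smul (hf.differentiableAt (by simp))
    (hg.differentiableAt (by simp)) hf0 hg0 hfg hf' hg'
  refine ⟨h, hpos, heq, fun v hv => ?_⟩
  obtain ⟨n, hn⟩ := exists_fderiv_eq_one hf'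
  have hgv : fderiv ℝ g p v = 0 := by rw [heq]; simp [hv]
  have hgn : fderiv ℝ g p n = h := by rw [heq]; simp [hn]
  set A := fderiv ℝ (fderiv ℝ f) p v v
  set B := fderiv ℝ (fderiv ℝ g) p v v
  -- Test on parabolas p + xv + cx²n: the second derivatives are A + 2c for f and B + 2ch for g. If
  -- B ≠ hA, some c gives them opposite signs, which separates the negative sets. This needs no
  -- smooth quotient g/f.
  have jet := fun c : ℝ => hasTwoJetAt_quadratic_curve hf v n c
  have jet' := fun c : ℝ => hasTwoJetAt_quadratic_curve hg v n c
  rw [hv, hn] at jet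
  rw [hgv, hgn] at jet'
  have ev : ∀ c : ℝ, ∀ᶠ x in 𝓝[≠] (0 : ℝ), f (p + x • v + (c * x ^ 2) • n) < 0 ↔
      g (p + x • v + (c * x ^ 2) • n) < 0 := fun c =>
    ((tendsto_quadratic_curve p v n c).eventually hfg).filter_mono nhdsWithin_le_nhds
  refine le_antisymm ?_ ?_
  · by_contra! hlt
    obtain ⟨c, hc1, hc2⟩ : ∃ c : ℝ, A + 2 * c < 0 ∧ 0 < B + 2 * c * h := by
      -- The midpoint of the critical values -A/2 and -B/(2h).
      refine ⟨-(A + B / h) / 4, ?_, ?_⟩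
      · have : A < B / h := by rw [lt_div_iff₀ hpos]; linarith
        linarith
      · have : B / h * h = B := div_mul_cancel₀ _ hpos.ne'
        nlinarith
    have e1 := (jet c).neg.congr_jet neg_zero rfl |>.eventually_lt (by linarith)
    have e2 := (jet' c).eventually_lt hc2
    obtain ⟨x, h1, h2, h3⟩ := (e1.and (e2.and (ev c))).exists
    simp only [zero_smul, add_zero, hf0, hg0, ne_eq, OfNat.ofNat_ne_zero, not_false_eq_true,
      zero_pow, mul_zero] at h1 h2
    linarith [h3.1 (by linarith)]
  · by_contra! hlt
    obtain ⟨c, hc1, hc2⟩ : ∃ c : ℝ, 0 < A + 2 * c ∧ B + 2 * c * h < 0 := by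
      refine ⟨-(A + B / h) / 4, ?_, ?_⟩
      · have : B / h < A := by rw [div_lt_iff₀ hpos]; linarith
        linarith
      · have : B / h * h = B := div_mul_cancel₀ _ hpos.ne'
        nlinarith
    have e1 := (jet' c).neg.congr_jet neg_zero rfl |>.eventually_lt (by linarith)
    have e2 := (jet c).eventually_lt (by linarith)
    obtain ⟨x, h1, h2, h3⟩ := (e1.and (e2.and (ev c))).exists
    simp only [zero_smul, add_zero, hf0, hg0, ne_eq, OfNat.ofNat_ne_zero, not_false_eq_true,
      zero_pow, mul_zero] at h1 h2
    linarith [h3.2 (by linarith)]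

end Invariance

/-! ### Defining functions and invariance of the Levi form. -/

section DefiningFunction

variable {Ω : Set (ℂ × ℂ)} {n : WithTop ℕ∞} {ρ ρ' : ℂ × ℂ → ℝ} {p : ℂ × ℂ}

theorem IsDefiningFunction.contDiffAt (h : IsDefiningFunction n Ω ρ) (hp : p ∈ closure Ω) :
    ContDiffAt ℝ n ρ p := by
  obtain ⟨U, hU, hcl, hC, -, -⟩ := h
  exact hC.contDiffAt (hU.mem_nhds (hcl hp))

theorem IsDefiningFunction.eventually_mem_iff (h : IsDefiningFunction n Ω ρ)
    (hp : p ∈ closure Ω) : ∀ᶠ q in 𝓝 p, q ∈ Ω ↔ ρ q < 0 := by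
  obtain ⟨U, hU, hcl, hC, hΩ, -⟩ := h
  filter_upwards [hU.mem_nhds (hcl hp)] with q hq
  rw [hΩ]
  simp [hq]

theorem IsDefiningFunction.eq_zero (h : IsDefiningFunction n Ω ρ) (hp : p ∈ frontier Ω) :
    ρ p = 0 := by
  have hcl := frontier_subset_closure hp
  have hc := (h.contDiffAt hcl).continuousAt
  have hev := h.eventually_mem_iff hcl
  refine le_antisymm ?_ ?_
  · by_contra! hpos
    obtain ⟨q, hq, h1, h2⟩ := (mem_closure_iff_frequently.1 hcl).and_eventually
      (hev.and (hc.eventually (lt_mem_nhds hpos))) |>.exists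
    linarith [h1.1 hq]
  · by_contra! hneg
    refine hp.2 (mem_interior_iff_mem_nhds.2 ?_)
    filter_upwards [hev, hc.eventually (gt_mem_nhds hneg)] with q h1 h2
    exact h1.2 h2

theorem IsDefiningFunction.fderiv_ne_zero (h : IsDefiningFunction n Ω ρ) (hp : p ∈ frontier Ω) :
    fderiv ℝ ρ p ≠ 0 := by
  obtain ⟨U, hU, hcl, hC, hΩ, hd⟩ := h
  exact hd p hp

theorem IsDefiningFunction.of_le {m : WithTop ℕ∞} (h : IsDefiningFunction n Ω ρ) (hmn : m ≤ n) :
    IsDefiningFunction m Ω ρ := by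
  obtain ⟨U, hU, hcl, hC, hΩ, hd⟩ := h
  exact ⟨U, hU, hcl, hC.of_le hmn, hΩ, hd⟩

/-- The Levi forms of two defining functions are positively proportional on complex tangent
vectors. -/
theorem IsDefiningFunction.exists_leviForm_eq_mul (h : IsDefiningFunction 2 Ω ρ)
    (h' : IsDefiningFunction 2 Ω ρ') (hp : p ∈ frontier Ω) :
    ∃ c : ℝ, 0 < c ∧ fderiv ℝ ρ' p = c • fderiv ℝ ρ p ∧ ∀ t,
      (IsComplexTangent ρ' p t ↔ IsComplexTangent ρ p t) ∧
      (IsComplexTangent ρ p t → leviForm ρ' p t = c * leviForm ρ p t) := by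
  have hcl := frontier_subset_closure hp
  have hC := h.contDiffAt hcl
  have hC' := h'.contDiffAt hcl
  have hiff : ∀ᶠ q in 𝓝 p, ρ q < 0 ↔ ρ' q < 0 := by
    filter_upwards [h.eventually_mem_iff hcl, h'.eventually_mem_iff hcl] with q h1 h2
    rw [← h1, h2]
  obtain ⟨c, hc, hd, hH⟩ := exists_hessian_eq_mul hC hC' (h.eq_zero hp) (h'.eq_zero hp) hiff
    (h.fderiv_ne_zero hp) (h'.fderiv_ne_zero hp)
  refine ⟨c, hc, hd, fun t => ⟨?_, fun ht => ?_⟩⟩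
  · rw [isComplexTangent_iff (hC.differentiableAt (by simp)),
      isComplexTangent_iff (hC'.differentiableAt (by simp)), hd]
    simp [hc.ne']
  · rw [isComplexTangent_iff (hC.differentiableAt (by simp))] at ht
    rw [leviForm_eq hC, leviForm_eq hC', hH _ ht.1, hH _ ht.2]
    ring

end DefiningFunction

/-! ### The complex Hessian of -(-f)^τ. -/

section Composition

variable {f : ℂ × ℂ → ℝ} {p t : ℂ × ℂ}

theorem hasTwoJetAt_line (hf : ContDiffAt ℝ 2 f p) (v : ℂ × ℂ) :
    HasTwoJetAt (fun x : ℝ => f (p + x • v)) (fderiv ℝ f p v)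
      (fderiv ℝ (fderiv ℝ f) p v v) 0 := by
  simpa using hasTwoJetAt_quadratic_curve hf v 0 0

/-- The complex Hessian form of a composition `χ ∘ f`. -/
theorem leviForm_comp {χ : ℝ → ℝ} {b c : ℝ} (hf : ContDiffAt ℝ 2 f p)
    (hχ : ContDiffAt ℝ 2 χ (f p)) (hj : HasTwoJetAt χ b c (f p)) :
    4 * leviForm (fun q => χ (f q)) p t = b * (4 * leviForm f p t) +
      c * (fderiv ℝ f p t ^ 2 + fderiv ℝ f p (Complex.I • t) ^ 2) := by
  have hc : ContDiffAt ℝ 2 (fun q => χ (f q)) p := hχ.comp p hf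
  have key : ∀ v, fderiv ℝ (fderiv ℝ fun q => χ (f q)) p v v =
      c * fderiv ℝ f p v ^ 2 + b * fderiv ℝ (fderiv ℝ f) p v v := fun v =>
    ((hasTwoJetAt_line hc v).unique
      (HasTwoJetAt.comp (g := fun x : ℝ => f (p + x • v)) (by simpa using hj)
        (hasTwoJetAt_line hf v))).2
  rw [leviForm_eq hc, leviForm_eq hf, key, key]
  ring

theorem hasTwoJetAt_neg_rpow {y : ℝ} (hy : y < 0) (τ : ℝ) :
    HasTwoJetAt (fun y : ℝ => -((-y) ^ τ)) (τ * (-y) ^ (τ - 1))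
      (τ * (1 - τ) * (-y) ^ (τ - 2)) y := by
  have h1 : ∀ x : ℝ, x < 0 →
      HasDerivAt (fun y : ℝ => -((-y) ^ τ)) (τ * (-x) ^ (τ - 1)) x := fun x hx =>
    (((hasDerivAt_id x).neg.rpow_const (p := τ) (Or.inl (by simp; linarith))).neg).congr_deriv
      (by simp)
  refine HasTwoJetAt.of_hasDerivAt (g' := fun x => τ * (-x) ^ (τ - 1))
    ((gt_mem_nhds hy).mono fun x hx => h1 x hx) ?_
  refine (((hasDerivAt_id y).neg.rpow_const (p := τ - 1)
    (Or.inl (by simp; linarith))).const_mul τ).congr_deriv ?_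
  simp
  ring_nf

theorem contDiffAt_neg_rpow {y : ℝ} (hy : y < 0) (τ : ℝ) {n : WithTop ℕ∞} :
    ContDiffAt ℝ n (fun y : ℝ => -((-y) ^ τ)) y :=
  ((contDiffAt_id.neg).rpow_const_of_ne (by simp; linarith)).neg

/-- Pulling out the positive factor τ(-f)^{τ-2} leaves a bracket without fractional powers, which
extends to the boundary f = 0. -/
theorem leviForm_neg_rpow (hf : ContDiffAt ℝ 2 f p) (hp : f p < 0) (τ : ℝ) :
    4 * leviForm (fun q => -((-f q) ^ τ)) p t = τ * (-f p) ^ (τ - 2) *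
      (-f p * (4 * leviForm f p t) +
        (1 - τ) * (fderiv ℝ f p t ^ 2 + fderiv ℝ f p (Complex.I • t) ^ 2)) := by
  rw [leviForm_comp (χ := fun y => -((-y) ^ τ)) hf (contDiffAt_neg_rpow hp τ)
    (hasTwoJetAt_neg_rpow hp τ)]
  have : (-f p) ^ (τ - 1) = (-f p) ^ (τ - 2) * (-f p) := by
    rw [← Real.rpow_add_one (by linarith)]
    ring_nf
  rw [this]
  ring

end Composition

/-! ### Elementary properties of the cut-off λ. -/

section Profile

variable {lam : ℝ → ℝ} (hlam : IsWormProfile lam)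
include hlam

namespace IsWormProfile

theorem contDiff_deriv : ContDiff ℝ ∞ (deriv lam) :=
  ((contDiff_infty_iff_deriv).1 hlam.smooth).2

theorem contDiff_deriv_deriv : ContDiff ℝ ∞ (deriv (deriv lam)) :=
  ((contDiff_infty_iff_deriv).1 hlam.contDiff_deriv).2

theorem hasDerivAt (x : ℝ) : HasDerivAt lam (deriv lam x) x :=
  (hlam.smooth.differentiable (by simp) x).hasDerivAt

theorem hasDerivAt_deriv (x : ℝ) : HasDerivAt (deriv lam) (deriv (deriv lam) x) x :=
  (hlam.contDiff_deriv.differentiable (by simp) x).hasDerivAt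

theorem deriv_eq_zero_of_neg {x : ℝ} (hx : x < 0) : deriv lam x = 0 := by
  have : lam =ᶠ[𝓝 x] fun _ => 0 := (gt_mem_nhds hx).mono fun y hy => hlam.eq_zero y (le_of_lt hy)
  rw [this.deriv_eq]; simp

theorem deriv_eq_zero {x : ℝ} (hx : x ≤ 0) : deriv lam x = 0 := by
  have hcl : IsClosed {x | deriv lam x = 0} :=
    isClosed_eq hlam.contDiff_deriv.continuous continuous_const
  have : closure (Set.Iio (0 : ℝ)) ⊆ {x | deriv lam x = 0} :=
    hcl.closure_subset_iff.2 fun y hy => hlam.deriv_eq_zero_of_neg hy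
  rw [closure_Iio] at this
  exact this hx

theorem deriv_deriv_eq_zero {x : ℝ} (hx : x ≤ 0) : deriv (deriv lam) x = 0 := by
  have hcl : IsClosed {x | deriv (deriv lam) x = 0} :=
    isClosed_eq hlam.contDiff_deriv_deriv.continuous continuous_const
  have : closure (Set.Iio (0 : ℝ)) ⊆ {x | deriv (deriv lam) x = 0} := by
    refine hcl.closure_subset_iff.2 fun y (hy : y < 0) => ?_
    have : deriv lam =ᶠ[𝓝 y] fun _ => 0 :=
      (gt_mem_nhds hy).mono fun y hy => hlam.deriv_eq_zero (le_of_lt hy)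
    change deriv (deriv lam) y = 0
    rw [this.deriv_eq]; simp
  rw [closure_Iio] at this
  exact this hx

theorem deriv_pos {x : ℝ} (hx : 0 < x) : 0 < deriv lam x := by
  have h : StrictMonoOn (deriv lam) (Set.Ici 0) := by
    refine strictMonoOn_of_deriv_pos (convex_Ici 0) hlam.contDiff_deriv.continuous.continuousOn ?_
    intro y hy
    rw [interior_Ici] at hy
    exact hlam.deriv_deriv_pos y hy
  have := h (Set.self_mem_Ici) hx.le hx
  rwa [hlam.deriv_eq_zero le_rfl] at this

theorem pos {x : ℝ} (hx : 0 < x) : 0 < lam x := by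
  have h : StrictMonoOn lam (Set.Ici 0) := by
    refine strictMonoOn_of_deriv_pos (convex_Ici 0) hlam.smooth.continuous.continuousOn ?_
    intro y hy
    rw [interior_Ici] at hy
    exact hlam.deriv_pos hy
  have := h (Set.self_mem_Ici) hx.le hx
  rwa [hlam.eq_zero 0 le_rfl] at this

theorem nonneg (x : ℝ) : 0 ≤ lam x := by
  rcases le_or_gt x 0 with h | h
  · rw [hlam.eq_zero x h]
  · exact (hlam.pos h).le

theorem deriv_nonneg (x : ℝ) : 0 ≤ deriv lam x := by
  rcases le_or_gt x 0 with h | h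
  · rw [hlam.deriv_eq_zero h]
  · exact (hlam.deriv_pos h).le

theorem deriv_deriv_nonneg (x : ℝ) : 0 ≤ deriv (deriv lam) x := by
  rcases le_or_gt x 0 with h | h
  · rw [hlam.deriv_deriv_eq_zero h]
  · exact (hlam.deriv_deriv_pos x h).le

end IsWormProfile

end Profile

/-! ### The cut-off terms in the variable log|z|. -/

/-- The cut-off terms of the worm function, in terms of `x = log |z|`. -/
noncomputable def collar (lam : ℝ → ℝ) (r x : ℝ) : ℝ :=
  lam (Real.exp (-2 * x) - 1) + lam (Real.exp (2 * x) - r ^ 2)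

section Collar

variable {lam : ℝ → ℝ} {r : ℝ}

theorem hasDerivAt_exp_two_mul (k x : ℝ) (m : ℝ) :
    HasDerivAt (fun x => Real.exp (k * x) - m) (k * Real.exp (k * x)) x := by
  have := (((hasDerivAt_id x).const_mul k).exp).sub_const m
  exact this.congr_deriv (by simp; ring)

theorem deriv_collar (hlam : IsWormProfile lam) (r : ℝ) :
    deriv (collar lam r) = fun x =>
      -2 * (Real.exp (-2 * x) * deriv lam (Real.exp (-2 * x) - 1)) +
      2 * (Real.exp (2 * x) * deriv lam (Real.exp (2 * x) - r ^ 2)) := by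
  ext x
  have h1 := (hlam.hasDerivAt (Real.exp (-2 * x) - 1)).comp x (hasDerivAt_exp_two_mul (-2) x 1)
  have h2 := (hlam.hasDerivAt (Real.exp (2 * x) - r ^ 2)).comp x
    (hasDerivAt_exp_two_mul 2 x (r ^ 2))
  refine (h1.add h2).deriv.trans ?_
  ring

theorem deriv_deriv_collar (hlam : IsWormProfile lam) (r x : ℝ) :
    deriv (deriv (collar lam r)) x =
      4 * (Real.exp (-2 * x) ^ 2 * deriv (deriv lam) (Real.exp (-2 * x) - 1) +
        Real.exp (-2 * x) * deriv lam (Real.exp (-2 * x) - 1)) +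
      4 * (Real.exp (2 * x) ^ 2 * deriv (deriv lam) (Real.exp (2 * x) - r ^ 2) +
        Real.exp (2 * x) * deriv lam (Real.exp (2 * x) - r ^ 2)) := by
  rw [deriv_collar hlam]
  have e1 : HasDerivAt (fun x => Real.exp (-2 * x)) (-2 * Real.exp (-2 * x)) x := by
    simpa using hasDerivAt_exp_two_mul (-2) x 0
  have e2 : HasDerivAt (fun x => Real.exp (2 * x)) (2 * Real.exp (2 * x)) x := by
    simpa using hasDerivAt_exp_two_mul 2 x 0
  have h1 := (hlam.hasDerivAt_deriv (Real.exp (-2 * x) - 1)).comp x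
    (hasDerivAt_exp_two_mul (-2) x 1)
  have h2 := (hlam.hasDerivAt_deriv (Real.exp (2 * x) - r ^ 2)).comp x
    (hasDerivAt_exp_two_mul 2 x (r ^ 2))
  refine (((e1.mul h1).const_mul (-2)).add ((e2.mul h2).const_mul 2)).deriv.trans ?_
  simp only [Function.comp_apply]
  ring

theorem contDiff_collar (hlam : IsWormProfile lam) (r : ℝ) : ContDiff ℝ ∞ (collar lam r) := by
  have h1 : ContDiff ℝ ∞ fun x : ℝ => Real.exp (-2 * x) - 1 := by fun_prop
  have h2 : ContDiff ℝ ∞ fun x : ℝ => Real.exp (2 * x) - r ^ 2 := by fun_prop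
  exact (hlam.smooth.comp h1).add (hlam.smooth.comp h2)

theorem collar_nonneg (hlam : IsWormProfile lam) (r x : ℝ) : 0 ≤ collar lam r x :=
  add_nonneg (hlam.nonneg _) (hlam.nonneg _)

theorem deriv_deriv_collar_nonneg (hlam : IsWormProfile lam) (r x : ℝ) :
    0 ≤ deriv (deriv (collar lam r)) x := by
  rw [deriv_deriv_collar hlam]
  have h1 := hlam.deriv_nonneg (Real.exp (-2 * x) - 1)
  have h2 := hlam.deriv_nonneg (Real.exp (2 * x) - r ^ 2)
  have h3 := hlam.deriv_deriv_nonneg (Real.exp (-2 * x) - 1)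
  have h4 := hlam.deriv_deriv_nonneg (Real.exp (2 * x) - r ^ 2)
  positivity

theorem sq_eq_exp (hr : 1 < r) : r ^ 2 = Real.exp (2 * Real.log r) := by
  rw [two_mul, Real.exp_add, Real.exp_log (by linarith)]
  ring

theorem collar_arguments_nonpos (hr : 1 < r) {x : ℝ} (h0 : 0 ≤ x) (h1 : x ≤ Real.log r) :
    Real.exp (-2 * x) - 1 ≤ 0 ∧ Real.exp (2 * x) - r ^ 2 ≤ 0 := by
  rw [sq_eq_exp hr, sub_nonpos, sub_nonpos]
  exact ⟨Real.exp_le_one_iff.2 (by linarith), Real.exp_le_exp.2 (by linarith)⟩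

theorem collar_eq_zero (hlam : IsWormProfile lam) (hr : 1 < r) {x : ℝ} (h0 : 0 ≤ x)
    (h1 : x ≤ Real.log r) : collar lam r x = 0 := by
  obtain ⟨h2, h3⟩ := collar_arguments_nonpos hr h0 h1
  rw [collar, hlam.eq_zero _ h2, hlam.eq_zero _ h3, add_zero]

theorem deriv_collar_eq_zero (hlam : IsWormProfile lam) (hr : 1 < r) {x : ℝ} (h0 : 0 ≤ x)
    (h1 : x ≤ Real.log r) : deriv (collar lam r) x = 0 := by
  obtain ⟨h2, h3⟩ := collar_arguments_nonpos hr h0 h1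
  simp only [deriv_collar hlam, hlam.deriv_eq_zero h2, hlam.deriv_eq_zero h3, mul_zero, add_zero]

theorem deriv_deriv_collar_eq_zero (hlam : IsWormProfile lam) (hr : 1 < r) {x : ℝ} (h0 : 0 ≤ x)
    (h1 : x ≤ Real.log r) : deriv (deriv (collar lam r)) x = 0 := by
  obtain ⟨h2, h3⟩ := collar_arguments_nonpos hr h0 h1
  simp only [deriv_deriv_collar hlam, hlam.deriv_eq_zero h2, hlam.deriv_eq_zero h3,
    hlam.deriv_deriv_eq_zero h2, hlam.deriv_deriv_eq_zero h3, mul_zero, add_zero]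

/-- Outside [0, log r] exactly one of the two arguments of λ is positive, so the two terms cannot
cancel in the first derivative. -/
theorem collar_of_outside (hlam : IsWormProfile lam) (hr : 1 < r) {x : ℝ}
    (hx : x < 0 ∨ Real.log r < x) : 0 < collar lam r x ∧ deriv (collar lam r) x ≠ 0 ∧
      0 < deriv (deriv (collar lam r)) x := by
  have hlog := Real.log_pos hr
  rw [deriv_deriv_collar hlam, deriv_collar hlam, collar, sq_eq_exp hr]
  have E1 := Real.exp_pos (-2 * x)
  have E2 := Real.exp_pos (2 * x)
  rcases hx with hx | hx
  · have h1 : 0 < Real.exp (-2 * x) - 1 := by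
      rw [sub_pos, Real.one_lt_exp_iff]; linarith
    have h2 : Real.exp (2 * x) - Real.exp (2 * Real.log r) ≤ 0 := by
      rw [sub_nonpos, Real.exp_le_exp]; linarith
    have l0 := hlam.pos h1
    have l1 := hlam.deriv_pos h1
    have l2 := hlam.deriv_deriv_pos _ h1
    simp only [hlam.eq_zero _ h2, hlam.deriv_eq_zero h2, hlam.deriv_deriv_eq_zero h2]
    exact ⟨by linarith, ne_of_lt (by nlinarith [mul_pos E1 l1]), by positivity⟩
  · have h1 : Real.exp (-2 * x) - 1 ≤ 0 := by
      rw [sub_nonpos, Real.exp_le_one_iff]; linarith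
    have h2 : 0 < Real.exp (2 * x) - Real.exp (2 * Real.log r) := by
      rw [sub_pos, Real.exp_lt_exp]; linarith
    have l0 := hlam.pos h2
    have l1 := hlam.deriv_pos h2
    have l2 := hlam.deriv_deriv_pos _ h2
    simp only [hlam.eq_zero _ h1, hlam.deriv_eq_zero h1, hlam.deriv_deriv_eq_zero h1]
    exact ⟨by linarith, ne_of_gt (by nlinarith [mul_pos E2 l1]), by positivity⟩

end Collar

/-! ### The worm function along holomorphic discs. -/

/-- The unimodular factor `e^{i log |z|²}`. -/
noncomputable def phase (z : ℂ) : ℂ := Complex.exp (Complex.I * (Real.log (‖z‖ ^ 2) : ℂ))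

/-- The rotated fibre coordinate `w e^{-i log |z|²}`. -/
noncomputable def fibre (p : ℂ × ℂ) : ℂ := p.2 * conj (phase p.1)

section Worm

variable {lam : ℝ → ℝ} {r : ℝ}

theorem phase_mul_conj (z : ℂ) : phase z * conj (phase z) = 1 := by
  rw [Complex.mul_conj, Complex.normSq_eq_norm_sq, phase, mul_comm, Complex.norm_exp_ofReal_mul_I]
  simp

theorem norm_phase (z : ℂ) : ‖phase z‖ = 1 := by
  rw [phase, mul_comm, Complex.norm_exp_ofReal_mul_I]

theorem exp_two_mul_log_norm {z : ℂ} (hz : z ≠ 0) : Real.exp (2 * Real.log ‖z‖) = ‖z‖ ^ 2 := by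
  rw [two_mul, Real.exp_add, Real.exp_log (norm_pos_iff.2 hz)]
  ring

theorem exp_neg_two_mul_log_norm {z : ℂ} (hz : z ≠ 0) :
    Real.exp (-2 * Real.log ‖z‖) = 1 / ‖z‖ ^ 2 := by
  rw [neg_mul, Real.exp_neg, exp_two_mul_log_norm hz, one_div]

theorem wormFunction_eq {p : ℂ × ℂ} (hp : p.1 ≠ 0) : wormFunction lam r p =
    (1 + (fibre p).re) ^ 2 + (fibre p).im ^ 2 - 1 + collar lam r (Real.log ‖p.1‖) := by
  have h : ‖p.2 + phase p.1‖ ^ 2 = (1 + (fibre p).re) ^ 2 + (fibre p).im ^ 2 := by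
    have : ‖p.2 + phase p.1‖ = ‖1 + fibre p‖ := by
      rw [← mul_one ‖p.2 + _‖, ← norm_phase p.1, ← RCLike.norm_conj (phase p.1), ← norm_mul,
        add_mul, phase_mul_conj, add_comm, fibre]
    rw [this, ← Complex.normSq_eq_norm_sq, Complex.normSq_apply]
    simp; ring
  rw [wormFunction, collar, exp_two_mul_log_norm hp, exp_neg_two_mul_log_norm hp, ← h, phase]
  ring

theorem contDiffAt_norm_sq_fst {n : WithTop ℕ∞} (p : ℂ × ℂ) :
    ContDiffAt ℝ n (fun q : ℂ × ℂ => ‖q.1‖ ^ 2) p :=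
  (contDiff_fst.norm_sq ℝ).contDiffAt

theorem contDiffAt_log_norm {n : WithTop ℕ∞} {p : ℂ × ℂ} (hp : p.1 ≠ 0) :
    ContDiffAt ℝ n (fun q : ℂ × ℂ => Real.log ‖q.1‖) p := by
  have h : ContDiffAt ℝ n (fun q : ℂ × ℂ => Real.log (‖q.1‖ ^ 2) / 2) p :=
    ((contDiffAt_norm_sq_fst p).log (by simpa using hp)).div_const 2
  refine h.congr_of_eventuallyEq (Eventually.of_forall fun q => ?_)
  simp

theorem contDiffAt_phase {n : WithTop ℕ∞} {p : ℂ × ℂ} (hp : p.1 ≠ 0) :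
    ContDiffAt ℝ n (fun q : ℂ × ℂ => phase q.1) p := by
  have h : ContDiffAt ℝ n (fun q : ℂ × ℂ => ((Real.log (‖q.1‖ ^ 2) : ℝ) : ℂ)) p :=
    Complex.ofRealCLM.contDiff.contDiffAt.comp p
      ((contDiffAt_norm_sq_fst p).log (by simpa using hp))
  exact (contDiffAt_const.mul h).cexp

theorem contDiffAt_wormFunction (hlam : IsWormProfile lam) {p : ℂ × ℂ} (hp : p.1 ≠ 0) :
    ContDiffAt ℝ ∞ (wormFunction lam r) p := by
  have h1 : ContDiffAt ℝ ∞ (fun q : ℂ × ℂ => ‖q.2 + phase q.1‖ ^ 2 - 1) p :=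
    ((contDiffAt_snd.add (contDiffAt_phase hp)).norm_sq ℝ).sub contDiffAt_const
  have h2 : ContDiffAt ℝ ∞ (fun q : ℂ × ℂ => collar lam r (Real.log ‖q.1‖)) p :=
    (contDiff_collar hlam r).contDiffAt.comp p (contDiffAt_log_norm hp)
  refine (h1.add h2).congr_of_eventuallyEq ?_
  have : ∀ᶠ q in 𝓝 p, q.1 ≠ 0 := continuous_fst.continuousAt.eventually_ne hp
  filter_upwards [this] with q hq
  rw [wormFunction, collar, exp_two_mul_log_norm hq, exp_neg_two_mul_log_norm hq, phase]
  ring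

/-- A real curve through `p` in the holomorphic disc `ζ ↦ (z e^{ηζ}, w + ζ t)`. -/
noncomputable def discCurve (p : ℂ × ℂ) (η t u : ℂ) (s : ℝ) : ℂ × ℂ :=
  (p.1 * Complex.exp (η * u * s), p.2 + s * (u * t))

theorem hasDerivAt_discCurve (p : ℂ × ℂ) (η t u : ℂ) (s : ℝ) :
    HasDerivAt (discCurve p η t u) (p.1 * (Complex.exp (η * u * s) * (η * u)), u * t) s := by
  have h0 : HasDerivAt (fun s : ℝ => (s : ℂ)) 1 s := Complex.ofRealCLM.hasDerivAt
  refine HasDerivAt.prodMk ?_ ?_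
  · exact ((((h0.const_mul (η * u)).cexp).const_mul p.1)).congr_deriv (by ring)
  · exact ((h0.mul_const (u * t)).const_add p.2).congr_deriv (by ring)

theorem hasDerivAt_discCurve' (p : ℂ × ℂ) (η t u : ℂ) :
    HasDerivAt (fun s : ℝ => ((p.1 * (Complex.exp (η * u * s) * (η * u)), u * t) : ℂ × ℂ))
      (p.1 * (η * u) ^ 2, 0) 0 := by
  have h0 : HasDerivAt (fun s : ℝ => (s : ℂ)) 1 0 := Complex.ofRealCLM.hasDerivAt
  refine HasDerivAt.prodMk ?_ (hasDerivAt_const _ _)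
  refine (((((h0.const_mul (η * u)).cexp).mul_const (η * u)).const_mul p.1)).congr_deriv ?_
  simp only [Complex.ofReal_zero, mul_zero, Complex.exp_zero]
  ring

/-- For z ≠ 0 every tangent vector has the form (zη, t), so these discs detect the whole complex
Hessian. Parametrizing z exponentially keeps log|z| affine on them. -/
theorem four_mul_leviForm_discCurve {f : ℂ × ℂ → ℝ} {p : ℂ × ℂ} {η t : ℂ} {b₁ c₁ b₂ c₂ : ℝ}
    (hf : ContDiffAt ℝ 2 f p) (hj₁ : HasTwoJetAt (fun s => f (discCurve p η t 1 s)) b₁ c₁ 0)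
    (hj₂ : HasTwoJetAt (fun s => f (discCurve p η t Complex.I s)) b₂ c₂ 0) :
    4 * leviForm f p (p.1 * η, t) = c₁ + c₂ ∧ fderiv ℝ f p (p.1 * η, t) = b₁ ∧
      fderiv ℝ f p (Complex.I • (p.1 * η, t)) = b₂ := by
  refine four_mul_leviForm_eq hf (m := (p.1 * (η * 1) ^ 2, 0)) (by simp [discCurve])
    (by simp [discCurve]) (hasDerivAt_discCurve p η t 1) (hasDerivAt_discCurve p η t Complex.I)
    (hasDerivAt_discCurve' p η t 1) ?_ (by simp) ?_ hj₁ hj₂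
  · refine (hasDerivAt_discCurve' p η t Complex.I).congr_deriv ?_
    rw [mul_pow η Complex.I, Complex.I_sq]
    simp
  · simp; ring

theorem log_norm_discCurve {p : ℂ × ℂ} (hp : p.1 ≠ 0) (η t u : ℂ) (s : ℝ) :
    Real.log ‖(discCurve p η t u s).1‖ = Real.log ‖p.1‖ + (η * u).re * s := by
  rw [discCurve, norm_mul, Real.log_mul (by simpa using hp) (by simp), Complex.norm_exp,
    Real.log_exp, Complex.re_mul_ofReal]

theorem phase_eq (z : ℂ) : phase z = Complex.exp (((2 * Real.log ‖z‖ : ℝ) : ℂ) * Complex.I) := by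
  rw [phase, Real.log_pow, mul_comm]
  simp

/-- Since log|z| grows linearly in s, the phase is multiplied by a rotation of constant angular
speed. -/
theorem fibre_discCurve {p : ℂ × ℂ} (hp : p.1 ≠ 0) (η t u : ℂ) (s : ℝ) :
    fibre (discCurve p η t u s) = (fibre p + s * (u * (t * conj (phase p.1)))) *
      conj (Complex.exp (((2 * ((η * u).re * s) : ℝ) : ℂ) * Complex.I)) := by
  have : phase (discCurve p η t u s).1 = phase p.1 *
      Complex.exp (((2 * ((η * u).re * s) : ℝ) : ℂ) * Complex.I) := by
    rw [phase_eq, phase_eq, log_norm_discCurve hp, ← Complex.exp_add, ← add_mul]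
    push_cast; ring_nf
  rw [fibre, this, fibre, map_mul, discCurve]
  ring

/-- The rotation is moved from W onto the centre 1 of the fibre disc, using its unimodularity. The
argument is kept as `0 + 2 * …` to match the affine jet. -/
theorem wormFunction_discCurve {p : ℂ × ℂ} (hp : p.1 ≠ 0) (η t u : ℂ) (s : ℝ) :
    wormFunction lam r (discCurve p η t u s) =
      (((fibre p).re + (u * (t * conj (phase p.1))).re * s) +
        Real.cos (0 + 2 * (η * u).re * s)) ^ 2 +
      (((fibre p).im + (u * (t * conj (phase p.1))).im * s) +
        Real.sin (0 + 2 * (η * u).re * s)) ^ 2 +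
      (-1 + collar lam r (Real.log ‖p.1‖ + (η * u).re * s)) := by
  have hz : (discCurve p η t u s).1 ≠ 0 := by simp [discCurve, hp]
  rw [wormFunction_eq hz, log_norm_discCurve hp, fibre_discCurve hp, ← Complex.exp_conj]
  simp only [map_mul, Complex.conj_ofReal, Complex.conj_I, mul_neg, ← neg_mul, ← Complex.ofReal_neg]
  generalize u * (t * conj (phase p.1)) = T
  rw [Complex.mul_re, Complex.mul_im, Complex.exp_ofReal_mul_I_re, Complex.exp_ofReal_mul_I_im,
    Complex.add_re, Complex.add_im, Complex.re_ofReal_mul, Complex.im_ofReal_mul, neg_mul,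
    Real.cos_neg, Real.sin_neg, zero_add, mul_assoc 2]
  linear_combination (((fibre p).re + s * T.re) ^ 2 + ((fibre p).im + s * T.im) ^ 2 - 1) *
    (Real.sin_sq_add_cos_sq (2 * ((η * u).re * s)))

theorem hasTwoJetAt_worm_model {C : ℝ → ℝ} {W₁ W₂ T₁ T₂ a x L₁ L₂ : ℝ}
    (hC : HasTwoJetAt C L₁ L₂ x) :
    HasTwoJetAt (fun s => ((W₁ + T₁ * s) + Real.cos (0 + 2 * a * s)) ^ 2 +
        ((W₂ + T₂ * s) + Real.sin (0 + 2 * a * s)) ^ 2 + (-1 + C (x + a * s)))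
      (2 * (1 + W₁) * T₁ + 2 * W₂ * (T₂ + 2 * a) + a * L₁)
      (2 * (T₁ ^ 2 + T₂ ^ 2) + 8 * a * T₂ - 8 * a ^ 2 * W₁ + a ^ 2 * L₂) 0 := by
  have hl := HasTwoJetAt.affine 0 (2 * a) 0
  have hcos : HasTwoJetAt Real.cos 0 (-1) ((0 : ℝ) + 2 * a * 0) :=
    (HasTwoJetAt.of_hasDerivAt (g' := fun x => -Real.sin x)
      (Eventually.of_forall Real.hasDerivAt_cos) (Real.hasDerivAt_sin _).neg).congr_jet
      (by simp) (by simp)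
  have hsin : HasTwoJetAt Real.sin 1 0 ((0 : ℝ) + 2 * a * 0) :=
    (HasTwoJetAt.of_hasDerivAt (g' := fun x => Real.cos x)
      (Eventually.of_forall Real.hasDerivAt_sin) (Real.hasDerivAt_cos _)).congr_jet
      (by simp) (by simp)
  have hC' : HasTwoJetAt C L₁ L₂ (x + a * 0) := by simpa using hC
  have h1 := ((HasTwoJetAt.affine W₁ T₁ 0).add
    (HasTwoJetAt.comp (g := fun s => 0 + 2 * a * s) hcos hl)).sq
  have h2 := ((HasTwoJetAt.affine W₂ T₂ 0).add
    (HasTwoJetAt.comp (g := fun s => 0 + 2 * a * s) hsin hl)).sq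
  have h3 := (HasTwoJetAt.const (-1) 0).add
    (HasTwoJetAt.comp (g := fun s => x + a * s) hC' (HasTwoJetAt.affine x a 0))
  refine ((h1.add h2).add h3).congr_jet ?_ ?_
  · simp; ring
  · simp; ring

theorem hasTwoJetAt_wormFunction (hlam : IsWormProfile lam) {p : ℂ × ℂ} (hp : p.1 ≠ 0)
    (η t u : ℂ) :
    HasTwoJetAt (fun s => wormFunction lam r (discCurve p η t u s))
      (2 * (1 + (fibre p).re) * (u * (t * conj (phase p.1))).re +
        2 * (fibre p).im * ((u * (t * conj (phase p.1))).im + 2 * (η * u).re) +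
        (η * u).re * deriv (collar lam r) (Real.log ‖p.1‖))
      (2 * ((u * (t * conj (phase p.1))).re ^ 2 + (u * (t * conj (phase p.1))).im ^ 2) +
        8 * (η * u).re * (u * (t * conj (phase p.1))).im -
        8 * (η * u).re ^ 2 * (fibre p).re +
        (η * u).re ^ 2 * deriv (deriv (collar lam r)) (Real.log ‖p.1‖)) 0 := by
  have h2 : ContDiffAt ℝ 2 (collar lam r) (Real.log ‖p.1‖) :=
    ((contDiff_collar hlam r).of_le (by norm_cast)).contDiffAt
  exact (hasTwoJetAt_worm_model (HasTwoJetAt.of_contDiffAt h2)).congr_of_eventuallyEq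
    (Eventually.of_forall fun s => wormFunction_discCurve hp η t u s)

end Worm

/-! ### Explicit complex Hessians and the Hermitian form. -/

section LeviForm

variable {lam : ℝ → ℝ} {r : ℝ} {p : ℂ × ℂ}

theorem contDiffAt_two_wormFunction (hlam : IsWormProfile lam) (hp : p.1 ≠ 0) :
    ContDiffAt ℝ 2 (wormFunction lam r) p :=
  (contDiffAt_wormFunction hlam hp).of_le (by norm_cast)

theorem wormFunction_data (hlam : IsWormProfile lam) (hp : p.1 ≠ 0) (η T : ℂ) :
    4 * leviForm (wormFunction lam r) p (p.1 * η, T * phase p.1) =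
      4 * (T.re ^ 2 + T.im ^ 2) + 8 * (η.re * T.im - η.im * T.re) +
        (η.re ^ 2 + η.im ^ 2) * (deriv (deriv (collar lam r)) (Real.log ‖p.1‖) -
          8 * (fibre p).re) ∧
    fderiv ℝ (wormFunction lam r) p (p.1 * η, T * phase p.1) =
      2 * ((1 + (fibre p).re) * T.re + (fibre p).im * T.im +
        η.re * (2 * (fibre p).im + deriv (collar lam r) (Real.log ‖p.1‖) / 2)) ∧
    fderiv ℝ (wormFunction lam r) p (Complex.I • (p.1 * η, T * phase p.1)) =
      -2 * ((1 + (fibre p).re) * T.im - (fibre p).im * T.re +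
        η.im * (2 * (fibre p).im + deriv (collar lam r) (Real.log ‖p.1‖) / 2)) := by
  have h := four_mul_leviForm_discCurve (η := η) (t := T * phase p.1)
    (contDiffAt_two_wormFunction (r := r) hlam hp)
    (hasTwoJetAt_wormFunction hlam hp η _ 1) (hasTwoJetAt_wormFunction hlam hp η _ Complex.I)
  rw [mul_assoc T, phase_mul_conj, mul_one] at h
  obtain ⟨h1, h2, h3⟩ := h
  rw [h1, h2, h3]
  simp
  refine ⟨by ring, by ring, by ring⟩

/-- The worm function weighted by a function of `log |z|`. -/
noncomputable def weightedWorm (lam : ℝ → ℝ) (r : ℝ) (m : ℝ → ℝ) (p : ℂ × ℂ) : ℝ :=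
  wormFunction lam r p * m (Real.log ‖p.1‖)

theorem contDiffAt_weightedWorm (hlam : IsWormProfile lam) {m : ℝ → ℝ} (hm : ContDiff ℝ ∞ m)
    (hp : p.1 ≠ 0) : ContDiffAt ℝ ∞ (weightedWorm lam r m) p :=
  (contDiffAt_wormFunction hlam hp).mul (hm.contDiffAt.comp p (contDiffAt_log_norm hp))

theorem hasTwoJetAt_weight {m : ℝ → ℝ} (hm : ContDiff ℝ ∞ m) (hp : p.1 ≠ 0) (η t u : ℂ) :
    HasTwoJetAt (fun s => m (Real.log ‖(discCurve p η t u s).1‖))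
      ((η * u).re * deriv m (Real.log ‖p.1‖))
      ((η * u).re ^ 2 * deriv (deriv m) (Real.log ‖p.1‖)) 0 := by
  have h2 : ContDiffAt ℝ 2 m (Real.log ‖p.1‖ + (η * u).re * 0) :=
    (hm.of_le (by norm_cast)).contDiffAt
  have h := HasTwoJetAt.comp (g := fun s => Real.log ‖p.1‖ + (η * u).re * s)
    (HasTwoJetAt.of_contDiffAt h2) (HasTwoJetAt.affine _ _ 0)
  refine (h.congr_of_eventuallyEq (Eventually.of_forall fun s => ?_)).congr_jet ?_ ?_
  · rw [log_norm_discCurve hp]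
  · simp; ring
  · simp; ring

theorem weightedWorm_data (hlam : IsWormProfile lam) {m : ℝ → ℝ} (hm : ContDiff ℝ ∞ m)
    (hp : p.1 ≠ 0) (η T : ℂ) :
    4 * leviForm (weightedWorm lam r m) p (p.1 * η, T * phase p.1) =
      4 * leviForm (wormFunction lam r) p (p.1 * η, T * phase p.1) * m (Real.log ‖p.1‖) +
      2 * deriv m (Real.log ‖p.1‖) *
        (η.re * fderiv ℝ (wormFunction lam r) p (p.1 * η, T * phase p.1) -
         η.im * fderiv ℝ (wormFunction lam r) p (Complex.I • (p.1 * η, T * phase p.1))) +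
      wormFunction lam r p * ((η.re ^ 2 + η.im ^ 2) * deriv (deriv m) (Real.log ‖p.1‖)) ∧
    fderiv ℝ (weightedWorm lam r m) p (p.1 * η, T * phase p.1) =
      fderiv ℝ (wormFunction lam r) p (p.1 * η, T * phase p.1) * m (Real.log ‖p.1‖) +
      wormFunction lam r p * (η.re * deriv m (Real.log ‖p.1‖)) ∧
    fderiv ℝ (weightedWorm lam r m) p (Complex.I • (p.1 * η, T * phase p.1)) =
      fderiv ℝ (wormFunction lam r) p (Complex.I • (p.1 * η, T * phase p.1)) *
        m (Real.log ‖p.1‖) - wormFunction lam r p * (η.im * deriv m (Real.log ‖p.1‖)) := by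
  have hf := contDiffAt_two_wormFunction (r := r) hlam hp
  have hR := four_mul_leviForm_discCurve (η := η) (t := T * phase p.1) hf
    (hasTwoJetAt_wormFunction hlam hp η _ 1) (hasTwoJetAt_wormFunction hlam hp η _ Complex.I)
  have hw : ContDiffAt ℝ 2 (weightedWorm lam r m) p :=
    (contDiffAt_weightedWorm hlam hm hp).of_le (by norm_cast)
  have hM := four_mul_leviForm_discCurve (η := η) (t := T * phase p.1) hw
    ((hasTwoJetAt_wormFunction hlam hp η _ 1).mul (hasTwoJetAt_weight hm hp η _ 1))
    ((hasTwoJetAt_wormFunction hlam hp η _ Complex.I).mul (hasTwoJetAt_weight hm hp η _ Complex.I))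
  rw [hM.1, hM.2.1, hM.2.2, hR.1, hR.2.1, hR.2.2]
  simp [discCurve]
  refine ⟨by ring, by ring⟩

/-- The factor |1+W|² = |∂ρ/∂w|² allows T to be eliminated in favour of E, where Dρ(t) = 2E₁ and
Dρ(it) = -2E₂. With δ = -ρ, the boundary and tangency conditions are δ = 0 and E = 0, and then only
the visibly nonnegative last bracket survives. -/
theorem worm_levi_identity {W₁ W₂ T₁ T₂ η₁ η₂ C L L₂ δ c E₁ E₂ : ℝ}
    (hδ : δ = 1 - C - ((1 + W₁) ^ 2 + W₂ ^ 2)) (hc : c = 2 * W₂ + L)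
    (hE₁ : E₁ = (1 + W₁) * T₁ + W₂ * T₂ + η₁ * c) (hE₂ : E₂ = (1 + W₁) * T₂ - W₂ * T₁ + η₂ * c) :
    ((1 + W₁) ^ 2 + W₂ ^ 2) * (4 * (T₁ ^ 2 + T₂ ^ 2) + 8 * (η₁ * T₂ - η₂ * T₁) +
      (η₁ ^ 2 + η₂ ^ 2) * (L₂ - 8 * W₁)) =
    4 * (E₁ ^ 2 + E₂ ^ 2) +
      8 * ((E₁ * η₁ + E₂ * η₂) * (W₂ - c) - (E₁ * η₂ - E₂ * η₁) * (1 + W₁)) +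
      4 * (η₁ ^ 2 + η₂ ^ 2) * (δ * (1 + W₁) ^ 2 + ((W₂ + L) ^ 2 + C * (1 + W₁) ^ 2 +
        ((1 + W₁) ^ 2 + W₂ ^ 2) * (W₁ ^ 2 + L₂ / 4))) := by
  subst hE₁ hE₂ hc hδ
  ring

/-- Positivity of the complex Hessian of `-(-ρ)^τ` in terms of a `2 × 2` Hermitian form. -/
theorem worm_hessian_nonneg {W₁ W₂ T₁ T₂ η₁ η₂ C L L₂ δ c E₁ E₂ p₁ p₂ τ : ℝ}
    (hδ : δ = 1 - C - ((1 + W₁) ^ 2 + W₂ ^ 2)) (hδ0 : 0 ≤ δ) (hC : 0 ≤ C) (hL₂ : 0 ≤ L₂)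
    (hV : 0 < (1 + W₁) ^ 2 + W₂ ^ 2) (hτ : τ < 1) (hc : c = 2 * W₂ + L)
    (hE₁ : E₁ = (1 + W₁) * T₁ + W₂ * T₂ + η₁ * c) (hE₂ : E₂ = (1 + W₁) * T₂ - W₂ * T₁ + η₂ * c)
    (hdisc : (W₂ - c + τ * p₁ * ((1 + W₁) ^ 2 + W₂ ^ 2) / 2) ^ 2 + (1 + W₁) ^ 2 ≤
      (1 - τ) * ((1 + W₁) ^ 2 + W₂ ^ 2) * ((1 + W₁) ^ 2 -
        ((1 + W₁) ^ 2 + W₂ ^ 2) * (p₂ - (1 - τ) * p₁ ^ 2) / 4)) :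
    0 ≤ δ * ((4 * (T₁ ^ 2 + T₂ ^ 2) + 8 * (η₁ * T₂ - η₂ * T₁) +
        (η₁ ^ 2 + η₂ ^ 2) * (L₂ - 8 * W₁)) + 4 * p₁ * (η₁ * E₁ + η₂ * E₂) -
        δ * (η₁ ^ 2 + η₂ ^ 2) * p₂) +
      (1 - τ) * ((2 * E₁ - δ * η₁ * p₁) ^ 2 + (2 * E₂ - δ * η₂ * p₁) ^ 2) := by
  have key := worm_levi_identity (L₂ := L₂) hδ hc hE₁ hE₂
  generalize (4 * (T₁ ^ 2 + T₂ ^ 2) + 8 * (η₁ * T₂ - η₂ * T₁) +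
        (η₁ ^ 2 + η₂ ^ 2) * (L₂ - 8 * W₁)) = S at key ⊢
  clear hE₁ hE₂ hc hδ
  have hslack : 0 ≤ (W₂ + L) ^ 2 + C * (1 + W₁) ^ 2 +
        ((1 + W₁) ^ 2 + W₂ ^ 2) * (W₁ ^ 2 + L₂ / 4) := by positivity
  generalize (W₂ + L) ^ 2 + C * (1 + W₁) ^ 2 +
        ((1 + W₁) ^ 2 + W₂ ^ 2) * (W₁ ^ 2 + L₂ / 4) = K at key hslack
  generalize hV2 : (1 + W₁) ^ 2 + W₂ ^ 2 = V at *
  generalize hU : 1 + W₁ = U at *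
  have hα : 0 < (1 - τ) * V := mul_pos (by linarith) hV
  set α := (1 - τ) * V with hαdef
  set β := W₂ - c + τ * p₁ * V / 2 with hβ
  set γ := U ^ 2 - V * (p₂ - (1 - τ) * p₁ ^ 2) / 4 with hγ
  -- After multiplication by V the expression contains the Hermitian form in E and δη with diagonal
  -- entries α, γ and off-diagonal modulus squared β² + U². Multiplying by α completes the square,
  -- and the hypothesis `hdisc` bounds the determinant αγ - β² - U² below by 0. The leftover terms
  -- carry K ≥ 0 or |E|² with nonnegative coefficients.
  have h1 : 0 ≤ α * (V * (δ * (S + 4 * p₁ * (η₁ * E₁ + η₂ * E₂) -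
        δ * (η₁ ^ 2 + η₂ ^ 2) * p₂) +
      (1 - τ) * ((2 * E₁ - δ * η₁ * p₁) ^ 2 + (2 * E₂ - δ * η₂ * p₁) ^ 2))) := by
    have e1 : V * (δ * (S + 4 * p₁ * (η₁ * E₁ + η₂ * E₂) - δ * (η₁ ^ 2 + η₂ ^ 2) * p₂) +
        (1 - τ) * ((2 * E₁ - δ * η₁ * p₁) ^ 2 + (2 * E₂ - δ * η₂ * p₁) ^ 2)) =
        4 * (α * (E₁ ^ 2 + E₂ ^ 2) +
          2 * δ * ((E₁ * η₁ + E₂ * η₂) * β - (E₁ * η₂ - E₂ * η₁) * U) +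
          δ ^ 2 * (η₁ ^ 2 + η₂ ^ 2) * γ) + 4 * δ * (E₁ ^ 2 + E₂ ^ 2) +
          4 * δ * ((η₁ ^ 2 + η₂ ^ 2) * K) := by
      rw [hαdef, hβ, hγ]
      linear_combination δ * key
    have e2 : α * (α * (E₁ ^ 2 + E₂ ^ 2) +
          2 * δ * ((E₁ * η₁ + E₂ * η₂) * β - (E₁ * η₂ - E₂ * η₁) * U) +
          δ ^ 2 * (η₁ ^ 2 + η₂ ^ 2) * γ) =
        (α * E₁ + δ * (η₁ * β - η₂ * U)) ^ 2 + (α * E₂ + δ * (η₂ * β + η₁ * U)) ^ 2 +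
          δ ^ 2 * (η₁ ^ 2 + η₂ ^ 2) * (α * γ - (β ^ 2 + U ^ 2)) := by ring
    have h3 : 0 ≤ α * γ - (β ^ 2 + U ^ 2) := by linarith
    have h4 : 0 ≤ α * (α * (E₁ ^ 2 + E₂ ^ 2) +
          2 * δ * ((E₁ * η₁ + E₂ * η₂) * β - (E₁ * η₂ - E₂ * η₁) * U) +
          δ ^ 2 * (η₁ ^ 2 + η₂ ^ 2) * γ) := by rw [e2]; positivity
    have h5 : 0 ≤ α * (4 * δ * (E₁ ^ 2 + E₂ ^ 2) + 4 * δ * ((η₁ ^ 2 + η₂ ^ 2) * K)) := by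
      positivity
    rw [e1]
    linarith
  exact nonneg_of_mul_nonneg_right (nonneg_of_mul_nonneg_right h1 hα) hV

end LeviForm

/-! ### Geometry of the worm domain: boundary, pseudoconvexity, weak points. -/

section Domain

variable {lam : ℝ → ℝ} {r : ℝ} {p : ℂ × ℂ}

theorem isOpen_fst_ne_zero : IsOpen {p : ℂ × ℂ | p.1 ≠ 0} :=
  isOpen_ne_fun continuous_fst continuous_const

/-- All terms other than -1 are nonnegative, so neither value of λ can exceed 1, and w lies in a
unit disc whose centre has modulus 1. -/
theorem wormDomain_bounds (hlam : IsWormProfile lam) (hp : p ∈ wormDomain lam r) :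
    1 / 2 ≤ ‖p.1‖ ^ 2 ∧ ‖p.1‖ ^ 2 ≤ r ^ 2 + 1 ∧ ‖p.2‖ ≤ 2 := by
  obtain ⟨hz, hneg⟩ := hp
  have hz' : 0 < ‖p.1‖ ^ 2 := by positivity
  have n1 := hlam.nonneg (1 / ‖p.1‖ ^ 2 - 1)
  have n2 := hlam.nonneg (‖p.1‖ ^ 2 - r ^ 2)
  change ‖p.2 + phase p.1‖ ^ 2 - 1 + lam (1 / ‖p.1‖ ^ 2 - 1) + lam (‖p.1‖ ^ 2 - r ^ 2) < 0 at hneg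
  have n3 := sq_nonneg ‖p.2 + phase p.1‖
  refine ⟨?_, ?_, ?_⟩
  · by_contra! h
    have : 1 < 1 / ‖p.1‖ ^ 2 - 1 := by
      have : 2 < 1 / ‖p.1‖ ^ 2 := by rw [lt_div_iff₀ hz']; linarith
      linarith
    linarith [hlam.one_lt _ this]
  · by_contra! h
    linarith [hlam.one_lt (‖p.1‖ ^ 2 - r ^ 2) (by linarith)]
  · have h1 : ‖p.2 + phase p.1‖ ≤ 1 := by nlinarith [norm_nonneg (p.2 + phase p.1)]
    have h2 : ‖p.2‖ ≤ ‖p.2 + phase p.1‖ + ‖phase p.1‖ := by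
      simpa using norm_sub_le (p.2 + phase p.1) (phase p.1)
    rw [norm_phase] at h2
    linarith

theorem closure_wormDomain_bounds (hlam : IsWormProfile lam) (hp : p ∈ closure (wormDomain lam r)) :
    1 / 2 ≤ ‖p.1‖ ^ 2 ∧ ‖p.1‖ ^ 2 ≤ r ^ 2 + 1 ∧ ‖p.2‖ ≤ 2 := by
  have hcl : IsClosed {p : ℂ × ℂ | 1 / 2 ≤ ‖p.1‖ ^ 2 ∧ ‖p.1‖ ^ 2 ≤ r ^ 2 + 1 ∧ ‖p.2‖ ≤ 2} := by
    have h1 : IsClosed {p : ℂ × ℂ | 1 / 2 ≤ ‖p.1‖ ^ 2} := isClosed_le (by fun_prop) (by fun_prop)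
    have h2 : IsClosed {p : ℂ × ℂ | ‖p.1‖ ^ 2 ≤ r ^ 2 + 1} :=
      isClosed_le (by fun_prop) (by fun_prop)
    have h3 : IsClosed {p : ℂ × ℂ | ‖p.2‖ ≤ 2} := isClosed_le (by fun_prop) (by fun_prop)
    exact h1.inter (h2.inter h3)
  exact closure_minimal (fun q hq => wormDomain_bounds hlam hq) hcl hp

theorem fst_ne_zero_of_mem_closure (hlam : IsWormProfile lam)
    (hp : p ∈ closure (wormDomain lam r)) : p.1 ≠ 0 := by
  intro h
  have := (closure_wormDomain_bounds hlam hp).1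
  rw [h] at this
  norm_num at this

theorem isCompact_closure_wormDomain (hlam : IsWormProfile lam) (r : ℝ) :
    IsCompact (closure (wormDomain lam r)) := by
  refine Metric.isCompact_of_isClosed_isBounded isClosed_closure ?_
  refine (Metric.isBounded_closedBall (x := (0 : ℂ × ℂ)) (r := r ^ 2 + 3)).subset fun p hp => ?_
  obtain ⟨-, h1, h2⟩ := closure_wormDomain_bounds hlam hp
  rw [mem_closedBall_zero_iff, Prod.norm_def]
  refine max_le ?_ ?_ <;> nlinarith [norm_nonneg p.1, sq_nonneg r, sq_nonneg (‖p.1‖ - 1)]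

theorem isOpen_wormDomain (hlam : IsWormProfile lam) (r : ℝ) : IsOpen (wormDomain lam r) := by
  rw [isOpen_iff_mem_nhds]
  rintro p ⟨hz, hneg⟩
  filter_upwards [isOpen_fst_ne_zero.mem_nhds hz,
    (contDiffAt_wormFunction hlam hz).continuousAt.eventually (gt_mem_nhds hneg)] with q h1 h2
  exact ⟨h1, h2⟩

theorem log_norm_outside (hr : 1 < r) (hp : p.1 ≠ 0) (h : ¬ (1 ≤ ‖p.1‖ ∧ ‖p.1‖ ≤ r)) :
    Real.log ‖p.1‖ < 0 ∨ Real.log r < Real.log ‖p.1‖ := by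
  have hpos := norm_pos_iff.2 hp
  by_cases h1 : 1 ≤ ‖p.1‖
  · exact Or.inr (Real.log_lt_log (by linarith) (not_le.1 fun h2 => h ⟨h1, h2⟩))
  · exact Or.inl (Real.log_neg hpos (not_le.1 h1))

theorem log_norm_inside (h : 1 ≤ ‖p.1‖ ∧ ‖p.1‖ ≤ r) :
    0 ≤ Real.log ‖p.1‖ ∧ Real.log ‖p.1‖ ≤ Real.log r :=
  ⟨Real.log_nonneg h.1, Real.log_le_log (by linarith) h.2⟩

theorem fst_ne_zero_of_one_le (h : 1 ≤ ‖p.1‖) : p.1 ≠ 0 :=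
  norm_pos_iff.1 (by linarith)

/-- A boundary point where the fibre disc degenerates lies in the collar. -/
theorem degenerate_fibre (hlam : IsWormProfile lam) (hr : 1 < r) (hp : p.1 ≠ 0)
    (h0 : wormFunction lam r p = 0) (hV : (1 + (fibre p).re) ^ 2 + (fibre p).im ^ 2 = 0) :
    (fibre p).re = -1 ∧ (fibre p).im = 0 ∧ deriv (collar lam r) (Real.log ‖p.1‖) ≠ 0 := by
  have h1 : (1 + (fibre p).re) ^ 2 = 0 := by
    linarith [sq_nonneg (1 + (fibre p).re), sq_nonneg (fibre p).im]
  have h2 : (fibre p).im ^ 2 = 0 := by linarith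
  refine ⟨by linarith [pow_eq_zero_iff (two_ne_zero) |>.1 h1], pow_eq_zero_iff two_ne_zero |>.1 h2,
    ?_⟩
  rw [wormFunction_eq hp, hV] at h0
  refine (collar_of_outside hlam hr (log_norm_outside hr hp fun h => ?_)).2.1
  have := log_norm_inside h
  rw [collar_eq_zero hlam hr this.1 this.2] at h0
  norm_num at h0

/-- Moving w radially away from the centre of the fibre disc changes ρ at rate 2|1+W|². At the
centre itself the derivative of the cut-off terms in log|z| takes over. -/
theorem fderiv_wormFunction_ne_zero (hlam : IsWormProfile lam) (hr : 1 < r) (hp : p.1 ≠ 0)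
    (h0 : wormFunction lam r p = 0) : fderiv ℝ (wormFunction lam r) p ≠ 0 := by
  intro hd
  by_cases hV : (1 + (fibre p).re) ^ 2 + (fibre p).im ^ 2 = 0
  · obtain ⟨h1, h2, h3⟩ := degenerate_fibre hlam hr hp h0 hV
    have := (wormFunction_data (r := r) hlam hp 1 0).2.1
    rw [hd, h1, h2] at this
    simp [h3] at this
  · have := (wormFunction_data (r := r) hlam hp 0 (1 + fibre p)).2.1
    rw [hd] at this
    simp at this
    exact hV (by linarith)

theorem mem_frontier_wormDomain_iff (hlam : IsWormProfile lam) (hr : 1 < r) :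
    p ∈ frontier (wormDomain lam r) ↔ p.1 ≠ 0 ∧ wormFunction lam r p = 0 := by
  constructor
  · intro hp
    have hz := fst_ne_zero_of_mem_closure hlam (frontier_subset_closure hp)
    refine ⟨hz, ?_⟩
    rw [(isOpen_wormDomain hlam r).frontier_eq] at hp
    have hc := (contDiffAt_wormFunction (r := r) hlam hz).continuousAt
    refine le_antisymm ?_ (not_lt.1 fun h => hp.2 ⟨hz, h⟩)
    by_contra! hpos
    obtain ⟨q, h1, h2⟩ := ((mem_closure_iff_frequently.1 hp.1).and_eventually
      (hc.eventually (lt_mem_nhds hpos))).exists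
    exact absurd h1.2 (not_lt.2 h2.le)
  · rintro ⟨hz, h0⟩
    rw [(isOpen_wormDomain hlam r).frontier_eq]
    refine ⟨?_, fun h => h.2.ne h0⟩
    by_contra hcl
    obtain ⟨n, hn⟩ := exists_fderiv_eq_one (fderiv_wormFunction_ne_zero hlam hr hz h0)
    have hd := (contDiffAt_two_wormFunction (r := r) hlam hz).differentiableAt (by simp)
    -- If p were outside the closure, the worm function would have no negative values near p. The
    -- implication to any other function would then hold vacuously, and comparing with minus the
    -- linear part contradicts Dρ ≠ 0.
    have hdl : HasFDerivAt (fun q => -fderiv ℝ (wormFunction lam r) p (q - p))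
        (-fderiv ℝ (wormFunction lam r) p) p :=
      (((fderiv ℝ (wormFunction lam r) p).hasFDerivAt).comp p
        ((hasFDerivAt_id p).sub_const p)).neg
    have hev : ∀ᶠ q in 𝓝 p, wormFunction lam r q < 0 →
        -fderiv ℝ (wormFunction lam r) p (q - p) < 0 := by
      filter_upwards [isClosed_closure.isOpen_compl.mem_nhds hcl,
        isOpen_fst_ne_zero.mem_nhds hz] with q hq hq' hneg
      exact absurd (subset_closure (show q ∈ wormDomain lam r from ⟨hq', hneg⟩)) hq
    have := fderiv_nonpos_of_neg hd hdl.differentiableAt h0 (by simp) hev (v := -n) (by simp [hn])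
    rw [hdl.fderiv] at this
    simp [hn] at this
    linarith

theorem isDefiningFunction_weightedWorm (hlam : IsWormProfile lam) (hr : 1 < r) {m : ℝ → ℝ}
    (hm : ContDiff ℝ ∞ m) (hpos : ∀ x, 0 < m x) :
    IsDefiningFunction ∞ (wormDomain lam r) (weightedWorm lam r m) := by
  refine ⟨{p | p.1 ≠ 0}, isOpen_fst_ne_zero, fun p hp => fst_ne_zero_of_mem_closure hlam hp,
    fun p hp => (contDiffAt_weightedWorm hlam hm hp).contDiffWithinAt, ?_, fun p hp => ?_⟩
  · ext p
    refine and_congr_right fun _ => ?_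
    rw [weightedWorm]
    constructor
    · intro h
      exact mul_neg_of_neg_of_pos h (hpos _)
    · intro h
      exact neg_of_mul_neg_left h (hpos _).le
  · obtain ⟨hz, h0⟩ := (mem_frontier_wormDomain_iff hlam hr).1 hp
    have h1 := (contDiffAt_wormFunction (r := r) hlam hz).differentiableAt (by simp)
    have h2 : DifferentiableAt ℝ (fun q : ℂ × ℂ => m (Real.log ‖q.1‖)) p :=
      (hm.differentiable (by simp) _).comp p
        ((contDiffAt_log_norm (n := 1) hz).differentiableAt (by simp))
    have : fderiv ℝ (weightedWorm lam r m) p =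
        m (Real.log ‖p.1‖) • fderiv ℝ (wormFunction lam r) p := by
      have := (h1.hasFDerivAt.mul h2.hasFDerivAt).fderiv
      rw [h0, zero_smul, zero_add] at this
      exact this
    rw [this]
    exact smul_ne_zero (hpos _).ne' (fderiv_wormFunction_ne_zero hlam hr hz h0)

theorem isDefiningFunction_wormFunction (hlam : IsWormProfile lam) (hr : 1 < r) :
    IsDefiningFunction ∞ (wormDomain lam r) (wormFunction lam r) := by
  have h := isDefiningFunction_weightedWorm hlam hr (m := fun _ => 1) contDiff_const
    fun _ => one_pos
  have : weightedWorm lam r (fun _ => 1) = wormFunction lam r := by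
    ext p; simp [weightedWorm]
  rwa [this] at h

theorem eq_discTangent (hp : p.1 ≠ 0) (t : ℂ × ℂ) :
    t = (p.1 * (t.1 / p.1), t.2 * conj (phase p.1) * phase p.1) := by
  ext1
  · simp [mul_div_cancel₀, hp]
  · simp only
    rw [mul_assoc, mul_comm (conj _), phase_mul_conj, mul_one]

/-- At a degenerate point W = -1, tangency forces η = 0 and |T|² remains. Elsewhere tangency forces
η ≠ 0, and the last bracket of `worm_levi_identity` is positive: it is |W|² over 1 ≤ |z| ≤ r, and it
contains a positive second derivative of the cut-off terms outside. -/
theorem leviForm_wormFunction_pos_or (hlam : IsWormProfile lam) (hr : 1 < r) (hp : p.1 ≠ 0)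
    (h0 : wormFunction lam r p = 0) {t : ℂ × ℂ} (ht : t ≠ 0)
    (htan : IsComplexTangent (wormFunction lam r) p t) :
    0 < leviForm (wormFunction lam r) p t ∨ (1 ≤ ‖p.1‖ ∧ ‖p.1‖ ≤ r ∧ p.2 = 0) := by
  rw [isComplexTangent_iff ((contDiffAt_two_wormFunction hlam hp).differentiableAt (by simp))]
    at htan
  obtain ⟨η, T, rfl⟩ : ∃ η T, t = (p.1 * η, T * phase p.1) := ⟨_, _, eq_discTangent hp t⟩
  obtain ⟨d1, d2, d3⟩ := wormFunction_data (r := r) hlam hp η T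
  rw [d2, d3] at htan
  have hη0 : η = 0 → T ≠ 0 := by
    rintro rfl rfl
    simp at ht
  clear ht d2 d3
  obtain ⟨t1, t2⟩ := htan
  by_cases hV : (1 + (fibre p).re) ^ 2 + (fibre p).im ^ 2 = 0
  · obtain ⟨h1, h2, h3⟩ := degenerate_fibre hlam hr hp h0 hV
    rw [h1, h2] at t1 t2
    have e1 : η.re = 0 := by
      have : η.re * deriv (collar lam r) (Real.log ‖p.1‖) = 0 := by linarith
      exact (mul_eq_zero.1 this).resolve_right h3
    have e2 : η.im = 0 := by
      have : η.im * deriv (collar lam r) (Real.log ‖p.1‖) = 0 := by linarith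
      exact (mul_eq_zero.1 this).resolve_right h3
    have hT := hη0 (Complex.ext e1 e2)
    have : 0 < T.re ^ 2 + T.im ^ 2 := by
      have := Complex.normSq_pos.2 hT
      rw [Complex.normSq_apply] at this
      linarith
    left
    rw [e1, e2] at d1
    linarith
  have hVpos : 0 < (1 + (fibre p).re) ^ 2 + (fibre p).im ^ 2 :=
    lt_of_le_of_ne (by positivity) (Ne.symm hV)
  have hw := wormFunction_eq (lam := lam) (r := r) hp
  rw [h0] at hw
  have key := worm_levi_identity (W₁ := (fibre p).re) (W₂ := (fibre p).im) (T₁ := T.re)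
    (T₂ := T.im) (η₁ := η.re) (η₂ := η.im) (C := collar lam r (Real.log ‖p.1‖))
    (L := deriv (collar lam r) (Real.log ‖p.1‖) / 2)
    (L₂ := deriv (deriv (collar lam r)) (Real.log ‖p.1‖)) (δ := 0) (E₁ := 0) (E₂ := 0)
    (by linarith) rfl (by linarith) (by linarith)
  rw [← d1] at key
  -- With η = 0 the tangency equations say that |1+W|² T = 0, so t would vanish.
  have hη : 0 < η.re ^ 2 + η.im ^ 2 := by
    by_contra! hle
    have h1 : η.re = 0 := by nlinarith [sq_nonneg η.re, sq_nonneg η.im]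
    have h2 : η.im = 0 := by nlinarith [sq_nonneg η.re, sq_nonneg η.im]
    refine hη0 (Complex.ext h1 h2) ?_
    rw [h1] at t1
    rw [h2] at t2
    have h3 : ((1 + (fibre p).re) ^ 2 + (fibre p).im ^ 2) * T.re = 0 := by
      linear_combination (1 + (fibre p).re) / 2 * t1 + (fibre p).im / 2 * t2
    have h4 : ((1 + (fibre p).re) ^ 2 + (fibre p).im ^ 2) * T.im = 0 := by
      linear_combination (fibre p).im / 2 * t1 - (1 + (fibre p).re) / 2 * t2
    exact Complex.ext ((mul_eq_zero.1 h3).resolve_left hV) ((mul_eq_zero.1 h4).resolve_left hV)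
  have hC := collar_nonneg hlam r (Real.log ‖p.1‖)
  have pos_of : 0 < ((fibre p).im + deriv (collar lam r) (Real.log ‖p.1‖) / 2) ^ 2 +
      collar lam r (Real.log ‖p.1‖) * (1 + (fibre p).re) ^ 2 +
      ((1 + (fibre p).re) ^ 2 + (fibre p).im ^ 2) *
        ((fibre p).re ^ 2 + deriv (deriv (collar lam r)) (Real.log ‖p.1‖) / 4) →
      0 < leviForm (wormFunction lam r) p (p.1 * η, T * phase p.1) := by
    intro hpos
    have h1 := mul_pos hη hpos
    have h2 : 0 < ((1 + (fibre p).re) ^ 2 + (fibre p).im ^ 2) *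
      (4 * leviForm (wormFunction lam r) p (p.1 * η, T * phase p.1)) := by
      rw [key]; linarith
    have := pos_of_mul_pos_right h2 hVpos.le
    linarith
  by_cases hin : 1 ≤ ‖p.1‖ ∧ ‖p.1‖ ≤ r
  · by_cases hw0 : p.2 = 0
    · exact Or.inr ⟨hin.1, hin.2, hw0⟩
    left
    apply pos_of
    have hl := log_norm_inside hin
    rw [collar_eq_zero hlam hr hl.1 hl.2, deriv_collar_eq_zero hlam hr hl.1 hl.2,
      deriv_deriv_collar_eq_zero hlam hr hl.1 hl.2]
    rw [collar_eq_zero hlam hr hl.1 hl.2] at hw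
    have hV1 : (1 + (fibre p).re) ^ 2 + (fibre p).im ^ 2 = 1 := by linarith
    rw [hV1]
    have hW : fibre p ≠ 0 := by
      refine mul_ne_zero hw0 ?_
      rw [← norm_ne_zero_iff, RCLike.norm_conj, norm_phase]
      exact one_ne_zero
    have := Complex.normSq_pos.2 hW
    rw [Complex.normSq_apply] at this
    linarith
  · left
    apply pos_of
    have := (collar_of_outside hlam hr (log_norm_outside hr hp hin)).2.2
    positivity

/-- The cut-off terms vanish to second order and W = 0. The mixed η–T term that survives is the
winding of the worm, and it is what obstructs large exponents. -/
theorem annulus_data (hlam : IsWormProfile lam) (hr : 1 < r) {z : ℂ} (h : 1 ≤ ‖z‖ ∧ ‖z‖ ≤ r) :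
    (z, (0 : ℂ)) ∈ frontier (wormDomain lam r) ∧ ∀ η T : ℂ,
      4 * leviForm (wormFunction lam r) (z, 0) (z * η, T * phase z) =
        4 * (T.re ^ 2 + T.im ^ 2) + 8 * (η.re * T.im - η.im * T.re) ∧
      fderiv ℝ (wormFunction lam r) (z, 0) (z * η, T * phase z) = 2 * T.re ∧
      fderiv ℝ (wormFunction lam r) (z, 0) (Complex.I • (z * η, T * phase z)) = -2 * T.im := by
  have hz : (z, (0 : ℂ)).1 ≠ 0 := fst_ne_zero_of_one_le (p := (z, 0)) h.1
  have hl := log_norm_inside (p := (z, 0)) h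
  have hf : fibre (z, 0) = 0 := by simp [fibre]
  refine ⟨?_, fun η T => ?_⟩
  · rw [mem_frontier_wormDomain_iff hlam hr, wormFunction_eq hz, collar_eq_zero hlam hr hl.1 hl.2]
    exact ⟨hz, by simp [hf]⟩
  · have := wormFunction_data (r := r) hlam hz η T
    rw [deriv_collar_eq_zero hlam hr hl.1 hl.2, deriv_deriv_collar_eq_zero hlam hr hl.1 hl.2,
      hf] at this
    obtain ⟨h1, h2, h3⟩ := this
    exact ⟨h1.trans (by simp), h2.trans (by simp), h3.trans (by simp)⟩

theorem leviForm_wormFunction_nonneg (hlam : IsWormProfile lam) (hr : 1 < r) (hp : p.1 ≠ 0)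
    (h0 : wormFunction lam r p = 0) {t : ℂ × ℂ}
    (htan : IsComplexTangent (wormFunction lam r) p t) :
    0 ≤ leviForm (wormFunction lam r) p t := by
  by_cases ht : t = 0
  · rw [leviForm_eq (contDiffAt_two_wormFunction hlam hp), ht]
    simp
  rcases leviForm_wormFunction_pos_or hlam hr hp h0 ht htan with h | ⟨h1, h2, h3⟩
  · exact h.le
  obtain ⟨z, w⟩ := p
  obtain rfl : w = 0 := h3
  rw [isComplexTangent_iff ((contDiffAt_two_wormFunction hlam hp).differentiableAt (by simp))]
    at htan
  obtain ⟨η, T, rfl⟩ : ∃ η T, t = (z * η, T * phase z) := ⟨_, _, eq_discTangent hp t⟩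
  obtain ⟨d1, d2, d3⟩ := (annulus_data hlam hr ⟨h1, h2⟩).2 η T
  have e1 : T.re = 0 := by linarith [htan.1]
  have e2 : T.im = 0 := by linarith [htan.2]
  rw [e1, e2] at d1
  linarith

theorem isPseudoconvexAt_wormDomain (hlam : IsWormProfile lam) (hr : 1 < r)
    (hp : p ∈ frontier (wormDomain lam r)) : IsPseudoconvexAt (wormDomain lam r) p := by
  intro ρ hρ t ht
  obtain ⟨hz, h0⟩ := (mem_frontier_wormDomain_iff hlam hr).1 hp
  obtain ⟨c, hc, -, h⟩ := ((isDefiningFunction_wormFunction hlam hr).of_le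
    (m := 2) (by norm_cast)).exists_leviForm_eq_mul hρ hp
  have ht' := (h t).1.1 ht
  rw [(h t).2 ht']
  exact mul_nonneg hc.le (leviForm_wormFunction_nonneg hlam hr hz h0 ht')

theorem isPseudoconvex_wormDomain (hlam : IsWormProfile lam) (hr : 1 < r) :
    IsPseudoconvex (wormDomain lam r) :=
  ⟨⟨_, (isDefiningFunction_wormFunction hlam hr).of_le (by norm_cast)⟩,
    fun _ hp => isPseudoconvexAt_wormDomain hlam hr hp⟩

/-- Off the exceptional annulus, every defining function has positive definite Levi form. -/
theorem leviForm_pos_of_not_mem_annulus (hlam : IsWormProfile lam) (hr : 1 < r)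
    (hp : p ∈ frontier (wormDomain lam r)) (hM : ¬ (1 ≤ ‖p.1‖ ∧ ‖p.1‖ ≤ r ∧ p.2 = 0)) :
    IsStrictlyPseudoconvexAt (wormDomain lam r) p := by
  intro ρ hρ t ht0 ht
  obtain ⟨hz, h0⟩ := (mem_frontier_wormDomain_iff hlam hr).1 hp
  obtain ⟨c, hc, -, h⟩ := ((isDefiningFunction_wormFunction hlam hr).of_le
    (m := 2) (by norm_cast)).exists_leviForm_eq_mul hρ hp
  have ht' := (h t).1.1 ht
  rw [(h t).2 ht']
  exact mul_pos hc ((leviForm_wormFunction_pos_or hlam hr hz h0 ht0 ht').resolve_right hM)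

theorem weaklyPseudoconvexPoints_wormDomain (hlam : IsWormProfile lam) (hr : 1 < r) :
    weaklyPseudoconvexPoints (wormDomain lam r) =
      {p : ℂ × ℂ | 1 ≤ ‖p.1‖ ∧ ‖p.1‖ ≤ r ∧ p.2 = 0} := by
  ext p
  constructor
  · rintro ⟨hp, -, hns⟩
    by_contra hM
    exact hns (leviForm_pos_of_not_mem_annulus hlam hr hp hM)
  · rintro ⟨h1, h2, h3⟩
    obtain ⟨z, w⟩ := p
    obtain rfl : w = 0 := h3
    obtain ⟨hfr, hd⟩ := annulus_data hlam hr ⟨h1, h2⟩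
    have hz : (z, (0 : ℂ)).1 ≠ 0 := fst_ne_zero_of_one_le (p := (z, 0)) h1
    refine ⟨hfr, isPseudoconvexAt_wormDomain hlam hr hfr, fun hs => ?_⟩
    obtain ⟨d1, d2, d3⟩ := hd 1 0
    have := hs _ ((isDefiningFunction_wormFunction hlam hr).of_le (by norm_cast))
      (z * 1, 0 * phase z) (by simpa using hz) ((isComplexTangent_iff
        ((contDiffAt_two_wormFunction hlam hz).differentiableAt (by simp))).2
        ⟨by rw [d2]; simp, by rw [d3]; simp⟩)
    simp only [Complex.zero_re, Complex.zero_im] at d1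
    linarith

end Domain

/-! ### From the boundary to a global exponent: truncation and the Hessian condition. -/

section Convex

/-- A smooth convex nondecreasing function that is the identity near `0` and constant far to the
left. -/
theorem exists_smooth_convex_truncation {a : ℝ} (ha : 0 < a) : ∃ χ : ℝ → ℝ, ContDiff ℝ ∞ χ ∧
    (∀ x, -a ≤ x → χ x = x) ∧ (∀ x, x < 0 → χ x < 0) ∧ (∀ x, 0 ≤ deriv χ x) ∧
    (∀ x, 0 ≤ deriv (deriv χ) x) ∧ ∀ x, x < -2 * a → deriv χ x = 0 ∧ deriv (deriv χ) x = 0 := by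
  -- S is 0 left of -2a and 1 right of -a. Its primitive vanishing at 0 is χ, so monotonicity of S
  -- gives convexity.
  set S : ℝ → ℝ := fun x => Real.smoothTransition ((x + 2 * a) / a) with hS
  have hSc : ContDiff ℝ ∞ S :=
    Real.smoothTransition.contDiff.comp ((contDiff_id.add contDiff_const).div_const a)
  have hSm : Monotone S := fun x y hxy =>
    Real.smoothTransition.monotone (div_le_div_of_nonneg_right (by linarith) ha.le)
  set χ : ℝ → ℝ := fun x => ∫ t in (0 : ℝ)..x, S t with hχ
  have hd : ∀ x, HasDerivAt χ (S x) x := fun x =>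
    intervalIntegral.integral_hasDerivAt_right (hSc.continuous.intervalIntegrable _ _)
      (hSc.continuous.stronglyMeasurableAtFilter _ _) hSc.continuous.continuousAt
  have hd' : deriv χ = S := funext fun x => (hd x).deriv
  have hmono : Monotone χ := monotone_of_deriv_nonneg (fun x => (hd x).differentiableAt)
    fun x => by rw [hd']; exact Real.smoothTransition.nonneg _
  have hid : ∀ x, -a ≤ x → χ x = x := by
    intro x hx
    have : ∫ t in (0 : ℝ)..x, S t = ∫ t in (0 : ℝ)..x, (1 : ℝ) := by
      refine intervalIntegral.integral_congr fun t ht => ?_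
      have hta : -a ≤ t := by
        rw [Set.uIcc, Set.mem_Icc] at ht
        exact le_trans (le_min (by linarith) hx) ht.1
      exact Real.smoothTransition.one_of_one_le (by rw [le_div_iff₀ ha]; linarith)
    rw [hχ]
    simp only [this]
    simp
  refine ⟨χ, contDiff_infty_iff_deriv.2 ⟨fun x => (hd x).differentiableAt, hd' ▸ hSc⟩, hid, ?_,
    ?_, ?_, ?_⟩
  · intro x hx
    rcases le_total (-a) x with h | h
    · rwa [hid x h]
    · have := hmono h
      rw [hid _ le_rfl] at this
      linarith
  · intro x
    rw [hd']
    exact Real.smoothTransition.nonneg _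
  · intro x
    rw [hd']
    exact hSm.deriv_nonneg
  · intro x hx
    have hz : ∀ y, y < -2 * a → S y = 0 := fun y hy =>
      Real.smoothTransition.zero_of_nonpos (div_nonpos_of_nonpos_of_nonneg (by linarith) ha.le)
    rw [hd']
    refine ⟨hz x hx, ?_⟩
    have : S =ᶠ[𝓝 x] fun _ => 0 := (gt_mem_nhds hx).mono hz
    rw [this.deriv_eq]
    simp

end Convex

/-- The form whose nonnegativity expresses that the complex Hessian of `-(-f)^τ` is nonnegative. -/
def HessianCondition (f : ℂ × ℂ → ℝ) (τ : ℝ) (p : ℂ × ℂ) : Prop :=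
  ∀ t : ℂ × ℂ, 0 ≤ -f p * (4 * leviForm f p t) +
    (1 - τ) * (fderiv ℝ f p t ^ 2 + fderiv ℝ f p (Complex.I • t) ^ 2)

section General

variable {f g : ℂ × ℂ → ℝ} {p q t : ℂ × ℂ} {τ : ℝ} {Ω : Set (ℂ × ℂ)}

theorem leviForm_congr (hf : ContDiffAt ℝ 2 f p) (h : g =ᶠ[𝓝 p] f) :
    leviForm g p t = leviForm f p t := by
  rw [leviForm_eq hf, leviForm_eq (hf.congr_of_eventuallyEq h), h.fderiv.fderiv_eq]

theorem continuousAt_leviForm (hf : ContDiffAt ℝ 2 f p) :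
    ContinuousAt (fun z : (ℂ × ℂ) × (ℂ × ℂ) => fderiv ℝ (fderiv ℝ f) z.1 z.2 z.2 +
      fderiv ℝ (fderiv ℝ f) z.1 (Complex.I • z.2) (Complex.I • z.2)) (p, t) := by
  have h1 : ContDiffAt ℝ 1 (fderiv ℝ f) p := hf.fderiv_right (by norm_num)
  have h2 : ContDiffAt ℝ 0 (fderiv ℝ (fderiv ℝ f)) p := h1.fderiv_right (by norm_num)
  have h3 : ContinuousAt (fun z : (ℂ × ℂ) × (ℂ × ℂ) => fderiv ℝ (fderiv ℝ f) z.1) (p, t) :=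
    ContinuousAt.comp (f := Prod.fst) (x := (p, t)) h2.continuousAt continuousAt_fst
  have h4 : ContinuousAt (fun z : (ℂ × ℂ) × (ℂ × ℂ) => z.2) (p, t) := continuousAt_snd
  exact ((h3.clm_apply h4).clm_apply h4).add
    ((h3.clm_apply (h4.const_smul Complex.I)).clm_apply (h4.const_smul Complex.I))

theorem continuousAt_fderiv_apply (hf : ContDiffAt ℝ 1 f p) (c : ℂ) :
    ContinuousAt (fun z : (ℂ × ℂ) × (ℂ × ℂ) => fderiv ℝ f z.1 (c • z.2)) (p, t) := by
  have h2 : ContDiffAt ℝ 0 (fderiv ℝ f) p := hf.fderiv_right (by norm_num)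
  have h3 : ContinuousAt (fun z : (ℂ × ℂ) × (ℂ × ℂ) => fderiv ℝ f z.1) (p, t) :=
    ContinuousAt.comp (f := Prod.fst) (x := (p, t)) h2.continuousAt continuousAt_fst
  exact h3.clm_apply (continuousAt_snd.const_smul c)

/-- Near a strictly pseudoconvex boundary point the Hessian condition is automatic. -/
theorem eventually_hessianCondition (hτ : τ < 1) (hf : ContDiffAt ℝ 2 f q) (h0 : f q = 0)
    (hpos : ∀ t, t ≠ 0 → IsComplexTangent f q t → 0 < leviForm f q t) :
    ∀ᶠ p in 𝓝 q, f p < 0 → HessianCondition f τ p := by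
  have hdiff := hf.differentiableAt (by simp)
  have hf1 : ContDiffAt ℝ 1 f q := hf.of_le (by norm_num)
  -- By compactness it suffices to work near one unit vector t. If t is tangential, the Levi term is
  -- positive nearby; otherwise the first-order term is, while f(q) = 0 makes the Levi term small.
  -- Quadratic homogeneity then reaches all t.
  have hsphere : ∀ᶠ p in 𝓝 q, ∀ t ∈ Metric.sphere (0 : ℂ × ℂ) 1, f p < 0 →
      0 ≤ -f p * (fderiv ℝ (fderiv ℝ f) p t t +
        fderiv ℝ (fderiv ℝ f) p (Complex.I • t) (Complex.I • t)) +
      (1 - τ) * (fderiv ℝ f p ((1 : ℂ) • t) ^ 2 + fderiv ℝ f p (Complex.I • t) ^ 2) := by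
    refine (isCompact_sphere _ _).eventually_forall_of_forall_eventually fun t ht => ?_
    have ht0 : t ≠ 0 := by
      rintro rfl
      simp at ht
    have c1 := continuousAt_leviForm (t := t) hf
    have c2 := continuousAt_fderiv_apply (t := t) hf1 1
    have c3 := continuousAt_fderiv_apply (t := t) hf1 Complex.I
    have c4 : ContinuousAt (fun z : (ℂ × ℂ) × (ℂ × ℂ) => f z.1) (q, t) :=
      ContinuousAt.comp (f := Prod.fst) (x := (q, t)) hf.continuousAt continuousAt_fst
    by_cases htan : IsComplexTangent f q t
    · have hl := hpos t ht0 htan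
      rw [leviForm_eq hf] at hl
      filter_upwards [c1.eventually (lt_mem_nhds (show (0 : ℝ) < _ by simpa using hl))]
        with z hz hneg
      have h1 : 0 ≤ 1 - τ := by linarith
      have h2 : 0 ≤ -f z.1 := by linarith
      positivity
    · have h2 : 0 < (1 - τ) * (fderiv ℝ f q ((1 : ℂ) • t) ^ 2 +
          fderiv ℝ f q (Complex.I • t) ^ 2) := by
        refine mul_pos (by linarith) ?_
        rw [isComplexTangent_iff hdiff] at htan
        rw [one_smul]
        by_contra! hle
        have s1 := sq_nonneg (fderiv ℝ f q t)
        have s2 := sq_nonneg (fderiv ℝ f q (Complex.I • t))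
        exact htan ⟨pow_eq_zero_iff two_ne_zero |>.1 (by linarith),
          pow_eq_zero_iff two_ne_zero |>.1 (by linarith)⟩
      have c5 := (c4.neg.mul c1).add ((c2.pow 2).add (c3.pow 2) |>.const_mul (1 - τ))
      have h3 := c5.eventually (lt_mem_nhds (show (0 : ℝ) < _ by simpa [h0] using h2))
      filter_upwards [h3] with z hz _
      exact hz.le
  filter_upwards [hsphere, hf.eventually (by simp)] with p hp hfp hneg t
  rw [leviForm_eq hfp]
  by_cases ht : t = 0
  · simp [ht]
  have hn : ‖t‖ ≠ 0 := norm_ne_zero_iff.2 ht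
  have h1 := hp ((‖t‖)⁻¹ • t) (by simp [norm_smul, hn]) hneg
  rw [one_smul, smul_comm Complex.I] at h1
  simp only [map_smul, smul_apply, smul_eq_mul] at h1
  have h2 : 0 < (‖t‖⁻¹) ^ 2 := by positivity
  refine nonneg_of_mul_nonneg_right (a := (‖t‖⁻¹) ^ 2) ?_ h2
  refine le_of_le_of_eq h1 ?_
  ring

/-- The Hessian condition near the boundary yields a Diederich–Fornæss exponent. -/
theorem isDFExponent_of_eventually (hΩ : IsOpen Ω) (hcpt : IsCompact (closure Ω)) (hτ0 : 0 < τ)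
    (hτ1 : τ < 1) (hf : IsDefiningFunction ∞ Ω f)
    (h : ∀ q ∈ frontier Ω, ∀ᶠ p in 𝓝 q, p ∈ Ω → HessianCondition f τ p) :
    IsDFExponent Ω τ := by
  -- The points of the closure near which the condition may fail form a compact subset of Ω, on
  -- which f has a negative maximum.
  obtain ⟨ε, hε, hgood⟩ : ∃ ε : ℝ, 0 < ε ∧ ∀ p ∈ Ω, -ε < f p → HessianCondition f τ p := by
    set N := {q | ∀ᶠ p in 𝓝 q, p ∈ Ω → HessianCondition f τ p} with hN
    have hNo : IsOpen N := isOpen_setOfPred_eventually_nhds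
    have hK : IsCompact (closure Ω \ N) := hcpt.diff hNo
    have hKΩ : closure Ω \ N ⊆ Ω := by
      intro q hq
      by_contra hqΩ
      exact hq.2 (h q (by rw [hΩ.frontier_eq]; exact ⟨hq.1, hqΩ⟩))
    have hneg : ∀ q ∈ Ω, f q < 0 := by
      obtain ⟨U, -, -, -, hU, -⟩ := hf
      intro q hq
      rw [hU] at hq
      exact hq.2
    rcases (closure Ω \ N).eq_empty_or_nonempty with he | hne
    · refine ⟨1, one_pos, fun p hp _ => ?_⟩
      have : p ∈ N := by
        by_contra hpN
        exact (he ▸ (⟨subset_closure hp, hpN⟩ : p ∈ closure Ω \ N) : p ∈ (∅ : Set _))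
      exact this.self_of_nhds hp
    · obtain ⟨q, hq, hmax⟩ := hK.exists_isMaxOn hne (f := f) fun x hx =>
        (hf.contDiffAt hx.1).continuousAt.continuousWithinAt
      refine ⟨-f q, by linarith [hneg q (hKΩ hq)], fun p hp hlt => ?_⟩
      have : p ∈ N := by
        by_contra hpN
        have := hmax (show p ∈ closure Ω \ N from ⟨subset_closure hp, hpN⟩)
        simp only [Set.mem_ofPred_eq] at this
        linarith
      exact this.self_of_nhds hp
  have hετ : 0 < ε ^ τ := Real.rpow_pos_of_pos hε τ
  -- The third makes f ≤ -ε imply u ≤ -3a < -2a, where χ is locally constant.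
  set a := ε ^ τ / 3 with ha
  have ha0 : 0 < a := by positivity
  obtain ⟨χ, hχc, hχid, hχneg, hχ1, hχ2, hχ0⟩ := exists_smooth_convex_truncation ha0
  have hχ2' : ContDiff ℝ 2 χ := hχc.of_le (by norm_cast)
  set u : ℂ × ℂ → ℝ := fun p => -((-f p) ^ τ) with hu
  have huneg : ∀ p, f p < 0 → u p < 0 := fun p hp =>
    neg_neg_of_pos (Real.rpow_pos_of_pos (by linarith) τ)
  -- Defined so that -(-ρ)^τ = χ(u) inside. Near the boundary χ is the identity and ρ agrees with f,
  -- so smoothness across the boundary and dρ ≠ 0 are inherited.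
  set ρ : ℂ × ℂ → ℝ := fun p => if f p < 0 then -((-χ (u p)) ^ τ⁻¹) else f p with hρ
  have hρneg : ∀ p, ρ p < 0 ↔ f p < 0 := by
    intro p
    by_cases hp : f p < 0
    · simp only [hρ, hp, if_true, iff_true]
      exact neg_neg_of_pos (Real.rpow_pos_of_pos (by linarith [hχneg _ (huneg p hp)]) _)
    · simp [hρ, hp]
  have hρf : ∀ p, -a ^ τ⁻¹ < f p → ρ p = f p := by
    intro p hp
    by_cases hp0 : f p < 0
    · have h1 : -a ≤ u p := by
        have : (-f p) ^ τ ≤ (a ^ τ⁻¹) ^ τ :=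
          Real.rpow_le_rpow (by linarith) (by linarith) hτ0.le
        rw [Real.rpow_inv_rpow ha0.le hτ0.ne'] at this
        simp only [hu]
        linarith
      simp only [hρ, hp0, if_true, hχid _ h1]
      simp only [hu, neg_neg]
      rw [Real.rpow_rpow_inv (by linarith) hτ0.ne', neg_neg]
    · simp [hρ, hp0]
  have hpsh : ∀ p, f p < 0 → -((-ρ p) ^ τ) = χ (u p) := by
    intro p hp
    simp only [hρ, hp, if_true, neg_neg]
    rw [Real.rpow_inv_rpow (by linarith [hχneg _ (huneg p hp)]) hτ0.ne', neg_neg]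
  obtain ⟨U, hU, hcl, hC, hΩU, hd⟩ := hf
  have hf' : IsDefiningFunction ∞ Ω f := ⟨U, hU, hcl, hC, hΩU, hd⟩
  have haτ : 0 < a ^ τ⁻¹ := Real.rpow_pos_of_pos ha0 _
  have hCat : ∀ p ∈ U, ContDiffAt ℝ ∞ f p := fun p hp => hC.contDiffAt (hU.mem_nhds hp)
  have huC : ∀ p ∈ U, f p < 0 → ContDiffAt ℝ ∞ u p := fun p hp hneg =>
    (contDiffAt_neg_rpow hneg τ).comp p (hCat p hp)
  have hev : ∀ p ∈ U, -a ^ τ⁻¹ < f p → ρ =ᶠ[𝓝 p] f := fun p hp hlt =>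
    ((hCat p hp).continuousAt.eventually (lt_mem_nhds hlt)).mono hρf
  have hev' : ∀ p ∈ U, f p < 0 → ∀ᶠ q in 𝓝 p, f q < 0 := fun p hp hlt =>
    (hCat p hp).continuousAt.eventually (gt_mem_nhds hlt)
  refine ⟨hτ0, hτ1, ρ, ⟨U, hU, hcl, ?_, ?_, ?_⟩, ?_⟩
  · intro p hp
    refine ContDiffAt.contDiffWithinAt ?_
    rcases lt_or_ge (-a ^ τ⁻¹) (f p) with hlt | hle
    · exact (hCat p hp).congr_of_eventuallyEq (hev p hp hlt)
    · have hneg : f p < 0 := by linarith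
      have h1 : ContDiffAt ℝ ∞ (fun p => -((-χ (u p)) ^ τ⁻¹)) p :=
        (((hχc.contDiffAt.comp p (huC p hp hneg)).neg).rpow_const_of_ne
          (by simp only [Function.comp_apply]; linarith [hχneg _ (huneg p hneg)])).neg
      refine h1.congr_of_eventuallyEq ((hev' p hp hneg).mono fun q hq => ?_)
      simp [hρ, hq]
  · simp only [hρneg]
    exact hΩU
  · intro p hp
    have hp0 := hf'.eq_zero hp
    rw [(hev p (hcl (frontier_subset_closure hp)) (by rw [hp0]; linarith)).fderiv_eq]
    exact hd p hp
  · have hpt : ∀ p ∈ Ω, p ∈ U ∧ f p < 0 := fun p hp => by rwa [hΩU] at hp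
    have hcomp : ∀ p ∈ Ω, ContDiffAt ℝ 2 (fun p => χ (u p)) p := fun p hp =>
      hχ2'.contDiffAt.comp p ((huC p (hpt p hp).1 (hpt p hp).2).of_le (by norm_cast))
    have heq : ∀ p ∈ Ω, (fun p => -((-ρ p) ^ τ)) =ᶠ[𝓝 p] fun p => χ (u p) := fun p hp =>
      (hev' p (hpt p hp).1 (hpt p hp).2).mono hpsh
    refine ⟨fun p hp => ((hcomp p hp).congr_of_eventuallyEq (heq p hp)).contDiffWithinAt, ?_⟩
    intro p hp t
    rw [leviForm_congr (hcomp p hp) (heq p hp)]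
    obtain ⟨hpU, hneg⟩ := hpt p hp
    have h4 := leviForm_comp (t := t) ((huC p hpU hneg).of_le (by norm_cast)) hχ2'.contDiffAt
      (HasTwoJetAt.of_contDiffAt hχ2'.contDiffAt)
    suffices 0 ≤ 4 * leviForm (fun p => χ (u p)) p t by linarith
    rw [h4]
    rcases lt_or_ge (-ε) (f p) with hlt | hle
    · have h5 := leviForm_neg_rpow (t := t) ((hCat p hpU).of_le (by norm_cast)) hneg τ
      have h6 : 0 ≤ 4 * leviForm u p t := by
        rw [h5]
        exact mul_nonneg (mul_nonneg hτ0.le (Real.rpow_nonneg (by linarith) _))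
          (hgood p hp hlt t)
      have h7 := hχ1 (u p)
      have h8 := hχ2 (u p)
      positivity
    · have h5 : u p < -2 * a := by
        have : ε ^ τ ≤ (-f p) ^ τ := Real.rpow_le_rpow hε.le (by linarith) hτ0.le
        simp only [hu, ha]
        linarith
      rw [(hχ0 _ h5).1, (hχ0 _ h5).2]
      simp

end General

/-! ### The weight and its Riccati inequality. -/

section Weight

theorem hasTwoJetAt_rpow {y : ℝ} (hy : 0 < y) (q : ℝ) :
    HasTwoJetAt (fun y : ℝ => y ^ q) (q * y ^ (q - 1)) (q * (q - 1) * y ^ (q - 2)) y := by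
  refine HasTwoJetAt.of_hasDerivAt (g' := fun x => q * x ^ (q - 1))
    ((lt_mem_nhds hy).mono fun x hx => Real.hasDerivAt_rpow_const (Or.inl hx.ne')) ?_
  refine ((Real.hasDerivAt_rpow_const (p := q - 1) (Or.inl hy.ne')).const_mul q).congr_deriv ?_
  ring_nf

theorem hasTwoJetAt_cos (ν c x : ℝ) :
    HasTwoJetAt (fun x => Real.cos (-(ν * c) + ν * x)) (-(ν * Real.sin (-(ν * c) + ν * x)))
      (-(ν ^ 2 * Real.cos (-(ν * c) + ν * x))) x := by
  have hcos := HasTwoJetAt.of_hasDerivAt (g' := fun x => -Real.sin x)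
    (Eventually.of_forall Real.hasDerivAt_cos) (Real.hasDerivAt_sin (-(ν * c) + ν * x)).neg
  exact (HasTwoJetAt.comp (g := fun x => -(ν * c) + ν * x) hcos
    (HasTwoJetAt.affine _ ν x)).congr_jet (by ring) (by ring)

/-- A positive weight whose logarithm solves a strict Riccati inequality on `[0, l]`. -/
theorem exists_weight {τ k l : ℝ} (hτ0 : 0 < τ) (hτ1 : τ < 1) (hk : τ / (1 - τ) < k)
    (hl : 0 < l) (hkl : 2 * k * l < Real.pi) :
    ∃ m : ℝ → ℝ, ContDiff ℝ ∞ m ∧ (∀ x, 0 < m x) ∧ ∀ x, 0 ≤ x → x ≤ l →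
      (τ * (deriv m x / m x) / 2) ^ 2 + 1 <
        (1 - τ) * (1 - (deriv (deriv m) x / m x - (1 - τ) * (deriv m x / m x) ^ 2) / 4) := by
  have hτ : 0 < 1 - τ := by linarith
  have hk0 : 0 < k := lt_trans (div_pos hτ0 hτ) hk
  -- With m = s^q and q = (1-τ)/τ the inequality becomes ((1-τ)²/(4τ)) s''/s + τ < 0. Here s'' =
  -- -4k²s, and k > τ/(1-τ) is exactly what is needed.
  set s : ℝ → ℝ := fun x => Real.cos (-(2 * k * (l / 2)) + 2 * k * x) with hs
  set q := (1 - τ) / τ with hq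
  set R := Real.pi / (4 * k) with hR
  have hlR : l / 2 < R := by
    rw [hR, lt_div_iff₀ (by positivity)]
    linarith
  have hspos : ∀ x, |x - l / 2| < R → 0 < s x := by
    intro x hx
    refine Real.cos_pos_of_mem_Ioo ?_
    have h1 : 2 * k * R = Real.pi / 2 := by rw [hR]; field_simp; ring
    rw [abs_lt] at hx
    constructor
    · nlinarith
    · nlinarith
  -- Both radii lie strictly between l/2 and R. Hence m = s^q near [0, l], and the bump has died out
  -- before the cosine reaches its first zero.
  let f : ContDiffBump (l / 2) := ⟨(2 * (l / 2) + R) / 3, ((l / 2) + 2 * R) / 3, by linarith,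
    by linarith⟩
  have hsC : ContDiff ℝ ∞ s := Real.contDiff_cos.comp
    (contDiff_const.add (contDiff_const.mul contDiff_id))
  set m : ℝ → ℝ := fun x => f x * s x ^ q + (1 - f x) with hm
  have hfin : ∀ x, |x - l / 2| < R ∨ f =ᶠ[𝓝 x] 0 := by
    intro x
    by_cases hx : |x - l / 2| < R
    · exact Or.inl hx
    · right
      refine notMem_tsupport_iff_eventuallyEq.1 ?_
      rw [f.tsupport_eq, Metric.mem_closedBall, Real.dist_eq, not_le]
      change ((l / 2) + 2 * R) / 3 < _
      linarith
  have hfC : ContDiff ℝ ∞ f := f.contDiff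
  have hmC : ContDiff ℝ ∞ m := by
    rw [contDiff_iff_contDiffAt]
    intro x
    rcases hfin x with hx | hx
    · exact (hfC.contDiffAt.mul (hsC.contDiffAt.rpow_const_of_ne (hspos x hx).ne')).add
        (contDiffAt_const.sub hfC.contDiffAt)
    · refine (contDiffAt_const (c := (1 : ℝ))).congr_of_eventuallyEq (hx.mono fun y hy => ?_)
      simp [hm, hy]
  have hmpos : ∀ x, 0 < m x := by
    intro x
    rcases hfin x with hx | hx
    · have h1 : 0 < s x ^ q := Real.rpow_pos_of_pos (hspos x hx) q
      have h2 := f.nonneg (x := x)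
      have h3 := f.le_one (x := x)
      simp only [hm]
      rcases h3.lt_or_eq with h3 | h3
      · nlinarith [mul_nonneg h2 h1.le]
      · rw [h3]; linarith
    · simp [hm, hx.self_of_nhds]
  refine ⟨m, hmC, hmpos, fun x hx0 hxl => ?_⟩
  have hxR : |x - l / 2| < (2 * (l / 2) + R) / 3 := by
    rw [abs_lt]
    constructor <;> linarith
  have hms : m =ᶠ[𝓝 x] fun x => s x ^ q := by
    have := f.eventuallyEq_one_of_mem_ball (x := x) (by rwa [Metric.mem_ball, Real.dist_eq])
    filter_upwards [this] with y hy
    simp [hm, hy]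
  have hsx := hspos x (by linarith)
  have hj := (HasTwoJetAt.comp (g := s) (hasTwoJetAt_rpow hsx q)
    (hasTwoJetAt_cos (2 * k) (l / 2) x)).congr_of_eventuallyEq hms
  have hmx : m x = s x ^ q := hms.self_of_nhds
  rw [hj.hasDerivAt.deriv, hj.hasDerivAt_deriv.deriv, hmx]
  have e1 : s x ^ (q - 1) = s x ^ q / s x := Real.rpow_sub_one hsx.ne' q
  have e2 : s x ^ (q - 2) = s x ^ q / s x ^ 2 := by
    rw [Real.rpow_sub hsx, Real.rpow_two]
  rw [e1, e2]
  have hP : 0 < s x ^ q := Real.rpow_pos_of_pos hsx q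
  change _ < (1 - τ) * (1 - ((_ + q * (s x ^ q / s x) * -((2 * k) ^ 2 * s x)) / _ - _) / 4)
  generalize Real.sin (-(2 * k * (l / 2)) + 2 * k * x) = σ
  generalize s x ^ q = P at *
  generalize s x = S at *
  -- The sin² terms cancel because τq² = (1-τ)q, so the slack is constant in x.
  have key : (1 - τ) * (1 - ((q * (q - 1) * (P / S ^ 2) * (-(2 * k * σ)) ^ 2 +
      q * (P / S) * -((2 * k) ^ 2 * S)) / P - (1 - τ) * (q * (P / S) * -(2 * k * σ) / P) ^ 2) / 4) -
      ((τ * (q * (P / S) * -(2 * k * σ) / P) / 2) ^ 2 + 1) = ((1 - τ) ^ 2 * k ^ 2 - τ ^ 2) / τ := by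
    rw [hq]
    field_simp
    ring
  have : 0 < ((1 - τ) ^ 2 * k ^ 2 - τ ^ 2) / τ := by
    refine div_pos ?_ hτ0
    rw [div_lt_iff₀ hτ] at hk
    nlinarith
  linarith

end Weight

/-! ### Every τ below the critical value is an exponent. -/

section LowerBound

variable {lam : ℝ → ℝ} {r τ : ℝ}

theorem continuousAt_fibre {p : ℂ × ℂ} (hp : p.1 ≠ 0) : ContinuousAt fibre p :=
  continuousAt_snd.mul (Complex.continuous_conj.continuousAt.comp
    (contDiffAt_phase (n := 0) hp).continuousAt)

/-- The discriminant of the Hermitian form describing the complex Hessian of the weighted worm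
function. -/
noncomputable def discriminant (lam : ℝ → ℝ) (r : ℝ) (m : ℝ → ℝ) (τ : ℝ) (p : ℂ × ℂ) : ℝ :=
  (1 - τ) * ((1 + (fibre p).re) ^ 2 + (fibre p).im ^ 2) * ((1 + (fibre p).re) ^ 2 -
      ((1 + (fibre p).re) ^ 2 + (fibre p).im ^ 2) *
        (deriv (deriv m) (Real.log ‖p.1‖) / m (Real.log ‖p.1‖) -
          (1 - τ) * (deriv m (Real.log ‖p.1‖) / m (Real.log ‖p.1‖)) ^ 2) / 4) -
    (((fibre p).im - (2 * (fibre p).im + deriv (collar lam r) (Real.log ‖p.1‖) / 2) +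
      τ * (deriv m (Real.log ‖p.1‖) / m (Real.log ‖p.1‖)) *
        ((1 + (fibre p).re) ^ 2 + (fibre p).im ^ 2) / 2) ^ 2 + (1 + (fibre p).re) ^ 2)

theorem continuousAt_discriminant (hlam : IsWormProfile lam) {m : ℝ → ℝ} (hm : ContDiff ℝ ∞ m)
    (hpos : ∀ x, 0 < m x) {p : ℂ × ℂ} (hp : p.1 ≠ 0) :
    ContinuousAt (discriminant lam r m τ) p := by
  have hx : ContinuousAt (fun q : ℂ × ℂ => Real.log ‖q.1‖) p :=
    (contDiffAt_log_norm (n := 0) hp).continuousAt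
  have h1 : ContinuousAt (fun q => (fibre q).re) p :=
    Complex.continuous_re.continuousAt.comp (continuousAt_fibre hp)
  have h2 : ContinuousAt (fun q => (fibre q).im) p :=
    Complex.continuous_im.continuousAt.comp (continuousAt_fibre hp)
  have h3 : ContinuousAt (fun q : ℂ × ℂ => deriv (collar lam r) (Real.log ‖q.1‖)) p :=
    ContinuousAt.comp (g := deriv (collar lam r))
      ((contDiff_infty_iff_deriv.1 (contDiff_collar hlam r)).2.continuous.continuousAt) hx
  have hm1 := (contDiff_infty_iff_deriv.1 hm).2
  have h4 : ContinuousAt (fun q : ℂ × ℂ => deriv m (Real.log ‖q.1‖) / m (Real.log ‖q.1‖)) p :=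
    (ContinuousAt.comp (g := deriv m) hm1.continuous.continuousAt hx).div
      (ContinuousAt.comp (g := m) hm.continuous.continuousAt hx) (hpos _).ne'
  have h5 : ContinuousAt
      (fun q : ℂ × ℂ => deriv (deriv m) (Real.log ‖q.1‖) / m (Real.log ‖q.1‖)) p :=
    (ContinuousAt.comp (g := deriv (deriv m))
      (contDiff_infty_iff_deriv.1 hm1).2.continuous.continuousAt hx).div
      (ContinuousAt.comp (g := m) hm.continuous.continuousAt hx) (hpos _).ne'
  unfold discriminant
  fun_prop

/-- Dividing the weighted function's data by m turns it into the form of `worm_hessian_nonneg` with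
p₁ = m'/m and p₂ = m''/m, so the required expression is m² times a nonnegative one. -/
theorem hessianCondition_weightedWorm (hlam : IsWormProfile lam) {m : ℝ → ℝ}
    (hm : ContDiff ℝ ∞ m) (hpos : ∀ x, 0 < m x) (hτ : τ < 1) {p : ℂ × ℂ} (hp : p.1 ≠ 0)
    (hneg : wormFunction lam r p < 0) (hV : 0 < (1 + (fibre p).re) ^ 2 + (fibre p).im ^ 2)
    (hdisc : 0 ≤ discriminant lam r m τ p) : HessianCondition (weightedWorm lam r m) τ p := by
  intro t
  obtain ⟨η, T, rfl⟩ : ∃ η T, t = (p.1 * η, T * phase p.1) := ⟨_, _, eq_discTangent hp t⟩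
  obtain ⟨d1, d2, d3⟩ := wormFunction_data (r := r) hlam hp η T
  obtain ⟨w1, w2, w3⟩ := weightedWorm_data (r := r) hlam hm hp η T
  rw [w1, w2, w3, d1, d2, d3]
  have hM := hpos (Real.log ‖p.1‖)
  have hw := wormFunction_eq (lam := lam) (r := r) hp
  have key := worm_hessian_nonneg (W₁ := (fibre p).re) (W₂ := (fibre p).im) (T₁ := T.re)
    (T₂ := T.im) (η₁ := η.re) (η₂ := η.im) (C := collar lam r (Real.log ‖p.1‖))
    (L := deriv (collar lam r) (Real.log ‖p.1‖) / 2)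
    (L₂ := deriv (deriv (collar lam r)) (Real.log ‖p.1‖)) (δ := -wormFunction lam r p)
    (by linarith) (by linarith) (collar_nonneg hlam r _) (deriv_deriv_collar_nonneg hlam r _)
    hV hτ rfl rfl rfl (sub_nonneg.1 hdisc)
  rw [weightedWorm]
  generalize m (Real.log ‖p.1‖) = M at *
  refine le_of_le_of_eq (mul_nonneg (sq_nonneg M) key) ?_
  field_simp
  ring

theorem discriminant_pos_of_annulus (hlam : IsWormProfile lam) (hr : 1 < r) {m : ℝ → ℝ}
    (hm : ∀ x, 0 ≤ x → x ≤ Real.log r → (τ * (deriv m x / m x) / 2) ^ 2 + 1 <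
      (1 - τ) * (1 - (deriv (deriv m) x / m x - (1 - τ) * (deriv m x / m x) ^ 2) / 4))
    {z : ℂ} (h : 1 ≤ ‖z‖ ∧ ‖z‖ ≤ r) : 0 < discriminant lam r m τ (z, 0) := by
  have hl := log_norm_inside (p := (z, 0)) h
  have hf : fibre (z, 0) = 0 := by simp [fibre]
  have := hm _ hl.1 hl.2
  rw [discriminant, deriv_collar_eq_zero hlam hr hl.1 hl.2, hf]
  simp only [Complex.zero_re, Complex.zero_im]
  linarith

theorem isDFExponent_wormDomain (hlam : IsWormProfile lam) (hr : 1 < r) (hτ0 : 0 < τ)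
    (hτ1 : τ < 1) (hτ : 2 * (τ / (1 - τ)) * Real.log r < Real.pi) :
    IsDFExponent (wormDomain lam r) τ := by
  have hl := Real.log_pos hr
  obtain ⟨k, hk1, hk2⟩ : ∃ k, τ / (1 - τ) < k ∧ k < Real.pi / (2 * Real.log r) :=
    exists_between (by rw [lt_div_iff₀ (by positivity)]; linarith)
  rw [lt_div_iff₀ (by positivity)] at hk2
  obtain ⟨m, hm, hpos, hric⟩ := exists_weight hτ0 hτ1 hk1 hl (by linarith)
  have hdef := isDefiningFunction_weightedWorm hlam hr hm hpos
  refine isDFExponent_of_eventually (isOpen_wormDomain hlam r)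
    (isCompact_closure_wormDomain hlam r) hτ0 hτ1 hdef fun q hq => ?_
  have hq1 := fst_ne_zero_of_mem_closure hlam (frontier_subset_closure hq)
  by_cases hM : 1 ≤ ‖q.1‖ ∧ ‖q.1‖ ≤ r ∧ q.2 = 0
  -- On the annulus the discriminant is strictly positive, hence positive nearby by continuity. The
  -- other boundary points are strictly pseudoconvex.
  · obtain ⟨z, w⟩ := q
    obtain ⟨hz1, hz2, hw⟩ := hM
    obtain rfl : w = 0 := hw
    have hd := discriminant_pos_of_annulus hlam hr hric ⟨hz1, hz2⟩
    have hV : ContinuousAt (fun q => (1 + (fibre q).re) ^ 2 + (fibre q).im ^ 2) (z, 0) := by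
      have h1 : ContinuousAt (fun q => (fibre q).re) (z, 0) :=
        Complex.continuous_re.continuousAt.comp (continuousAt_fibre hq1)
      have h2 : ContinuousAt (fun q => (fibre q).im) (z, 0) :=
        Complex.continuous_im.continuousAt.comp (continuousAt_fibre hq1)
      fun_prop
    filter_upwards [hV.eventually (lt_mem_nhds (show (0 : ℝ) < _ by simp [fibre])),
      (continuousAt_discriminant hlam hm hpos hq1).eventually (lt_mem_nhds hd)] with p h1 h2 hp
    exact hessianCondition_weightedWorm hlam hm hpos hτ1 hp.1 hp.2 h1 h2.le
  · have h2 : IsDefiningFunction 2 (wormDomain lam r) (weightedWorm lam r m) :=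
      hdef.of_le (by norm_cast)
    have hs := leviForm_pos_of_not_mem_annulus hlam hr hq hM _ h2
    filter_upwards [eventually_hessianCondition hτ1
      (h2.contDiffAt (frontier_subset_closure hq)) (h2.eq_zero hq) hs] with p h1 hp
    refine h1 ?_
    exact mul_neg_of_neg_of_pos hp.2 (hpos _)

end LowerBound

/-! ### Holomorphic curves collapsing onto the annulus. -/

/-- The fibre coordinate of the leaves `leaf c k ε`. -/
noncomputable def leafFibre (c k : ℝ) (ζ : ℂ) : ℂ :=
  -Complex.exp (2 * Complex.I * c + 2 * Complex.I * (1 + k) * ζ)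

/-- Holomorphic curves approaching the exceptional annulus as `ε → 0`. -/
noncomputable def leaf (c k ε : ℝ) (ζ : ℂ) : ℂ × ℂ :=
  (Complex.exp (c + ζ), ε * leafFibre c k ζ)

section Leaf

variable {c k ε : ℝ}

theorem hasDerivAt_leaf (c k ε : ℝ) (ζ u : ℂ) (s : ℝ) :
    HasDerivAt (fun s : ℝ => leaf c k ε (ζ + s * u))
      (u * Complex.exp (c + (ζ + s * u)), u * (2 * Complex.I * (1 + k)) *
        (ε * leafFibre c k (ζ + s * u))) s := by
  have h0 : HasDerivAt (fun s : ℝ => ζ + (s : ℂ) * u) u s := by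
    simpa using ((Complex.ofRealCLM.hasDerivAt (x := s)).mul_const u).const_add ζ
  refine HasDerivAt.prodMk ?_ ?_
  · exact (h0.const_add (c : ℂ)).cexp.congr_deriv (by ring)
  · exact ((((h0.const_mul (2 * Complex.I * (1 + k))).const_add (2 * Complex.I * c)).cexp.neg
      ).const_mul (ε : ℂ)).congr_deriv (by rw [leafFibre]; ring)

theorem hasDerivAt_leaf' (c k ε : ℝ) (ζ u : ℂ) (s : ℝ) :
    HasDerivAt (fun s : ℝ => ((u * Complex.exp (c + (ζ + s * u)), u * (2 * Complex.I * (1 + k)) *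
        (ε * leafFibre c k (ζ + s * u))) : ℂ × ℂ))
      (u ^ 2 * Complex.exp (c + (ζ + s * u)), u ^ 2 * (2 * Complex.I * (1 + k)) ^ 2 *
        (ε * leafFibre c k (ζ + s * u))) s := by
  have h := hasDerivAt_leaf c k ε ζ u s
  have h1 : HasDerivAt (fun s : ℝ => (leaf c k ε (ζ + s * u)).1) _ s :=
    ((ContinuousLinearMap.fst ℝ ℂ ℂ).hasFDerivAt.comp_hasDerivAt s h)
  have h2 : HasDerivAt (fun s : ℝ => (leaf c k ε (ζ + s * u)).2) _ s :=
    ((ContinuousLinearMap.snd ℝ ℂ ℂ).hasFDerivAt.comp_hasDerivAt s h)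
  refine HasDerivAt.prodMk ?_ ?_
  · exact (h1.const_mul u).congr_deriv (by simp; ring)
  · exact (h2.const_mul (u * (2 * Complex.I * (1 + k)))).congr_deriv (by simp; ring)

/-- Plurisubharmonic functions are subharmonic along the leaves. -/
theorem exists_twoJet_leaf {v : ℂ × ℂ → ℝ} {ζ : ℂ} (hv : ContDiffAt ℝ 2 v (leaf c k ε ζ))
    (hpsh : ∀ t, 0 ≤ leviForm v (leaf c k ε ζ) t) : ∃ b₁ c₁ b₂ c₂ : ℝ,
      HasTwoJetAt (fun s : ℝ => v (leaf c k ε (ζ + s * 1))) b₁ c₁ 0 ∧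
      HasTwoJetAt (fun s : ℝ => v (leaf c k ε (ζ + s * Complex.I))) b₂ c₂ 0 ∧ 0 ≤ c₁ + c₂ := by
  have hj : ∀ u, HasTwoJetAt (fun s : ℝ => v (leaf c k ε (ζ + s * u))) _ _ 0 := fun u =>
    HasTwoJetAt.comp_curve (F := v) (γ := fun s : ℝ => leaf c k ε (ζ + s * u)) (by simpa using hv)
      (hasDerivAt_leaf c k ε ζ u) (hasDerivAt_leaf' c k ε ζ u 0)
  refine ⟨_, _, _, _, hj 1, hj Complex.I, ?_⟩
  have h := four_mul_leviForm_eq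
    (t := (Complex.exp (c + ζ), 2 * Complex.I * (1 + k) * (ε * leafFibre c k ζ)))
    (γ₁ := fun s : ℝ => leaf c k ε (ζ + s * 1)) (γ₂ := fun s : ℝ => leaf c k ε (ζ + s * Complex.I))
    hv (by simp) (by simp)
    (hasDerivAt_leaf c k ε ζ 1) (hasDerivAt_leaf c k ε ζ Complex.I)
    (hasDerivAt_leaf' c k ε ζ 1 0)
    ((hasDerivAt_leaf' c k ε ζ Complex.I 0).congr_deriv (by simp)) (by simp)
    (by simp [mul_assoc]) (hj 1) (hj Complex.I)
  rw [← h.1]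
  have := hpsh (Complex.exp (c + ζ), 2 * Complex.I * (1 + k) * (ε * leafFibre c k ζ))
  linarith

theorem log_norm_exp_add (c : ℝ) (ζ : ℂ) : Real.log ‖Complex.exp (c + ζ)‖ = c + ζ.re := by
  rw [Complex.norm_exp, Real.log_exp]
  simp

/-- The phase absorbs the rotation 2(c + Re ζ), leaving the rotated coordinate -e^{-2(1+k)y + 2ikx}
for ζ = x + iy. Its real part is negative for |2kx| < π/2, so the curve enters the domain there. The
remaining rotation 2kx is the slack that k measures. -/
theorem leafFibre_eq (c k : ℝ) (ζ : ℂ) : leafFibre c k ζ =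
    -Complex.exp (((-2 * (1 + k) * ζ.im : ℝ) : ℂ) + ((2 * k * ζ.re : ℝ) : ℂ) * Complex.I) *
      phase (Complex.exp (c + ζ)) := by
  rw [phase_eq, log_norm_exp_add, leafFibre, neg_mul, ← Complex.exp_add]
  congr 2
  refine Complex.ext ?_ ?_
  · simp
  · simp; ring

theorem leaf_bounds {l : ℝ} {r : ℝ} (hr : 1 < r) (hl : l = Real.log r) {ζ : ℂ}
    (h : |ζ.re| ≤ l / 2) :
    1 ≤ ‖Complex.exp (((l / 2 : ℝ) : ℂ) + ζ)‖ ∧ ‖Complex.exp (((l / 2 : ℝ) : ℂ) + ζ)‖ ≤ r := by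
  rw [abs_le] at h
  have hn := log_norm_exp_add (l / 2) ζ
  have hpos : 0 < ‖Complex.exp (((l / 2 : ℝ) : ℂ) + ζ)‖ := by simp
  rw [← Real.log_nonneg_iff hpos, ← Real.log_le_log_iff hpos (by linarith), hn, ← hl]
  constructor <;> linarith

end Leaf

/-! ### The boundary limit of (-ρ)^τ and a touching subharmonic function. -/

/-- The normal derivative of a defining function along the exceptional annulus. -/
noncomputable def annulusFactor (ρ : ℂ × ℂ → ℝ) (z : ℂ) : ℝ :=
  fderiv ℝ ρ (z, 0) (0, phase z) / 2

section Factor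

variable {lam : ℝ → ℝ} {r : ℝ} {ρ : ℂ × ℂ → ℝ}

/-- The differential is a positive multiple of that of the worm function, whose fibre part is 2 Re
T; the factor is that multiple. -/
theorem annulusFactor_spec (hlam : IsWormProfile lam) (hr : 1 < r)
    (hρ : IsDefiningFunction 2 (wormDomain lam r) ρ) {z : ℂ} (h : 1 ≤ ‖z‖ ∧ ‖z‖ ≤ r) :
    0 < annulusFactor ρ z ∧
      ∀ T : ℂ, fderiv ℝ ρ (z, 0) (0, T * phase z) = 2 * annulusFactor ρ z * T.re := by
  obtain ⟨hfr, hd⟩ := annulus_data hlam hr h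
  obtain ⟨a, ha, hda, -⟩ := ((isDefiningFunction_wormFunction hlam hr).of_le
    (m := 2) (by norm_cast)).exists_leviForm_eq_mul hρ hfr
  have key : ∀ T : ℂ, fderiv ℝ ρ (z, 0) (0, T * phase z) = 2 * a * T.re := by
    intro T
    have := (hd 0 T).2.1
    rw [mul_zero] at this
    rw [hda, smul_apply, smul_eq_mul, this]
    ring
  have h1 : annulusFactor ρ z = a := by
    have := key 1
    rw [one_mul] at this
    rw [annulusFactor, this]
    simp
  rw [h1]
  exact ⟨ha, key⟩

theorem continuousAt_annulusFactor (hρ : ContDiffAt ℝ 1 ρ (z, 0)) (hz : z ≠ 0) :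
    ContinuousAt (annulusFactor ρ) z := by
  have h1 : ContDiffAt ℝ 0 (fderiv ℝ ρ) (z, 0) := hρ.fderiv_right (by norm_num)
  have h2 : ContinuousAt (fun z : ℂ => fderiv ℝ ρ (z, 0)) z :=
    ContinuousAt.comp (f := fun z : ℂ => (z, (0 : ℂ))) h1.continuousAt (by fun_prop)
  have h3 : ContinuousAt phase z :=
    ContinuousAt.comp (g := fun q : ℂ × ℂ => phase q.1) (f := fun z : ℂ => (z, (0 : ℂ)))
      (contDiffAt_phase (n := 0) (p := (z, 0)) hz).continuousAt (by fun_prop)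
  have h4 : ContinuousAt (fun z : ℂ => ((0 : ℂ), phase z)) z := continuousAt_const.prodMk h3
  exact (h2.clm_apply h4).div_const 2

/-- A strictly subharmonic function touching from below the boundary value of `(-ρ)^τ`. -/
theorem exists_touching (hlam : IsWormProfile lam) (hr : 1 < r)
    (hρ : IsDefiningFunction 2 (wormDomain lam r) ρ) {τ k : ℝ} (hτ1 : τ < 1)
    (hk : 0 < k) (hkr : Real.pi < 2 * k * Real.log r) :
    ∃ ζ₀ : ℂ, ∃ C : ℝ, 0 < C ∧ 2 * k * |ζ₀.re| < Real.pi / 2 ∧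
      (∀ ζ : ℂ, 2 * k * |ζ.re| < Real.pi / 2 →
        fderiv ℝ ρ (leaf (Real.log r / 2) k 0 ζ) (0, leafFibre (Real.log r / 2) k ζ) < 0 ∧
        Real.exp (-2 * (τ * (1 + k)) * ζ.im) * Real.cos (2 * k * ζ.re) ≤
          C * (-fderiv ℝ ρ (leaf (Real.log r / 2) k 0 ζ)
            (0, leafFibre (Real.log r / 2) k ζ)) ^ τ) ∧
      Real.exp (-2 * (τ * (1 + k)) * ζ₀.im) * Real.cos (2 * k * ζ₀.re) =
          C * (-fderiv ℝ ρ (leaf (Real.log r / 2) k 0 ζ₀)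
            (0, leafFibre (Real.log r / 2) k ζ₀)) ^ τ := by
  set l := Real.log r with hl
  have hl0 : 0 < l := Real.log_pos hr
  -- The half-width at which 2kx reaches π/2. Since π < 2k log r, the strip |x| ≤ X maps strictly
  -- inside the exceptional annulus.
  set X := Real.pi / (4 * k) with hX
  have hX0 : 0 < X := by positivity
  have hXl : X < l / 2 := by
    rw [hX, div_lt_iff₀ (by positivity)]
    linarith
  have hkX : 2 * k * X = Real.pi / 2 := by rw [hX]; field_simp; ring
  have hXiff : ∀ x, 2 * k * |x| < Real.pi / 2 ↔ |x| < X := fun x => by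
    rw [← hkX]; exact mul_lt_mul_iff_right₀ (by positivity)
  have hcos : ∀ x, |x| < X → 0 < Real.cos (2 * k * x) := fun x hx => by
    rw [abs_lt] at hx
    exact Real.cos_pos_of_mem_Ioo ⟨by nlinarith, by nlinarith⟩
  have hcosX : ∀ x, |x| = X → Real.cos (2 * k * x) = 0 := fun x hx => by
    rw [← Real.cos_abs, abs_mul, abs_of_pos (show 0 < 2 * k by positivity), hx, hkX,
      Real.cos_pi_div_two]
  -- the function to be maximized over a compact annulus
  set g : ℂ → ℝ := fun z => Real.cos (2 * k * (Real.log ‖z‖ - l / 2)) ^ (1 - τ) /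
    annulusFactor ρ z ^ τ with hg
  -- The image of the strip |Re ζ| ≤ X. The quotient to be maximized does not depend on the choice
  -- of logarithm because the factors e^{-2τ(1+k)y} cancel, so the noncompact strip can be replaced
  -- by this compact set.
  set A : Set ℂ := Metric.closedBall 0 (Real.exp (l / 2 + X)) ∩ {z | Real.exp (l / 2 - X) ≤ ‖z‖}
    with hA
  have hAc : IsCompact A := (isCompact_closedBall _ _).inter_right
    (isClosed_le continuous_const continuous_norm)
  have hAiff : ∀ ζ : ℂ, Complex.exp (((l / 2 : ℝ) : ℂ) + ζ) ∈ A ↔ |ζ.re| ≤ X := by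
    intro ζ
    have h1 : ‖Complex.exp (((l / 2 : ℝ) : ℂ) + ζ)‖ = Real.exp (l / 2 + ζ.re) := by
      rw [Complex.norm_exp]; simp
    rw [hA, Set.mem_inter_iff, mem_closedBall_zero_iff, Set.mem_ofPred_eq, h1, Real.exp_le_exp,
      Real.exp_le_exp, abs_le]
    constructor <;> rintro ⟨h2, h3⟩ <;> constructor <;> linarith
  have hAne : ∀ z ∈ A, z ≠ 0 := by
    rintro z ⟨-, hz⟩ rfl
    simp only [Set.mem_ofPred_eq, norm_zero] at hz
    exact absurd hz (not_le.2 (Real.exp_pos _))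
  have hsurj : ∀ z ∈ A, ∃ ζ : ℂ, Complex.exp (((l / 2 : ℝ) : ℂ) + ζ) = z := fun z hz =>
    ⟨Complex.log z - ((l / 2 : ℝ) : ℂ), by
      rw [add_sub_cancel, Complex.exp_log (hAne z hz)]⟩
  have hAb : ∀ z ∈ A, 1 ≤ ‖z‖ ∧ ‖z‖ ≤ r := by
    intro z hz
    obtain ⟨ζ, rfl⟩ := hsurj z hz
    exact leaf_bounds hr hl (((hAiff ζ).1 hz).trans hXl.le)
  have hgc : ContinuousOn g A := by
    intro z hz
    have hz0 := hAne z hz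
    refine ContinuousAt.continuousWithinAt ?_
    have hfr := (annulus_data hlam hr (hAb z hz)).1
    have h1 := continuousAt_annulusFactor
      ((hρ.contDiffAt (frontier_subset_closure hfr)).of_le (by norm_num)) hz0
    have hpos := (annulusFactor_spec hlam hr hρ (hAb z hz)).1
    have h2 : ContinuousAt (fun z : ℂ => Real.cos (2 * k * (Real.log ‖z‖ - l / 2))) z := by
      have : ContinuousAt (fun z : ℂ => Real.log ‖z‖) z :=
        continuous_norm.continuousAt.log (by simpa using hz0)
      exact Real.continuous_cos.continuousAt.comp
        (continuousAt_const.mul (this.sub continuousAt_const))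
    exact (h2.rpow_const (Or.inr (by linarith))).div (h1.rpow_const (Or.inl hpos.ne'))
      (Real.rpow_pos_of_pos hpos τ).ne'
  have h0A : Complex.exp (((l / 2 : ℝ) : ℂ) + 0) ∈ A := (hAiff 0).2 (by simpa using hX0.le)
  obtain ⟨z₀, hz₀, hmax⟩ := hAc.exists_isMaxOn ⟨_, h0A⟩ hgc
  obtain ⟨ζ₀, rfl⟩ := hsurj z₀ hz₀
  have hgval : ∀ ζ : ℂ, g (Complex.exp (((l / 2 : ℝ) : ℂ) + ζ)) =
      Real.cos (2 * k * ζ.re) ^ (1 - τ) /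
        annulusFactor ρ (Complex.exp (((l / 2 : ℝ) : ℂ) + ζ)) ^ τ := by
    intro ζ
    simp only [hg]
    rw [log_norm_exp_add, add_sub_cancel_left]
  have hfac : ∀ ζ : ℂ, |ζ.re| ≤ X →
      0 < annulusFactor ρ (Complex.exp (((l / 2 : ℝ) : ℂ) + ζ)) := fun ζ hζ =>
    (annulusFactor_spec hlam hr hρ (hAb _ ((hAiff ζ).2 hζ))).1
  have hgmax : ∀ ζ : ℂ, |ζ.re| ≤ X → g (Complex.exp (((l / 2 : ℝ) : ℂ) + ζ)) ≤
      g (Complex.exp (((l / 2 : ℝ) : ℂ) + ζ₀)) := fun ζ hζ => hmax ((hAiff ζ).2 hζ)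
  have hg0 : 0 < g (Complex.exp (((l / 2 : ℝ) : ℂ) + ζ₀)) := by
    refine lt_of_lt_of_le ?_ (hgmax 0 (by simpa using hX0.le))
    rw [hgval]
    refine div_pos (Real.rpow_pos_of_pos (by simp) _) (Real.rpow_pos_of_pos (hfac 0 ?_) _)
    simpa using hX0.le
  -- On the two boundary circles the quotient vanishes, since cos = 0 and 1 - τ > 0; hence the
  -- positive maximum is interior.
  have hζ₀ : |ζ₀.re| < X := by
    refine lt_of_le_of_ne ((hAiff ζ₀).1 hz₀) fun h => ?_
    rw [hgval, hcosX _ h, Real.zero_rpow (by linarith), zero_div] at hg0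
    exact lt_irrefl _ hg0
  have hder : ∀ ζ : ℂ, |ζ.re| ≤ X → -fderiv ℝ ρ (leaf (l / 2) k 0 ζ) (0, leafFibre (l / 2) k ζ) =
      2 * (annulusFactor ρ (Complex.exp (((l / 2 : ℝ) : ℂ) + ζ)) *
        (Real.exp (-2 * (1 + k) * ζ.im) * Real.cos (2 * k * ζ.re))) := by
    intro ζ hζ
    have h1 := (annulusFactor_spec hlam hr hρ (hAb _ ((hAiff ζ).2 hζ))).2
      (-Complex.exp (((-2 * (1 + k) * ζ.im : ℝ) : ℂ) + ((2 * k * ζ.re : ℝ) : ℂ) * Complex.I))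
    have h2 : leaf (l / 2) k 0 ζ = (Complex.exp (((l / 2 : ℝ) : ℂ) + ζ), 0) := by simp [leaf]
    rw [h2, leafFibre_eq, h1, Complex.neg_re, Complex.exp_re]
    simp
    ring
  have hpow : ∀ ζ : ℂ, |ζ.re| < X →
      (-fderiv ℝ ρ (leaf (l / 2) k 0 ζ) (0, leafFibre (l / 2) k ζ)) ^ τ =
      2 ^ τ * (annulusFactor ρ (Complex.exp (((l / 2 : ℝ) : ℂ) + ζ)) ^ τ *
        (Real.exp (-2 * (τ * (1 + k)) * ζ.im) * Real.cos (2 * k * ζ.re) ^ τ)) := by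
    intro ζ hζ
    have h1 := hfac ζ hζ.le
    have h2 := hcos ζ.re hζ
    rw [hder ζ hζ.le, Real.mul_rpow (by norm_num) (by positivity), Real.mul_rpow h1.le
      (by positivity), Real.mul_rpow (Real.exp_pos _).le h2.le, ← Real.exp_mul]
    ring_nf
  have h2τ : (0 : ℝ) < 2 ^ τ := by positivity
  have hv : ∀ ζ : ℂ, |ζ.re| < X → Real.exp (-2 * (τ * (1 + k)) * ζ.im) * Real.cos (2 * k * ζ.re) =
      g (Complex.exp (((l / 2 : ℝ) : ℂ) + ζ)) / 2 ^ τ *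
        (-fderiv ℝ ρ (leaf (l / 2) k 0 ζ) (0, leafFibre (l / 2) k ζ)) ^ τ := by
    intro ζ hζ
    have h1 : 0 < annulusFactor ρ (Complex.exp (((l / 2 : ℝ) : ℂ) + ζ)) ^ τ :=
      Real.rpow_pos_of_pos (hfac ζ hζ.le) τ
    have h3 : Real.cos (2 * k * ζ.re) =
        Real.cos (2 * k * ζ.re) ^ (1 - τ) * Real.cos (2 * k * ζ.re) ^ τ := by
      rw [← Real.rpow_add (hcos _ hζ)]
      simp
    rw [hpow ζ hζ, hgval]
    field_simp
    rw [← h3]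
  refine ⟨ζ₀, g (Complex.exp (((l / 2 : ℝ) : ℂ) + ζ₀)) / 2 ^ τ, div_pos hg0 h2τ,
    (hXiff _).2 hζ₀, fun ζ hζ => ?_, hv ζ₀ hζ₀⟩
  rw [hXiff] at hζ
  have hneg : 0 < -fderiv ℝ ρ (leaf (l / 2) k 0 ζ) (0, leafFibre (l / 2) k ζ) := by
    rw [hder ζ hζ.le]
    have h1 := hfac ζ hζ.le
    have h2 := hcos ζ.re hζ
    positivity
  refine ⟨by linarith, ?_⟩
  rw [hv ζ hζ]
  exact mul_le_mul_of_nonneg_right (div_le_div_of_nonneg_right (hgmax ζ hζ.le) h2τ.le)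
    (Real.rpow_nonneg hneg.le τ)

end Factor

/-! ### The maximum principle and the value of the index. -/

section UpperBound

variable {c k : ℝ}

theorem continuous_leafFibre (c k : ℝ) : Continuous (leafFibre c k) := by
  unfold leafFibre
  fun_prop

theorem continuous_leaf (c k : ℝ) : Continuous (fun x : ℝ × ℂ => leaf c k x.1 x.2) := by
  unfold leaf leafFibre
  fun_prop

theorem leaf_zero (c k : ℝ) (ζ : ℂ) : leaf c k 0 ζ = (Complex.exp (c + ζ), 0) := by
  simp [leaf]

theorem hasDerivAt_leaf_param (c k ε : ℝ) (ζ : ℂ) :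
    HasDerivAt (fun ε : ℝ => leaf c k ε ζ) (0, leafFibre c k ζ) ε := by
  refine HasDerivAt.prodMk (hasDerivAt_const _ _) ?_
  simpa using (Complex.ofRealCLM.hasDerivAt (x := ε)).mul_const (leafFibre c k ζ)

/-- Difference quotients of `ρ` transversally to the annulus are values of its differential. -/
theorem exists_eq_fderiv_leaf {ρ : ℂ × ℂ → ℝ} {ζ : ℂ} {ε : ℝ} (hε : 0 < ε)
    (hd : ∀ s ∈ Set.Icc 0 ε, DifferentiableAt ℝ ρ (leaf c k s ζ)) (h0 : ρ (leaf c k 0 ζ) = 0) :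
    ∃ s ∈ Set.Ioo 0 ε, ρ (leaf c k ε ζ) = ε * fderiv ℝ ρ (leaf c k s ζ) (0, leafFibre c k ζ) := by
  have hder : ∀ s ∈ Set.Icc 0 ε, HasDerivAt (fun s => ρ (leaf c k s ζ))
      (fderiv ℝ ρ (leaf c k s ζ) (0, leafFibre c k ζ)) s := fun s hs =>
    (hd s hs).hasFDerivAt.comp_hasDerivAt s (hasDerivAt_leaf_param c k s ζ)
  obtain ⟨s, hs, h⟩ := exists_hasDerivAt_eq_slope _ _ hε
    (fun s hs => (hder s hs).continuousAt.continuousWithinAt)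
    (fun s hs => hder s (Set.Ioo_subset_Icc_self hs))
  refine ⟨s, hs, ?_⟩
  rw [h, h0, sub_zero, sub_zero]
  field_simp

theorem hasTwoJetAt_barrier_re (K k μ : ℝ) (ζ ζ₀ : ℂ) :
    ∃ b, HasTwoJetAt (fun s : ℝ => Real.exp (-2 * K * (ζ + s * 1).im) *
        Real.cos (2 * k * (ζ + s * 1).re) - μ * Complex.normSq (ζ + s * 1 - ζ₀)) b
      (-(4 * k ^ 2 * (Real.exp (-2 * K * ζ.im) * Real.cos (2 * k * ζ.re))) - 2 * μ) 0 := by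
  have h1 : HasTwoJetAt (fun s : ℝ => Real.cos (2 * k * ζ.re + 2 * k * s)) _ _ 0 :=
    HasTwoJetAt.comp (g := fun x => 2 * k * ζ.re + 2 * k * x)
      (HasTwoJetAt.of_contDiffAt (Real.contDiff_cos.contDiffAt)) (HasTwoJetAt.affine _ (2 * k) 0)
  have h2 := ((h1.const_mul (Real.exp (-2 * K * ζ.im))).sub
    ((((HasTwoJetAt.affine (ζ.re - ζ₀.re) 1 0).sq).add
      (HasTwoJetAt.const ((ζ.im - ζ₀.im) ^ 2) 0)).const_mul μ))
  refine ⟨_, (h2.congr_of_eventuallyEq (Eventually.of_forall fun s => ?_)).congr_jet rfl ?_⟩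
  · simp [Complex.normSq_apply]
    ring_nf
  · simp
    ring_nf

theorem hasTwoJetAt_barrier_im (K k μ : ℝ) (ζ ζ₀ : ℂ) :
    ∃ b, HasTwoJetAt (fun s : ℝ => Real.exp (-2 * K * (ζ + s * Complex.I).im) *
        Real.cos (2 * k * (ζ + s * Complex.I).re) - μ * Complex.normSq (ζ + s * Complex.I - ζ₀)) b
      (4 * K ^ 2 * (Real.exp (-2 * K * ζ.im) * Real.cos (2 * k * ζ.re)) - 2 * μ) 0 := by
  have h1 : HasTwoJetAt (fun s : ℝ => Real.exp (-2 * K * ζ.im + -2 * K * s)) _ _ 0 :=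
    HasTwoJetAt.comp (g := fun x => -2 * K * ζ.im + -2 * K * x)
      (HasTwoJetAt.of_contDiffAt (Real.contDiff_exp.contDiffAt))
      (HasTwoJetAt.affine _ (-2 * K) 0)
  have h2 := ((h1.const_mul (Real.cos (2 * k * ζ.re))).sub
    ((((HasTwoJetAt.affine (ζ.im - ζ₀.im) 1 0).sq).add
      (HasTwoJetAt.const ((ζ.re - ζ₀.re) ^ 2) 0)).const_mul μ))
  refine ⟨_, (h2.congr_of_eventuallyEq (Eventually.of_forall fun s => ?_)).congr_jet rfl ?_⟩
  · simp [Complex.normSq_apply]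
    ring_nf
  · simp
    ring_nf

/-- The maximum principle: no strictly subharmonic function touches the limit of `(-ρ/ε)^τ` along
the leaves from below. -/
theorem not_touching {Ω : Set (ℂ × ℂ)} {ρ : ℂ × ℂ → ℝ} {τ K C : ℝ} {ζ₀ : ℂ}
    (hΩo : IsOpen Ω) (hρ : IsDefiningFunction ∞ Ω ρ)
    (hpsh : IsPlurisubharmonicOn (fun p => -((-ρ p) ^ τ)) Ω) (hkK : k ^ 2 < K ^ 2) (hC : 0 < C)
    (hv0 : 0 < Real.exp (-2 * K * ζ₀.im) * Real.cos (2 * k * ζ₀.re))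
    (hfr : ∀ᶠ ζ in 𝓝 ζ₀, leaf c k 0 ζ ∈ frontier Ω)
    (hle : ∀ᶠ ζ in 𝓝 ζ₀, fderiv ℝ ρ (leaf c k 0 ζ) (0, leafFibre c k ζ) < 0 ∧
      Real.exp (-2 * K * ζ.im) * Real.cos (2 * k * ζ.re) ≤
        C * (-fderiv ℝ ρ (leaf c k 0 ζ) (0, leafFibre c k ζ)) ^ τ)
    (heq : Real.exp (-2 * K * ζ₀.im) * Real.cos (2 * k * ζ₀.re) =
      C * (-fderiv ℝ ρ (leaf c k 0 ζ₀) (0, leafFibre c k ζ₀)) ^ τ) : False := by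
  obtain ⟨U, hU, hcl, hρC, hΩ, -⟩ := id hρ
  set v : ℂ → ℝ := fun ζ => Real.exp (-2 * K * ζ.im) * Real.cos (2 * k * ζ.re) with hv
  have hvc : Continuous v := by
    refine (Real.continuous_exp.comp (continuous_const.mul Complex.continuous_im)).mul
      (Real.continuous_cos.comp (continuous_const.mul Complex.continuous_re))
  set Ψ : ℝ → ℂ → ℝ := fun s ζ => -fderiv ℝ ρ (leaf c k s ζ) (0, leafFibre c k ζ) with hΨ
  -- The Laplacian of v - μ|ζ-ζ₀|² is 4(K²-k²)v - 4μ. This choice keeps it positive wherever v >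
  -- v(ζ₀)/2.
  set μ := (K ^ 2 - k ^ 2) * v ζ₀ / 4 with hμ
  have hμ0 : 0 < μ := by
    have : 0 < K ^ 2 - k ^ 2 := by linarith
    have : 0 < v ζ₀ := hv0
    positivity
  obtain ⟨R, hR0, hR⟩ : ∃ R > 0, ∀ ζ ∈ Metric.closedBall ζ₀ R, leaf c k 0 ζ ∈ frontier Ω ∧
      0 < Ψ 0 ζ ∧ v ζ ≤ C * Ψ 0 ζ ^ τ ∧ v ζ₀ / 2 < v ζ := by
    have h1 : ∀ᶠ ζ in 𝓝 ζ₀, v ζ₀ / 2 < v ζ :=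
      hvc.continuousAt.eventually (lt_mem_nhds (half_lt_self hv0))
    obtain ⟨R, hR0, hR⟩ := Metric.nhds_basis_closedBall.eventually_iff.1
      (hfr.and (hle.and h1))
    exact ⟨R, hR0, fun ζ hζ => ⟨(hR hζ).1, neg_pos.2 (hR hζ).2.1.1, (hR hζ).2.1.2, (hR hζ).2.2⟩⟩
  -- uniform control of the difference quotients
  have hΨc : ∀ ζ ∈ Metric.closedBall ζ₀ R, ContinuousAt (fun x : ℝ × ℂ => Ψ x.1 x.2) (0, ζ) := by
    intro ζ hζ
    have hC1 : ContDiffAt ℝ ∞ ρ (leaf c k 0 ζ) :=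
      hρ.contDiffAt (frontier_subset_closure (hR ζ hζ).1)
    have h1 : ContDiffAt ℝ 0 (fderiv ℝ ρ) (leaf c k 0 ζ) :=
      (hC1.of_le (m := 1) (by norm_cast)).fderiv_right (by norm_num)
    have h2 : ContinuousAt (fun x : ℝ × ℂ => fderiv ℝ ρ (leaf c k x.1 x.2)) (0, ζ) :=
      ContinuousAt.comp (f := fun x : ℝ × ℂ => leaf c k x.1 x.2) (x := (0, ζ)) h1.continuousAt
        (continuous_leaf c k).continuousAt
    have h3 : ContinuousAt (fun x : ℝ × ℂ => ((0 : ℂ), leafFibre c k x.2)) (0, ζ) :=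
      (continuous_const.prodMk ((continuous_leafFibre c k).comp continuous_snd)).continuousAt
    exact (h2.clm_apply h3).neg
  have hunif : ∀ᶠ s in 𝓝 (0 : ℝ), ∀ ζ ∈ Metric.closedBall ζ₀ R, leaf c k s ζ ∈ U ∧ 0 < Ψ s ζ ∧
      |C * Ψ s ζ ^ τ - C * Ψ 0 ζ ^ τ| < μ * R ^ 2 / 3 := by
    refine (isCompact_closedBall ζ₀ R).eventually_forall_of_forall_eventually fun ζ hζ => ?_
    have h1 : ∀ᶠ x : ℝ × ℂ in 𝓝 (0, ζ), leaf c k x.1 x.2 ∈ U :=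
      (continuous_leaf c k).continuousAt.eventually
        (hU.mem_nhds (hcl (frontier_subset_closure (hR ζ hζ).1)))
    have h2 := (hΨc ζ hζ).eventually (lt_mem_nhds (hR ζ hζ).2.1)
    have h3 : ContinuousAt (fun x : ℝ × ℂ => Ψ 0 x.2) (0, ζ) :=
      ContinuousAt.comp (f := fun x : ℝ × ℂ => ((0 : ℝ), x.2)) (x := (0, ζ))
        (g := fun x : ℝ × ℂ => Ψ x.1 x.2) (hΨc ζ hζ) (by fun_prop)
    have hne := (hR ζ hζ).2.1.ne'
    have h4 : ContinuousAt (fun x : ℝ × ℂ => |C * Ψ x.1 x.2 ^ τ - C * Ψ 0 x.2 ^ τ|) (0, ζ) :=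
      ((continuousAt_const.mul ((hΨc ζ hζ).rpow_const (Or.inl hne))).sub
        (continuousAt_const.mul (h3.rpow_const (Or.inl hne)))).abs
    have h5 := h4.eventually (gt_mem_nhds (show _ < μ * R ^ 2 / 3 by
      simp only [sub_self, abs_zero]; positivity))
    filter_upwards [h1, h2, h5] with x a1 a2 a3
    exact ⟨a1, a2, a3⟩
  obtain ⟨d, hd0, hd⟩ := Metric.nhds_basis_closedBall.eventually_iff.1 hunif
  -- By the mean value theorem -ρ/d on the leaf with parameter d equals Ψ at some intermediate
  -- parameter in (0, d), to which the uniform estimate applies.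
  have hq : ∀ ζ ∈ Metric.closedBall ζ₀ R, ρ (leaf c k d ζ) < 0 ∧
      |C * d ^ (-τ) * (-ρ (leaf c k d ζ)) ^ τ - C * Ψ 0 ζ ^ τ| < μ * R ^ 2 / 3 := by
    intro ζ hζ
    have hin : ∀ s ∈ Set.Icc 0 d, s ∈ Metric.closedBall (0 : ℝ) d := fun s hs => by
      rw [mem_closedBall_zero_iff, Real.norm_eq_abs, abs_of_nonneg hs.1]
      exact hs.2
    obtain ⟨s, hs, heqs⟩ := exists_eq_fderiv_leaf (c := c) (k := k) (ρ := ρ) (ζ := ζ) hd0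
      (fun s hs => (hρC.contDiffAt (hU.mem_nhds (hd (hin s hs) ζ hζ).1)).differentiableAt (by simp))
      (hρ.eq_zero (hR ζ hζ).1)
    obtain ⟨-, h1, h2⟩ := hd (hin s (Set.Ioo_subset_Icc_self hs)) ζ hζ
    have h3 : ρ (leaf c k d ζ) = -(d * Ψ s ζ) := by rw [heqs]; simp [hΨ]
    have h4 : C * d ^ (-τ) * (-ρ (leaf c k d ζ)) ^ τ = C * Ψ s ζ ^ τ := by
      rw [h3, neg_neg, Real.mul_rpow hd0.le h1.le, Real.rpow_neg hd0.le]
      have : d ^ τ ≠ 0 := (Real.rpow_pos_of_pos hd0 τ).ne'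
      field_simp
    refine ⟨?_, by rwa [h4]⟩
    rw [h3]
    exact neg_neg_of_pos (mul_pos hd0 h1)
  have hmemΩ : ∀ ζ ∈ Metric.closedBall ζ₀ R, leaf c k d ζ ∈ Ω := fun ζ hζ => by
    rw [hΩ]
    exact ⟨(hd (by simp [abs_of_pos hd0]) ζ hζ).1, (hq ζ hζ).1⟩
  set u : ℂ × ℂ → ℝ := fun p => -((-ρ p) ^ τ) with hu
  have huC : ∀ p ∈ Ω, ContDiffAt ℝ 2 u p := fun p hp => hpsh.1.contDiffAt (hΩo.mem_nhds hp)
  -- The perturbed v minus C(-ρ/d)^τ on a nearby leaf: a strictly subharmonic function plus a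
  -- subharmonic one.
  set E : ℂ → ℝ := fun ζ => v ζ - μ * Complex.normSq (ζ - ζ₀) +
    C * d ^ (-τ) * u (leaf c k d ζ) with hE
  have hEc : ContinuousOn E (Metric.closedBall ζ₀ R) := by
    intro ζ hζ
    refine ContinuousAt.continuousWithinAt ?_
    have h1 : ContinuousAt (fun ζ => leaf c k d ζ) ζ :=
      ((continuous_leaf c k).comp (continuous_const.prodMk continuous_id)).continuousAt
    have h2 : ContinuousAt (fun ζ => u (leaf c k d ζ)) ζ :=
      ContinuousAt.comp (g := u) (huC _ (hmemΩ ζ hζ)).continuousAt h1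
    exact (hvc.continuousAt.sub (continuousAt_const.mul
      (Complex.continuous_normSq.comp (continuous_id.sub continuous_const)).continuousAt)).add
      (continuousAt_const.mul h2)
  have hc0 : ζ₀ ∈ Metric.closedBall ζ₀ R := Metric.mem_closedBall_self hR0.le
  obtain ⟨ζ₁, hζ₁, hmax⟩ := (isCompact_closedBall ζ₀ R).exists_isMaxOn ⟨_, hc0⟩ hEc
  -- On the bounding circle E < -μR² + μR²/3, whereas E(ζ₀) > -μR²/3; so the maximum is interior.
  have hball : ζ₁ ∈ Metric.ball ζ₀ R := by
    by_contra hnot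
    have hdist : dist ζ₁ ζ₀ = R :=
      le_antisymm (Metric.mem_closedBall.1 hζ₁) (not_lt.1 fun h => hnot (Metric.mem_ball.2 h))
    have h1 := hmax hc0
    simp only [hE, hu, Set.mem_ofPred_eq, sub_self, map_zero, mul_zero, sub_zero] at h1
    rw [Complex.normSq_eq_norm_sq, ← dist_eq_norm, hdist] at h1
    have h2 := abs_lt.1 (hq ζ₀ hc0).2
    have h3 := abs_lt.1 (hq ζ₁ hζ₁).2
    have h4 := (hR ζ₁ hζ₁).2.2.1
    have h5 : v ζ₀ = C * Ψ 0 ζ₀ ^ τ := heq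
    have h6 : 0 < μ * R ^ 2 := by positivity
    linarith
  have hloc : IsLocalMax E ζ₁ :=
    (hmax.isLocalMax (Filter.mem_of_superset (Metric.isOpen_ball.mem_nhds hball)
      Metric.ball_subset_closedBall))
  have hlocu : ∀ u : ℂ, IsLocalMax (fun s : ℝ => E (ζ₁ + s * u)) 0 := by
    intro u
    have ht : Tendsto (fun s : ℝ => ζ₁ + s * u) (𝓝 0) (𝓝 ζ₁) := by
      have : Continuous (fun s : ℝ => ζ₁ + (s : ℂ) * u) := by fun_prop
      simpa using this.tendsto 0
    have := ht.eventually hloc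
    simpa [IsLocalMax, IsMaxFilter] using this
  obtain ⟨b₁, c₁, b₂, c₂, j₁, j₂, hsum⟩ := exists_twoJet_leaf (huC _ (hmemΩ ζ₁ hζ₁))
    (hpsh.2 _ (hmemΩ ζ₁ hζ₁))
  obtain ⟨_, k₁⟩ := hasTwoJetAt_barrier_re K k μ ζ₁ ζ₀
  obtain ⟨_, k₂⟩ := hasTwoJetAt_barrier_im K k μ ζ₁ ζ₀
  -- At an interior maximum the second derivatives in both directions are nonpositive, yet their sum
  -- is positive.
  have e₁ := (k₁.add (j₁.const_mul (C * d ^ (-τ)))).nonpos_of_isLocalMax (hlocu 1)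
  have e₂ := (k₂.add (j₂.const_mul (C * d ^ (-τ)))).nonpos_of_isLocalMax (hlocu Complex.I)
  have h7 : 0 ≤ C * d ^ (-τ) * (c₁ + c₂) :=
    mul_nonneg (mul_nonneg hC.le (Real.rpow_nonneg hd0.le _)) hsum
  have h8 : v ζ₀ / 2 < v ζ₁ := (hR ζ₁ hζ₁).2.2.2
  change _ * v ζ₁ - _ + _ ≤ 0 at e₂
  change -(_ * v ζ₁) - _ + _ ≤ 0 at e₁
  have h9 : (K ^ 2 - k ^ 2) * (v ζ₀ / 2) < (K ^ 2 - k ^ 2) * v ζ₁ :=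
    mul_lt_mul_of_pos_left h8 (by linarith)
  linarith

variable {lam : ℝ → ℝ} {r τ : ℝ}

theorem le_of_isDFExponent (hlam : IsWormProfile lam) (hr : 1 < r)
    (h : IsDFExponent (wormDomain lam r) τ) : 2 * (τ / (1 - τ)) * Real.log r ≤ Real.pi := by
  obtain ⟨hτ0, hτ1, ρ, hρ, hpsh⟩ := h
  by_contra! hlt
  have hl := Real.log_pos hr
  have hτ : 0 < 1 - τ := by linarith
  -- The lower bound on k fits the strip inside the annulus. The upper bound is equivalent to k <
  -- τ(1+k), that is, to strict subharmonicity of the barrier.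
  obtain ⟨k, hk1, hk2⟩ : ∃ k, Real.pi / (2 * Real.log r) < k ∧ k < τ / (1 - τ) :=
    exists_between (by rw [div_lt_iff₀ (by positivity)]; linarith)
  have hk0 : 0 < k := lt_trans (by positivity) hk1
  rw [div_lt_iff₀ (by positivity)] at hk1
  rw [lt_div_iff₀ hτ] at hk2
  have hρ2 : IsDefiningFunction 2 (wormDomain lam r) ρ := hρ.of_le (by norm_cast)
  obtain ⟨ζ₀, C, hC, hζ₀, hle, heq⟩ := exists_touching hlam hr hρ2 hτ1 hk0
    (by linarith : Real.pi < 2 * k * Real.log r)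
  have hev : ∀ᶠ ζ in 𝓝 ζ₀, 2 * k * |ζ.re| < Real.pi / 2 := by
    have : Continuous fun ζ : ℂ => 2 * k * |ζ.re| := by fun_prop
    exact this.continuousAt.eventually (gt_mem_nhds hζ₀)
  refine not_touching (K := τ * (1 + k)) (isOpen_wormDomain hlam r) hρ hpsh ?_ hC ?_ ?_
    (hev.mono hle) heq
  · have : k < τ * (1 + k) := by linarith
    nlinarith
  · refine mul_pos (Real.exp_pos _) (Real.cos_pos_of_mem_Ioo ?_)
    have h1 : |2 * k * ζ₀.re| < Real.pi / 2 := by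
      rwa [abs_mul, abs_of_pos (show 0 < 2 * k by positivity)]
    exact abs_lt.1 h1
  · filter_upwards [hev] with ζ hζ
    rw [leaf_zero]
    refine (annulus_data hlam hr (leaf_bounds hr rfl ?_)).1
    by_contra! hcon
    nlinarith

theorem dfIndex_wormDomain (hlam : IsWormProfile lam) (hr : 1 < r) :
    dfIndex (wormDomain lam r) = Real.pi / (Real.log (r ^ 2) + Real.pi) := by
  have hl := Real.log_pos hr
  have hπ := Real.pi_pos
  have hlog : Real.log (r ^ 2) = 2 * Real.log r := by rw [Real.log_pow]; norm_num
  rw [hlog]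
  have hden : 0 < 2 * Real.log r + Real.pi := by positivity
  have hidx : 0 < Real.pi / (2 * Real.log r + Real.pi) := by positivity
  have hexp : ∀ τ, 0 < τ → τ < Real.pi / (2 * Real.log r + Real.pi) →
      IsDFExponent (wormDomain lam r) τ := by
    intro τ h0 h1
    rw [lt_div_iff₀ hden] at h1
    have hτ1 : τ < 1 := by nlinarith
    refine isDFExponent_wormDomain hlam hr h0 hτ1 ?_
    have : 2 * (τ / (1 - τ)) * Real.log r = 2 * τ * Real.log r / (1 - τ) := by ring
    rw [this, div_lt_iff₀ (by linarith)]
    linarith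
  have hub : ∀ τ, IsDFExponent (wormDomain lam r) τ →
      τ ≤ Real.pi / (2 * Real.log r + Real.pi) := by
    intro τ h
    have h1 := le_of_isDFExponent hlam hr h
    have hτ1 := h.2.1
    have : 2 * (τ / (1 - τ)) * Real.log r = 2 * τ * Real.log r / (1 - τ) := by ring
    rw [this, div_le_iff₀ (by linarith)] at h1
    rw [le_div_iff₀ hden]
    linarith
  refine le_antisymm (csSup_le ⟨_, hexp _ (half_pos hidx) (half_lt_self hidx)⟩ hub) ?_
  refine le_of_forall_lt fun y hy => ?_
  obtain ⟨τ, h1, h2⟩ := exists_between (max_lt hy hidx)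
  exact lt_of_lt_of_le (lt_of_le_of_lt (le_max_left _ _) h1)
    (le_csSup ⟨_, hub⟩ (hexp τ (lt_of_le_of_lt (le_max_right _ _) h1) h2))

end UpperBound

end Worm

theorem mainTheorem5 (lam : ℝ → ℝ) (hlam : Worm.IsWormProfile lam) (r : ℝ) (hr : 1 < r) :
    Worm.IsPseudoconvex (Worm.wormDomain lam r) ∧
    Worm.weaklyPseudoconvexPoints (Worm.wormDomain lam r) =
      {p : ℂ × ℂ | 1 ≤ ‖p.1‖ ∧ ‖p.1‖ ≤ r ∧ p.2 = 0} ∧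
    Worm.dfIndex (Worm.wormDomain lam r) = Real.pi / (Real.log (r ^ 2) + Real.pi) :=
  ⟨Worm.isPseudoconvex_wormDomain hlam hr, Worm.weaklyPseudoconvexPoints_wormDomain hlam hr,
    Worm.dfIndex_wormDomain hlam hr⟩
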